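/- **Setting.** There are two players, $\top$ (the machine) and $\bot$ (the environment). A *move* is a finite string over the keyboard alphabet, a *run* is a finite or infinite sequence of moves labelled by players, and $\neg\Gamma$ is $\Gamma$ with all labels reversed. A *game* $A$ is a set $\mathbf{Lr}^A$ of (legal) runs, containing a run iff it contains all its nonempty finite initial segments, with a function $\mathbf{Wn}^A$ from runs to players such that a run is lost by $\wp$ if it is $\wp$-illegal, i.e. if the last move of its shortest illegal initial segment is $\wp$-labelled. A run $\Omega$ is a $\wp$-*delay* of $\Gamma$ if for each player the two runs have the same subsequence of moves of that player, and whenever the $n$-th $\wp$-labelled move comes after the $k$-th $\neg\wp$-labelled move in $\Gamma$, it does so in $\Omega$. $A$ is *static* if for each $\wp$ and each $\wp$-delay $\Omega$ of $\Gamma$: if $\Gamma$ is not $\wp$-illegal, neither is $\Omega$; if $\Gamma$ is won by $\wp$, so is $\Omega$. **Operations.** $\Gamma^{i.}$ is obtained from $\Gamma$ by keeping only the moves of the form $i.\beta$ and deleting their prefix "$i.$"; for an infinite bitstring $x$, $\Gamma^{\preceq x}$ is obtained by keeping only the moves $u.\beta$ with $u$ a finite initial segment of $x$ and deleting the prefix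 "$u.$". A bitstring is *essentially finite* if it has finitely many $1$s. - $\neg A$: $\Gamma$ is legal iff $\neg\Gamma$ is legal in $A$; a legal $\Gamma$ is won by $\top$ iff $\neg\Gamma$ is won by $\bot$ in $A$. - $A_1\wedge A_2$, $A_1\vee A_2$: $\Gamma$ is legal iff each of its moves is $1.\alpha$ or $2.\alpha$ for some $\alpha$ and each $\Gamma^{i.}$ is legal in $A_i$; a legal $\Gamma$ is won by $\top$ iff $\Gamma^{i.}$ is won by $\top$ in $A_i$ for both $i$ (for $\wedge$), for some $i$ (for $\vee$). - ${\circ\!\!|}^{\aleph_0}A$ (countable branching recurrence) and its dual $\mathrm{co}{\circ\!\!|}^{\aleph_0}A$ (corecurrence): $\Gamma$ is legal iff each of its moves is $w.\alpha$ for a finite bitstring $w$ and some $\alpha$, and $\Gamma^{\preceq x}$ is legal in $A$ for every infinite bitstring $x$; a legal $\Gamma$ is won by $\top$ iff $\Gamma^{\preceq v}$ is won by $\top$ in $A$ for all (for the recurrence), for some (for the corecurrence) infinite essentially finite bitstring $v$. **Machines and validity.** A *machine* (easy-play machine) is a deterministic Turing machine with a read/write work tape and a read-only run tape that always spells the current position;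 in each clock cycle it may make a move (the string spelled on its work tape) or grant permission, and the environment may make at most one, arbitrary, move in a cycle when permission is granted, and none otherwise. It *wins* $A$ if, for each infinite computation branch from the initial configuration (both tapes empty), the run spelled is won by $\top$, and, unless that run is $\bot$-illegal, permission is granted infinitely often. Formulas are built from countably many atoms and negated atoms by $\wedge,\vee,{\circ\!\!|}^{\aleph_0},\mathrm{co}{\circ\!\!|}^{\aleph_0}$, negation of other formulas being the De Morgan abbreviation. An interpretation $^*$ assigns static games to atoms and extends to formulas through the operations. A *uniform solution* of $F$ is a machine that wins $F^*$ for every interpretation $^*$; $F$ is *uniformly valid* if it has one. **The system $\mathbf{CL15}({\circ\!\!|}^{\aleph_0})$.** A *cirquent* consists of a nonempty finite sequence of formulas (whose occurrences are called oformulas) and two nonempty finite sequences of nonempty sets of oformulas, the undergroups and the overgroups, such that every oformula is in at least one undergroup and one overgroup. The axioms are the cirquents with oformulas $\neg F_1,F_1,\dots,\neg F_n,F_n$ ($n\ge1$), undergroups $\{\neg F_i,F_i\}$ and overgroups $\{\neg F_i,F_i\}$ ($i=1,\dots,n$). The rules, each with one premise, are as follows. - *Exchange:* interchange two adjacent oformulas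 (each keeping its memberships), undergroups, or overgroups. - *Duplication:* replace an undergroup (or an overgroup) by two adjacent copies of it. - *Merging:* replace two adjacent overgroups by their union. - *Weakening:* the premise results from the conclusion by removing an oformula $F$ from an undergroup with at least $2$ elements; if $F$ was in no other undergroup, $F$ is also deleted altogether, as are the overgroups that thereby become empty. - *Contraction:* the premise results by replacing an oformula $\mathrm{co}{\circ\!\!|}^{\aleph_0}F$ by two adjacent copies of it, each in the same groups. - *Disjunction introduction:* the premise results by replacing $E\vee F$ by adjacent $E$ and $F$, each in the same groups. - *Conjunction introduction:* the premise results by replacing $E\wedge F$ by adjacent $E$ and $F$, each in the same overgroups, and each undergroup $\{E\wedge F\}\cup\Delta$ (with $E\wedge F\notin\Delta$) by two adjacent undergroups $\{E\}\cup\Delta$ and $\{F\}\cup\Delta$. - *Recurrence introduction:* the premise results by replacing ${\circ\!\!|}^{\aleph_0}F$ by $F$ in the same groups and inserting a new overgroup $\{F\}$. - *Corecurrence introduction:* the premise results by replacing $\mathrm{co}{\circ\!\!|}^{\aleph_0}F$ by $F$ in the same groups and adding $F$ to any (possibly zero) number of the existing overgroups. A *proof* of a cirquent $C$ is a finite sequence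 of cirquents that starts with an axiom, ends with $C$, and in which each cirquent but the first follows from the preceding one by a rule. A *proof of a formula* $F$ is a proof of the cirquent with the single oformula $F$, one undergroup $\{F\}$ and one overgroup $\{F\}$. **Theorem.** Every formula $F$ provable in $\mathbf{CL15}({\circ\!\!|}^{\aleph_0})$ is uniformly valid. Furthermore, there is an effective procedure (a computable function from finite sequences of cirquents to machines) that takes any $\mathbf{CL15}({\circ\!\!|}^{\aleph_0})$-proof of any formula $F$ to a uniform solution of $F$. -/

import Mathlib

namespace CoL

/-! ### Players, moves, runs -/

/-- The two players: `top` is the machine, `bot` is its environment. -/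
inductive Player where
  | top
  | bot
  deriving DecidableEq

/-- The adversary of a player. -/
def Player.neg : Player → Player
  | .top => .bot
  | .bot => .top

/-- The keyboard alphabet: the 95 printable ASCII characters, numbered from the blank space
(ASCII code 32) on. -/
abbrev Key := Fin 95

/-- The character `.` (ASCII 46). -/
def Key.dot : Key := 14

/-- The bits `0` (ASCII 48) and `1` (ASCII 49) as characters. -/
def Key.bit (b : Bool) : Key := if b then 17 else 16

/-- The digit `1` (ASCII 49) for `false` and `2` (ASCII 50) for `true`: the names of the left and
of the right component of a parallel combination. -/
def Key.side (b : Bool) : Key := if b then 18 else 17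

/-- A move is a finite string over the keyboard alphabet. -/
abbrev Move := List Key

/-- A labmove is a move labelled by the player who makes it. -/
abbrev LabMove := Player × Move

/-- A run is a finite or infinite sequence of labmoves. -/
abbrev Run := Stream'.Seq LabMove

/-- A finite run (a position) as a run. -/
abbrev pos (l : List LabMove) : Run := Stream'.Seq.ofList l

/-- The finite or infinite sequence whose `i`-th entry is the `i`-th entry of the first list of
`p 0, p 1, p 2, …` that has one. For lists each of which is an initial segment of the next, this is
the sequence that they converge to. -/
noncomputable def limitRun (p : ℕ → List LabMove) : Run :=
  open Classical in
  ⟨fun i => if h : ∃ n, i < (p n).length then (p (Nat.find h))[i]? else none, by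
    intro i hi
    have h : ¬ ∃ n, i < (p n).length := by
      intro h
      simp only [dif_pos h] at hi
      have := Nat.find_spec h
      rw [List.getElem?_eq_none_iff] at hi
      omega
    have h' : ¬ ∃ n, i + 1 < (p n).length := fun ⟨n, hn⟩ => h ⟨n, by omega⟩
    simp only [dif_neg h']⟩

/-- Apply `g` to every labmove of a run, deleting those on which `g` is undefined. -/
noncomputable def Run.filterMap (g : LabMove → Option LabMove) (Γ : Run) : Run :=
  limitRun fun n => (Γ.take n).filterMap g

/-- `¬Γ`: all labels changed to their opposites. -/
def Run.neg (Γ : Run) : Run := Stream'.Seq.map (fun m => (m.1.neg, m.2)) Γ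

/-- `Γ^{α}`: only the moves of the form `αβ` are kept, and the prefix `α` is deleted in them. -/
noncomputable def Run.strip (α : Move) (Γ : Run) : Run :=
  Run.filterMap (fun m => if α <+: m.2 then some (m.1, m.2.drop α.length) else none) Γ

/-- If the move is `u.β` for a finite initial segment `u` of the infinite bitstring `x`, return
`β`. -/
def threadMove : (ℕ → Bool) → Move → Option Move
  | _, [] => none
  | x, c :: m =>
    if c = Key.dot then some m
    else if c = Key.bit (x 0) then threadMove (fun n => x (n + 1)) m
    else none

/-- `Γ^{≼x}`: only the moves of the form `u.β` with `u` a finite initial segment of `x` are kept,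
and the prefix `u.` is deleted in them. -/
noncomputable def Run.thread (x : ℕ → Bool) (Γ : Run) : Run :=
  Run.filterMap (fun m => (threadMove x m.2).map fun β => (m.1, β)) Γ

/-- An infinite bitstring is essentially finite if it contains only finitely many `1`s. -/
def EssFinite (x : ℕ → Bool) : Prop := {n | x n = true}.Finite

/-! ### Games -/

/-- `Lr` satisfies the condition on sets of legal runs: a run is in it iff so are all its nonempty
finite initial segments. -/
def IsLegalSet (Lr : Set Run) : Prop :=
  ∀ Γ : Run, Γ ∈ Lr ↔ ∀ n, Γ.take n ≠ [] → pos (Γ.take n) ∈ Lr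

/-- `Γ` is `p`-illegal: the last move of its shortest illegal initial segment (the one of length
`n + 1`) is `p`-labelled. -/
def IllegalBy (Lr : Set Run) (p : Player) (Γ : Run) : Prop :=
  ∃ n α, Γ.get? n = some (p, α) ∧ (∀ k ≤ n, pos (Γ.take k) ∈ Lr) ∧ pos (Γ.take (n + 1)) ∉ Lr

/-- A (constant) game. -/
structure Game where
  Lr : Set Run
  Wn : Run → Player
  legal : IsLegalSet Lr
  wn_illegal : ∀ p Γ, IllegalBy Lr p Γ → Wn Γ = p.neg

/-- `Γ` is a `p`-illegal run of `A`. -/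
def Game.Illegal (A : Game) (p : Player) (Γ : Run) : Prop := IllegalBy A.Lr p Γ

theorem IllegalBy.unique {Lr : Set Run} {p q : Player} {Γ : Run}
    (hp : IllegalBy Lr p Γ) (hq : IllegalBy Lr q Γ) : p = q := by
  obtain ⟨n, α, hn, h1, h2⟩ := hp
  obtain ⟨k, β, hk, h3, h4⟩ := hq
  have : n = k := by
    rcases lt_trichotomy n k with h | h | h
    · exact absurd (h3 (n + 1) h) h2
    · exact h
    · exact absurd (h1 (k + 1) h) h4
  subst this
  rw [hn] at hk
  simp only [Option.some.injEq, Prod.mk.injEq] at hk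
  exact hk.1

theorem IllegalBy.notMem {Lr : Set Run} (hL : IsLegalSet Lr) {p : Player} {Γ : Run}
    (hp : IllegalBy Lr p Γ) : Γ ∉ Lr := by
  obtain ⟨n, α, hn, -, h2⟩ := hp
  intro hΓ
  refine h2 ((hL Γ).1 hΓ (n + 1) ?_)
  cases Γ using Stream'.Seq.recOn with
  | nil => simp at hn
  | cons a s => simp

/-- The game with the given legal runs in which a legal run `Ω` is won by `top` iff `W Ω`; illegal
runs are lost by the player who has made the first illegal move. -/
noncomputable def Game.ofWins (Lr : Set Run) (hL : IsLegalSet Lr) (W : Run → Prop) : Game :=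
  open Classical in
  { Lr := Lr
    Wn := fun Γ =>
      if Γ ∈ Lr then (if W Γ then .top else .bot)
      else if IllegalBy Lr .bot Γ then .top else .bot
    legal := hL
    wn_illegal := by
      intro p Γ h
      simp only [if_neg (h.notMem hL)]
      cases p with
      | bot => simp [h, Player.neg]
      | top =>
        have : ¬ IllegalBy Lr .bot Γ := fun h' => by simpa using h.unique h'
        simp [this, Player.neg] }

/-! ### Facts needed to see that the operations below yield games -/

theorem pos_take (l : List LabMove) (n : ℕ) : (pos l).take n = l.take n := by
  apply List.ext_getElem?
  intro i
  rw [Stream'.Seq.getElem?_take, Stream'.Seq.ofList_get?, List.getElem?_take]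

theorem take_take_run (Γ : Run) {n k : ℕ} (h : n ≤ k) : (Γ.take k).take n = Γ.take n := by
  apply List.ext_getElem?
  intro i
  rw [List.getElem?_take, Stream'.Seq.getElem?_take, Stream'.Seq.getElem?_take]
  split_ifs <;> first | rfl | omega

theorem take_prefix_run (Γ : Run) {n k : ℕ} (h : n ≤ k) : Γ.take n <+: Γ.take k := by
  rw [← take_take_run Γ h]
  exact List.take_prefix _ _

theorem limitRun_get? {p : ℕ → List LabMove} (hp : ∀ n k, n ≤ k → p n <+: p k) {n i : ℕ}
    (h : i < (p n).length) : (limitRun p).get? i = (p n)[i]? := by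
  classical
  have hex : ∃ n, i < (p n).length := ⟨n, h⟩
  have h1 : (limitRun p).get? i = (p (Nat.find hex))[i]? := by
    simp only [limitRun, Stream'.Seq.get?]
    exact dif_pos hex
  rw [h1]
  obtain ⟨t, ht⟩ := hp _ _ (Nat.find_min' hex h)
  rw [← ht, List.getElem?_append_left (Nat.find_spec hex)]

theorem limitRun_get?_none {p : ℕ → List LabMove} {i : ℕ}
    (h : ¬ ∃ n, i < (p n).length) : (limitRun p).get? i = none := by
  simp only [limitRun, Stream'.Seq.get?]
  exact dif_neg h

theorem limitRun_take {p : ℕ → List LabMove} (hp : ∀ n k, n ≤ k → p n <+: p k) {n k : ℕ}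
    (h : k ≤ (p n).length) : (limitRun p).take k = (p n).take k := by
  apply List.ext_getElem?
  intro i
  rw [Stream'.Seq.getElem?_take, List.getElem?_take]
  split_ifs with hi
  · exact limitRun_get? hp (by omega)
  · rfl

theorem IsLegalSet.nil_mem {Lr : Set Run} (hL : IsLegalSet Lr) : pos [] ∈ Lr :=
  (hL _).2 fun n h => absurd (by simp) h

theorem IsLegalSet.take_mem {Lr : Set Run} (hL : IsLegalSet Lr) {Γ : Run} (h : Γ ∈ Lr) (n : ℕ) :
    pos (Γ.take n) ∈ Lr := by
  by_cases h0 : Γ.take n = []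
  · rw [h0]; exact hL.nil_mem
  · exact (hL Γ).1 h n h0

theorem IsLegalSet.limitRun_mem {Lr : Set Run} (hL : IsLegalSet Lr) {p : ℕ → List LabMove}
    (hp : ∀ n k, n ≤ k → p n <+: p k) : limitRun p ∈ Lr ↔ ∀ n, pos (p n) ∈ Lr := by
  constructor
  · intro h n
    have := hL.take_mem h (p n).length
    rwa [limitRun_take hp le_rfl, List.take_length] at this
  · intro h
    refine (hL _).2 fun n hn => ?_
    set l := (limitRun p).take n with hl
    have hlen : 0 < l.length := List.length_pos_iff.2 hn
    have hle : l.length ≤ n := by rw [hl]; exact Stream'.Seq.length_take_le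
    have hget : l[l.length - 1]? = (limitRun p).get? (l.length - 1) := by
      have h1 : l.length - 1 < n := by omega
      conv_lhs => rw [hl, Stream'.Seq.getElem?_take]
      rw [if_pos h1]
    have hex : ∃ m, l.length - 1 < (p m).length := by
      by_contra hne
      rw [limitRun_get?_none hne, List.getElem?_eq_none_iff] at hget
      omega
    obtain ⟨m, hm⟩ := hex
    have h2 : l = (p m).take l.length := by
      rw [← limitRun_take hp (by omega), ← take_take_run (limitRun p) hle, ← hl, List.take_length]
    rw [h2]
    have := hL.take_mem (h m) l.length
    rwa [pos_take] at this

theorem filterMap_prefix (g : LabMove → Option LabMove) (Γ : Run) (n k : ℕ) (h : n ≤ k) :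
    (Γ.take n).filterMap g <+: (Γ.take k).filterMap g :=
  (take_prefix_run Γ h).filterMap g

theorem IsLegalSet.filterMap_mem {Lr : Set Run} (hL : IsLegalSet Lr)
    (g : LabMove → Option LabMove) (Γ : Run) :
    Run.filterMap g Γ ∈ Lr ↔ ∀ n, pos ((Γ.take n).filterMap g) ∈ Lr :=
  hL.limitRun_mem (filterMap_prefix g Γ)

theorem isLegalSet_parallel {ι : Type*} (ok : Move → Prop)
    (g : ι → LabMove → Option LabMove) (Lr : ι → Set Run) (hL : ∀ i, IsLegalSet (Lr i)) :
    IsLegalSet {Γ : Run | (∀ n m, Γ.get? n = some m → ok m.2) ∧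
      ∀ i, Run.filterMap (g i) Γ ∈ Lr i} := by
  intro Γ
  simp only [Set.mem_ofPred_eq, (hL _).filterMap_mem, pos_take, Stream'.Seq.ofList_get?]
  constructor
  · rintro ⟨h1, h2⟩ n -
    refine ⟨fun k m hk => ?_, fun i k => ?_⟩
    · rw [Stream'.Seq.getElem?_take] at hk
      split_ifs at hk
      exact h1 k m hk
    · rcases le_total k n with h | h
      · rw [take_take_run Γ h]; exact h2 i k
      · rw [List.take_of_length_le (Stream'.Seq.length_take_le.trans h)]; exact h2 i n
  · intro h
    refine ⟨fun n m hn => ?_, fun i n => ?_⟩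
    · have h3 : (Γ.take (n + 1))[n]? = some m := by
        rw [Stream'.Seq.getElem?_take, if_pos (Nat.lt_succ_self n), hn]
      exact (h (n + 1) (by rintro h0; simp [h0] at h3)).1 n m h3
    · by_cases h0 : Γ.take n = []
      · rw [h0]; exact (hL i).nil_mem
      · have := (h n h0).2 i n
        rwa [take_take_run Γ le_rfl] at this

theorem neg_take (Γ : Run) (n : ℕ) :
    Γ.neg.take n = (Γ.take n).map fun m => (m.1.neg, m.2) := by
  apply List.ext_getElem?
  intro i
  rw [List.getElem?_map, Stream'.Seq.getElem?_take, Stream'.Seq.getElem?_take, Run.neg,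
    Stream'.Seq.map_get?]
  split_ifs <;> rfl

theorem neg_pos (l : List LabMove) :
    (pos l).neg = pos (l.map fun m => (m.1.neg, m.2)) := by
  ext1 i
  simp [Run.neg]

theorem isLegalSet_neg {Lr : Set Run} (hL : IsLegalSet Lr) :
    IsLegalSet {Γ : Run | Γ.neg ∈ Lr} := by
  intro Γ
  simp only [Set.mem_ofPred_eq, neg_pos, ← neg_take]
  rw [hL]
  simp [neg_take]

/-! ### Game operations -/

/-- Negation. -/
noncomputable def Game.neg (A : Game) : Game :=
  Game.ofWins {Γ | Γ.neg ∈ A.Lr} (isLegalSet_neg A.legal) fun Ω => A.Wn Ω.neg = .bot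

/-- The legal runs of the parallel combinations of `A false` and `A true`: every move is `1.α` or
`2.α`, and the moves in either component form a legal run of it. -/
def parallelLr (A : Bool → Game) : Set Run :=
  {Γ | (∀ n m, Γ.get? n = some m → ∃ i α, m.2 = [Key.side i, Key.dot] ++ α) ∧
    ∀ i, Γ.strip [Key.side i, Key.dot] ∈ (A i).Lr}

theorem isLegalSet_parallelLr (A : Bool → Game) : IsLegalSet (parallelLr A) :=
  isLegalSet_parallel (fun m => ∃ i α, m = [Key.side i, Key.dot] ++ α)
    (fun i m => if [Key.side i, Key.dot] <+: m.2
      then some (m.1, m.2.drop [Key.side i, Key.dot].length) else none)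
    (fun i => (A i).Lr) fun i => (A i).legal

/-- Parallel conjunction. -/
noncomputable def Game.conj (A₁ A₂ : Game) : Game :=
  let A : Bool → Game := fun i => if i then A₂ else A₁
  Game.ofWins (parallelLr A) (isLegalSet_parallelLr A) fun Ω =>
    ∀ i, (A i).Wn (Ω.strip [Key.side i, Key.dot]) = .top

/-- Parallel disjunction. -/
noncomputable def Game.disj (A₁ A₂ : Game) : Game :=
  let A : Bool → Game := fun i => if i then A₂ else A₁
  Game.ofWins (parallelLr A) (isLegalSet_parallelLr A) fun Ω =>
    ∃ i, (A i).Wn (Ω.strip [Key.side i, Key.dot]) = .top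

/-- The legal runs of the branching (co)recurrence of `A`: every move is `w.α` for a finite
bitstring `w`, and the run in each thread `x`, an arbitrary infinite bitstring, is legal. -/
def branchingLr (A : Game) : Set Run :=
  {Γ | (∀ n m, Γ.get? n = some m → ∃ (w : List Bool) (α : Move),
      m.2 = w.map Key.bit ++ [Key.dot] ++ α) ∧
    ∀ x : ℕ → Bool, Γ.thread x ∈ A.Lr}

theorem isLegalSet_branchingLr (A : Game) : IsLegalSet (branchingLr A) :=
  isLegalSet_parallel
    (fun m => ∃ (w : List Bool) (α : Move), m = w.map Key.bit ++ [Key.dot] ++ α)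
    (fun x m => (threadMove x m.2).map fun β => (m.1, β))
    (fun _ => A.Lr) fun _ => A.legal

/-- Countable branching recurrence. -/
noncomputable def Game.recur (A : Game) : Game :=
  Game.ofWins (branchingLr A) (isLegalSet_branchingLr A) fun Ω =>
    ∀ x, EssFinite x → A.Wn (Ω.thread x) = .top

/-- Countable branching corecurrence. -/
noncomputable def Game.corecur (A : Game) : Game :=
  Game.ofWins (branchingLr A) (isLegalSet_branchingLr A) fun Ω =>
    ∃ x, EssFinite x ∧ A.Wn (Ω.thread x) = .top

/-! ### Static games -/

/-- The subsequence of the `p`-labelled moves of a run. -/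
noncomputable def Run.movesOf (p : Player) (Γ : Run) : Run :=
  Run.filterMap (fun m => if m.1 = p then some m else none) Γ

/-- The `n`-th (counting from `0`) `p`-labelled move of `Γ` stands at place `i`. -/
def Run.IsNth (Γ : Run) (p : Player) (n i : ℕ) : Prop :=
  (∃ α, Γ.get? i = some (p, α)) ∧ (Γ.take i).countP (fun m => m.1 = p) = n

/-- `Ω` is a `p`-delay of `Γ`. -/
def IsDelay (p : Player) (Ω Γ : Run) : Prop :=
  (∀ q, Ω.movesOf q = Γ.movesOf q) ∧
  ∀ n k i j i' j', Γ.IsNth p n i → Γ.IsNth p.neg k j → Ω.IsNth p n i' → Ω.IsNth p.neg k j' →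
    j < i → j' < i'

/-- Static games. -/
def Game.Static (A : Game) : Prop :=
  ∀ p Ω Γ, IsDelay p Ω Γ →
    (¬ A.Illegal p Γ → ¬ A.Illegal p Ω) ∧ (A.Wn Γ = p → A.Wn Ω = p)

/-! ### Formulas -/

/-- `(¬,∧,∨,⫰,⫯)`-formulas over the atoms `0, 1, 2, …`, with negation on atoms only. -/
inductive Formula where
  | atom (P : ℕ)
  | natom (P : ℕ)
  | conj (F G : Formula)
  | disj (F G : Formula)
  | recur (F : Formula)
  | corecur (F : Formula)
  deriving DecidableEq

/-- The formula that `¬F` abbreviates. -/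
def Formula.neg : Formula → Formula
  | .atom P => .natom P
  | .natom P => .atom P
  | .conj F G => .disj F.neg G.neg
  | .disj F G => .conj F.neg G.neg
  | .recur F => .corecur F.neg
  | .corecur F => .recur F.neg

/-- An interpretation sends every atom to a static game. -/
abbrev Interpretation := ℕ → {A : Game // A.Static}

/-- The game `F*`. -/
noncomputable def Formula.interp (I : Interpretation) : Formula → Game
  | .atom P => (I P).1
  | .natom P => (I P).1.neg
  | .conj F G => (F.interp I).conj (G.interp I)
  | .disj F G => (F.interp I).disj (G.interp I)
  | .recur F => (F.interp I).recur
  | .corecur F => (F.interp I).corecur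

/-- Gödel number of a formula. -/
def Formula.toNat : Formula → ℕ
  | .atom P => 6 * P
  | .natom P => 6 * P + 1
  | .conj F G => 6 * Nat.pair F.toNat G.toNat + 2
  | .disj F G => 6 * Nat.pair F.toNat G.toNat + 3
  | .recur F => 6 * F.toNat + 4
  | .corecur F => 6 * F.toNat + 5

/-- The formula with a given Gödel number. -/
def Formula.ofNat (n : ℕ) : Formula :=
  if n % 6 = 0 then .atom (n / 6)
  else if n % 6 = 1 then .natom (n / 6)
  else if n % 6 = 2 then .conj (ofNat (n / 6).unpair.1) (ofNat (n / 6).unpair.2)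
  else if n % 6 = 3 then .disj (ofNat (n / 6).unpair.1) (ofNat (n / 6).unpair.2)
  else if n % 6 = 4 then .recur (ofNat (n / 6))
  else .corecur (ofNat (n / 6))
termination_by n
decreasing_by
  all_goals
    have h1 := (n / 6).unpair_left_le
    have h2 := (n / 6).unpair_right_le
    omega

theorem Formula.ofNat_toNat (F : Formula) : ofNat F.toNat = F := by
  induction F with
  | atom P => rw [toNat, ofNat]; simp
  | natom P =>
    rw [toNat, ofNat]
    have h1 : (6 * P + 1) % 6 = 1 := by omega
    have h2 : (6 * P + 1) / 6 = P := by omega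
    simp [h1, h2]
  | conj F G hF hG =>
    rw [toNat, ofNat]
    have h1 : (6 * Nat.pair F.toNat G.toNat + 2) % 6 = 2 := by omega
    have h2 : (6 * Nat.pair F.toNat G.toNat + 2) / 6 = Nat.pair F.toNat G.toNat := by omega
    simp [h1, h2, hF, hG]
  | disj F G hF hG =>
    rw [toNat, ofNat]
    have h1 : (6 * Nat.pair F.toNat G.toNat + 3) % 6 = 3 := by omega
    have h2 : (6 * Nat.pair F.toNat G.toNat + 3) / 6 = Nat.pair F.toNat G.toNat := by omega
    simp [h1, h2, hF, hG]
  | recur F hF =>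
    rw [toNat, ofNat]
    have h1 : (6 * F.toNat + 4) % 6 = 4 := by omega
    have h2 : (6 * F.toNat + 4) / 6 = F.toNat := by omega
    simp [h1, h2, hF]
  | corecur F hF =>
    rw [toNat, ofNat]
    have h1 : (6 * F.toNat + 5) % 6 = 5 := by omega
    have h2 : (6 * F.toNat + 5) / 6 = F.toNat := by omega
    simp [h1, h2, hF]

theorem Formula.toNat_ofNat (n : ℕ) : (ofNat n).toNat = n := by
  induction n using Nat.strong_induction_on with
  | _ n ih =>
    have h1 := (n / 6).unpair_left_le
    have h2 := (n / 6).unpair_right_le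
    rw [ofNat]
    split_ifs with h0 h1' h2' h3 h4
    · rw [toNat]; omega
    · rw [toNat]; omega
    · rw [toNat, ih _ (by omega), ih _ (by omega), Nat.pair_unpair]; omega
    · rw [toNat, ih _ (by omega), ih _ (by omega), Nat.pair_unpair]; omega
    · rw [toNat, ih _ (by omega)]; omega
    · rw [toNat, ih _ (by omega)]; omega

/-- The Gödel numbering of formulas. -/
def Formula.equivNat : Formula ≃ ℕ :=
  ⟨Formula.toNat, Formula.ofNat, Formula.ofNat_toNat, Formula.toNat_ofNat⟩

instance : Primcodable Formula := Primcodable.ofEquiv ℕ Formula.equivNat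

/-! ### Cirquents and the system CL15 -/

/-- A group is a set of oformulas, given by its characteristic vector: its `i`-th entry tells
whether the group contains the `i`-th oformula. -/
abbrev Group := List Bool

/-- The data of a cirquent: oformulas, undergroups and overgroups. -/
structure Cirquent where
  forms : List Formula
  ugroups : List Group
  ogroups : List Group

/-- The requirements on cirquents: there are oformulas, undergroups and overgroups, each group is
a nonempty set of oformulas, and every oformula is in some undergroup and in some overgroup. -/
structure Cirquent.WellFormed (C : Cirquent) : Prop where
  forms_ne : C.forms ≠ []
  under_ne : C.ugroups ≠ []
  over_ne : C.ogroups ≠ []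
  under_group : ∀ X ∈ C.ugroups, X.length = C.forms.length ∧ true ∈ X
  over_group : ∀ X ∈ C.ogroups, X.length = C.forms.length ∧ true ∈ X
  mem_under : ∀ i < C.forms.length, ∃ X ∈ C.ugroups, X[i]? = some true
  mem_over : ∀ i < C.forms.length, ∃ X ∈ C.ogroups, X[i]? = some true

/-- The Gödel numbering of cirquents is that of triples of lists. -/
def Cirquent.equivProd : Cirquent ≃ List Formula × List Group × List Group :=
  ⟨fun C => (C.forms, C.ugroups, C.ogroups), fun p => ⟨p.1, p.2.1, p.2.2⟩, fun _ => rfl, fun _ => rfl⟩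

instance : Primcodable Cirquent := Primcodable.ofEquiv _ Cirquent.equivProd

/-- Interchange the entries number `i` and `i + 1` of a list. -/
def swapAt {α : Type} : ℕ → List α → List α
  | 0, a :: b :: l => b :: a :: l
  | i + 1, a :: l => a :: swapAt i l
  | _, l => l

/-- Replace the entry number `i` of a list by two copies of it. -/
def dupAt {α : Type} : ℕ → List α → List α
  | 0, a :: l => a :: a :: l
  | i + 1, a :: l => a :: dupAt i l
  | _, l => l

/-- The group, in a cirquent with `k` oformulas, that contains the `i`-th oformula only. -/
def soleGroup (k i : ℕ) : Group := (List.replicate k false).set i true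

/-- The undergroups of the premise of Conjunction introduction that come from the undergroup `X` of
the conclusion when the `i`-th oformula is split. -/
def splitUnder (i : ℕ) (X : Group) : List Group :=
  if X[i]? = some true then [(dupAt i X).set (i + 1) false, (dupAt i X).set i false]
  else [dupAt i X]

/-- The axioms: each `¬F, F` for `F` in a nonempty list, with one undergroup and one overgroup for
each such pair. -/
def IsAxiom (C : Cirquent) : Prop :=
  ∃ L : List Formula, L ≠ [] ∧
    C.forms = L.flatMap (fun F => [F.neg, F]) ∧
    C.ugroups = (List.range L.length).map
      (fun j => (List.range (2 * L.length)).map fun a => decide (a / 2 = j)) ∧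
    C.ogroups = C.ugroups

/-- `Infer A B`: the conclusion `B` follows from the premise `A` by one of the rules other than
Axiom. -/
inductive Infer : Cirquent → Cirquent → Prop
  | oformulaExchange (Fs Gs : List Formula) (E F : Formula) (U O : List Group) :
      Infer ⟨Fs ++ E :: F :: Gs, U, O⟩
        ⟨Fs ++ F :: E :: Gs, U.map (swapAt Fs.length), O.map (swapAt Fs.length)⟩
  | underExchange (Fs : List Formula) (U V : List Group) (X Y : Group) (O : List Group) :
      Infer ⟨Fs, U ++ X :: Y :: V, O⟩ ⟨Fs, U ++ Y :: X :: V, O⟩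
  | overExchange (Fs : List Formula) (U O Q : List Group) (X Y : Group) :
      Infer ⟨Fs, U, O ++ X :: Y :: Q⟩ ⟨Fs, U, O ++ Y :: X :: Q⟩
  | underDuplication (Fs : List Formula) (U V : List Group) (X : Group) (O : List Group) :
      Infer ⟨Fs, U ++ X :: V, O⟩ ⟨Fs, U ++ X :: X :: V, O⟩
  | overDuplication (Fs : List Formula) (U O Q : List Group) (X : Group) :
      Infer ⟨Fs, U, O ++ X :: Q⟩ ⟨Fs, U, O ++ X :: X :: Q⟩
  | merging (Fs : List Formula) (U O Q : List Group) (X Y : Group) :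
      Infer ⟨Fs, U, O ++ X :: Y :: Q⟩ ⟨Fs, U, O ++ List.zipWith or X Y :: Q⟩
  /-- Weakening, when the `i`-th oformula is also in another undergroup than `X`. -/
  | weakeningArc (Fs : List Formula) (U V : List Group) (X : Group) (O : List Group) (i : ℕ)
      (hi : X[i]? = some true) (hX : 2 ≤ X.count true)
      (h : ∃ Y ∈ U ++ V, Y[i]? = some true) :
      Infer ⟨Fs, U ++ X.set i false :: V, O⟩ ⟨Fs, U ++ X :: V, O⟩
  /-- Weakening, when `X` is the only undergroup that contains the `i`-th oformula. -/
  | weakeningDelete (Fs : List Formula) (U V : List Group) (X : Group) (O : List Group) (i : ℕ)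
      (hi : X[i]? = some true) (hX : 2 ≤ X.count true)
      (h : ∀ Y ∈ U ++ V, Y[i]? ≠ some true) :
      Infer
        ⟨Fs.eraseIdx i, (U ++ X :: V).map (fun Y => Y.eraseIdx i),
          (O.map (fun Y => Y.eraseIdx i)).filter (fun Y => true ∈ Y)⟩
        ⟨Fs, U ++ X :: V, O⟩
  | contraction (Fs Gs : List Formula) (F : Formula) (U O : List Group) :
      Infer
        ⟨Fs ++ .corecur F :: .corecur F :: Gs, U.map (dupAt Fs.length), O.map (dupAt Fs.length)⟩
        ⟨Fs ++ .corecur F :: Gs, U, O⟩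
  | disjIntro (Fs Gs : List Formula) (E F : Formula) (U O : List Group) :
      Infer ⟨Fs ++ E :: F :: Gs, U.map (dupAt Fs.length), O.map (dupAt Fs.length)⟩
        ⟨Fs ++ .disj E F :: Gs, U, O⟩
  | conjIntro (Fs Gs : List Formula) (E F : Formula) (U O : List Group) :
      Infer ⟨Fs ++ E :: F :: Gs, U.flatMap (splitUnder Fs.length), O.map (dupAt Fs.length)⟩
        ⟨Fs ++ .conj E F :: Gs, U, O⟩
  | recurIntro (Fs Gs : List Formula) (F : Formula) (U O Q : List Group) :
      Infer
        ⟨Fs ++ F :: Gs, U, O ++ soleGroup (Fs ++ F :: Gs).length Fs.length :: Q⟩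
        ⟨Fs ++ .recur F :: Gs, U, O ++ Q⟩
  | corecurIntro (Fs Gs : List Formula) (F : Formula) (U O Q : List Group)
      (h : List.Forall₂ (fun X Y => X = Y ∨ X = Y.set Fs.length true) Q O) :
      Infer ⟨Fs ++ F :: Gs, U, Q⟩ ⟨Fs ++ .corecur F :: Gs, U, O⟩

/-- `L` is a proof of the cirquent `C`. -/
def IsCirquentProof (L : List Cirquent) (C : Cirquent) : Prop :=
  (∀ D ∈ L, D.WellFormed) ∧ (∃ D, L.head? = some D ∧ IsAxiom D) ∧ L.IsChain Infer ∧
    L.getLast? = some C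

/-- The cirquent `F♣` with the single oformula `F`, one undergroup and one overgroup. -/
def Formula.club (F : Formula) : Cirquent := ⟨[F], [[true]], [[true]]⟩

/-- `L` is a proof of the formula `F`. -/
def IsProof (L : List Cirquent) (F : Formula) : Prop := IsCirquentProof L F.club

/-- Provability of a formula. -/
def Provable (F : Formula) : Prop := ∃ L, IsProof L F

/-! ### Easy-play machines -/

/-- Movement of a scanning head. -/
inductive Shift where
  | left
  | stay
  | right
  deriving DecidableEq

/-- What a machine does in a clock cycle besides its work on the tapes: nothing, making a move, or
granting permission. -/
inductive Action where
  | idle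
  | move
  | permit
  deriving DecidableEq

/-- The symbols on the run tape: `none` is the blank, and the others are the labels and the
characters of the keyboard alphabet. -/
abbrev RunSymbol := Option (Player ⊕ Key)

/-- The right-hand side of an instruction: the new state, the symbol to be written on the work
tape, the movements of the work tape head and of the run tape head, and the action. -/
structure Instr where
  next : ℕ
  write : ℕ
  workShift : Shift
  runShift : Shift
  action : Action

/-- An easy-play machine is given by the finite table of its transition function. States and work
tape symbols are natural numbers, of which only those in the table matter; `0` is the start state
and the blank symbol of the work tape. An instruction is selected by the state, the scanned work
tape symbol and the scanned run tape symbol. -/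
abbrev EPM := List ((ℕ × ℕ × RunSymbol) × Instr)

/-- The Gödel numbering of players. -/
def Player.equivBool : Player ≃ Bool :=
  ⟨fun p => match p with | .top => true | .bot => false,
    fun b => if b then .top else .bot, by rintro (_ | _) <;> rfl, by rintro (_ | _) <;> rfl⟩

instance : Primcodable Player := Primcodable.ofEquiv Bool Player.equivBool

/-- The Gödel numbering of head movements. -/
def Shift.equivOption : Shift ≃ Option Bool :=
  ⟨fun s => match s with | .left => some false | .stay => none | .right => some true,
    fun o => match o with | some false => .left | none => .stay | some true => .right,
    by rintro (_ | _ | _) <;> rfl, by rintro (_ | _ | _) <;> rfl⟩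

instance : Primcodable Shift := Primcodable.ofEquiv (Option Bool) Shift.equivOption

/-- The Gödel numbering of actions. -/
def Action.equivOption : Action ≃ Option Bool :=
  ⟨fun s => match s with | .idle => none | .move => some false | .permit => some true,
    fun o => match o with | none => .idle | some false => .move | some true => .permit,
    by rintro (_ | _ | _) <;> rfl, by rintro (_ | _ | _) <;> rfl⟩

instance : Primcodable Action := Primcodable.ofEquiv (Option Bool) Action.equivOption

/-- The Gödel numbering of instructions is that of quintuples. -/
def Instr.equivProd : Instr ≃ ℕ × ℕ × Shift × Shift × Action :=
  ⟨fun i => (i.next, i.write, i.workShift, i.runShift, i.action),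
    fun p => ⟨p.1, p.2.1, p.2.2.1, p.2.2.2.1, p.2.2.2.2⟩, fun _ => rfl, fun _ => rfl⟩

instance : Primcodable Instr := Primcodable.ofEquiv _ Instr.equivProd

/-- A configuration: the state, the work tape with its head, the place of the run tape head, and
the position spelled on the run tape. -/
structure Config where
  state : ℕ
  work : Turing.Tape ℕ
  runHead : ℕ
  position : List LabMove

/-- The content of the run tape: the labmoves of the position one after another, each spelled as its
label followed by the characters of its move. -/
def spell (Φ : List LabMove) : List (Player ⊕ Key) :=
  Φ.flatMap fun m => .inl m.1 :: m.2.map .inr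

/-- The run tape symbol that is scanned. -/
def Config.scan (c : Config) : RunSymbol := (spell c.position)[c.runHead]?

/-- The instruction (the first one of the table) that applies to a configuration. -/
def EPM.instr (M : EPM) (c : Config) : Option Instr :=
  List.lookup (c.state, c.work.head, c.scan) M

/-- The move spelled by a list of work tape symbols: the symbol `k + 1` with `k < 95` stands for the
`k`-th character, and the move ends before the first symbol that does not stand for a character. -/
def readMove : List ℕ → Move
  | 0 :: _ => []
  | (k + 1) :: l => if h : k < 95 then ⟨k, h⟩ :: readMove l else []
  | [] => []

theorem readMove_replicate (n : ℕ) : readMove (List.replicate n 0) = [] := by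
  cases n <;> simp [List.replicate_succ, readMove]

theorem readMove_append (l : List ℕ) (n : ℕ) :
    readMove (l ++ List.replicate n 0) = readMove l := by
  induction l with
  | nil => simp [readMove_replicate, readMove]
  | cons a l ih =>
    cases a with
    | zero => simp [readMove]
    | succ k => simp [readMove, ih]

/-- The move spelled by the work tape from the scanned cell to the right. -/
def Config.spelledMove (c : Config) : Move :=
  c.work.right₀.liftOn readMove (by
    rintro l _ ⟨n, rfl⟩
    exact (readMove_append l n).symm)

/-- Movement of the head of the work tape. -/
def shiftWork : Shift → Turing.Tape ℕ → Turing.Tape ℕ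
  | .left, T => T.move Turing.Dir.left
  | .stay, T => T
  | .right, T => T.move Turing.Dir.right

/-- Movement of the head of the run tape, whose cells are numbered `0, 1, 2, …`. -/
def shiftRun : Shift → ℕ → ℕ
  | .left, n => n - 1
  | .stay, n => n
  | .right, n => n + 1

/-- The positions that may stand on the run tape in the next clock cycle: a move of the machine is
the one spelled on the work tape, and the environment may make one arbitrary move if it is granted
permission. -/
def Config.NextPosition (c : Config) (Φ : List LabMove) : Action → Prop
  | .idle => Φ = c.position
  | .move => Φ = c.position ++ [(.top, c.spelledMove)]
  | .permit => Φ = c.position ∨ ∃ α, Φ = c.position ++ [(.bot, α)]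

/-- `d` is a successor of `c`. Without an applicable instruction, nothing happens. -/
def EPM.Succ (M : EPM) (c d : Config) : Prop :=
  match M.instr c with
  | none => d = c
  | some i =>
    d.state = i.next ∧ d.work = shiftWork i.workShift (c.work.write i.write) ∧
      d.runHead = shiftRun i.runShift c.runHead ∧ c.NextPosition d.position i.action

/-- The initial configuration. -/
def Config.init : Config := ⟨0, default, 0, []⟩

/-- `B` is a computation branch of `M`. -/
def EPM.IsBranch (M : EPM) (B : ℕ → Config) : Prop :=
  B 0 = Config.init ∧ ∀ n, M.Succ (B n) (B (n + 1))

/-- The run spelled by a computation branch. -/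
noncomputable def spelledRun (B : ℕ → Config) : Run := limitRun fun n => (B n).position

/-- Permission is granted infinitely many times in `B`. -/
def EPM.Fair (M : EPM) (B : ℕ → Config) : Prop :=
  ∀ N, ∃ n ≥ N, ∃ i, M.instr (B n) = some i ∧ i.action = .permit

/-- `M` wins `A`. -/
def EPM.Wins (M : EPM) (A : Game) : Prop :=
  ∀ B, M.IsBranch B →
    A.Wn (spelledRun B) = .top ∧ (M.Fair B ∨ A.Illegal .bot (spelledRun B))

/-- `M` is a uniform solution of `F`. -/
def EPM.IsUniformSolution (M : EPM) (F : Formula) : Prop :=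
  ∀ I : Interpretation, M.Wins (F.interp I)

/-- Uniform validity of a formula. -/
def UniformlyValid (F : Formula) : Prop := ∃ M : EPM, M.IsUniformSolution F

end CoL

namespace CoL

/-! Read a proof from its end, the formula `F`, up to its axiom. Every oformula on the way receives
an address: a path from `F` to a subformula in one particular copy. A path leads to a side of a
conjunction or disjunction, to one half of the threads of a corecurrence (Contraction), or to a
single thread of a recurrence or corecurrence. Recurrence introduction names its thread by a fresh
variable for an infinite bitstring and attaches this variable to the new overgroup. Corecurrence
introduction takes the thread that interleaves all variables attached to the overgroups of the new
oformula. So the variables of an address are exactly those attached to the overgroups of the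
oformula (`Fits`, `RuleOk.fits`). Since the two members of a pair in an axiom have the same
overgroups, their addresses contain the same variables (`IsAxiom.paired`).

The machine plays copycat inside every pair `¬G, G` of the axiom, for all values of the variables at
once: for every assignment, the subrun at one address is to be the negation of the subrun at the
other. A move depends on finitely many bits only, so finitely many copies answer it. A copy spells
at least `k` bits of each variable of its address, where `k` bounds the lengths of the moves so far.
Hence an assignment that sees the copy agrees, up to `k` bits, with the one for which it was made,
and sees the original at the partner's address; this is where equality of the variables is needed
(`Paired.hit`). Copies are legal as long as the environment plays legally (`legal_build`,
`Paired.legal_respond`), and each environment move has finitely many answers, so permission is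
granted again and again (`Paired.copycat`).

Call a cirquent won if, for all essentially finite values of the variables, every undergroup
contains an oformula whose subrun is won. The axiom is won because of two opposite games with
opposite runs one is won (`IsAxiom.won`), and every rule hands victory from premise to conclusion
(`RuleOk.won`). For a conjunction, one uses the undergroups that omit either conjunct. For a
recurrence, one lets the fresh variable run through all essentially finite bitstrings while the
other oformulas stay the same. For a corecurrence, the interleaving of essentially finite bitstrings
is an essentially finite witness. At the end the address of `F` is empty, so the run itself is won.
A run in which the environment errs first is won anyway.

For effectiveness, the copycat strategy is primitive recursive in the addresses and the position,
and so is the extraction of the addresses from the proof. Register programs are compiled into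
machines, all primitive recursive functions are programmed, and one fixed table executes the
strategy for a parameter that a short prefix writes on the work tape (`exists_machine`). -/

/-! ### Register programs on easy-play machines -/

/-- The reaction of a state to the scanned work tape symbol and the scanned run tape symbol. -/
abbrev Handler := ℕ → RunSymbol → Instr

/-- `M` reacts in state `q` according to `h`, on the work tape symbols with at most `R` registers. -/
def EPM.Has (M : EPM) (R q : ℕ) (h : Handler) : Prop :=
  ∀ s < 96 + 2 ^ (R + 1), ∀ r : RunSymbol, List.lookup (q, s, r) M = some (h s r)

/-- `M` reacts according to the list of handlers `l` in the states from `lo` on. -/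
def EPM.CodeAt (M : EPM) (R lo : ℕ) (l : List Handler) : Prop :=
  ∀ i h, l[i]? = some h → M.Has R (lo + i) h

theorem EPM.CodeAt.left {M : EPM} {R lo : ℕ} {l l' : List Handler}
    (h : M.CodeAt R lo (l ++ l')) : M.CodeAt R lo l := by
  intro i hd hi
  refine h i hd ?_
  rw [List.getElem?_append_left (List.getElem?_eq_some_iff.1 hi).1, hi]

theorem EPM.CodeAt.right {M : EPM} {R lo : ℕ} {l l' : List Handler}
    (h : M.CodeAt R lo (l ++ l')) : M.CodeAt R (lo + l.length) l' := by
  intro i hd hi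
  have := h (l.length + i) hd (by rw [List.getElem?_append_right (by omega)]; simpa using hi)
  rwa [← add_assoc] at this

theorem EPM.CodeAt.head {M : EPM} {R lo : ℕ} {a : Handler} {l : List Handler}
    (h : M.CodeAt R lo (a :: l)) : M.Has R lo a := h 0 a rfl

theorem EPM.CodeAt.tail {M : EPM} {R lo : ℕ} {a : Handler} {l : List Handler}
    (h : M.CodeAt R lo (a :: l)) : M.CodeAt R (lo + 1) l :=
  EPM.CodeAt.right (l := [a]) h

/-- `c` is in state `q`, its work tape has the content `ct` with the head at place `h`, and its run
tape, scanned at place `rh`, spells `Φ`. -/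
def Config.At (c : Config) (q : ℕ) (ct : ℤ → ℕ) (h : ℤ) (rh : ℕ) (Φ : List LabMove) : Prop :=
  c.state = q ∧ (∀ i, c.work.nth i = ct (h + i)) ∧ c.runHead = rh ∧ c.position = Φ

/-- The displacement of a head. -/
def Shift.disp : Shift → ℤ
  | .left => -1
  | .stay => 0
  | .right => 1

theorem shiftWork_nth (d : Shift) (T : Turing.Tape ℕ) (i : ℤ) :
    (shiftWork d T).nth i = T.nth (i + d.disp) := by
  cases d <;> simp [shiftWork, Shift.disp, sub_eq_add_neg]

theorem EPM.Succ.next {M : EPM} {R : ℕ} {c d : Config} (hs : M.Succ c d) {q : ℕ} {ct : ℤ → ℕ}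
    {h : ℤ} {rh : ℕ} {Φ : List LabMove} (hc : c.At q ct h rh Φ) {hd : Handler} (hM : M.Has R q hd)
    (hct : ct h < 96 + 2 ^ (R + 1)) {i : Instr} (hi : hd (ct h) (spell Φ)[rh]? = i) :
    M.instr c = some i ∧ c.NextPosition d.position i.action ∧
    d.At i.next (Function.update ct h i.write) (h + i.workShift.disp) (shiftRun i.runShift rh)
      d.position := by
  obtain ⟨h1, h2, h3, h4⟩ := hc
  have hhead : c.work.head = ct h := by rw [← Turing.Tape.nth_zero, h2, add_zero]
  have hinstr : M.instr c = some i := by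
    rw [EPM.instr, h1, hhead, Config.scan, h3, h4, hM _ hct, hi]
  rw [EPM.Succ, hinstr] at hs
  obtain ⟨g1, g2, g3, g4⟩ := hs
  refine ⟨hinstr, g4, g1, fun j => ?_, by rw [g3, h3], rfl⟩
  rw [g2, shiftWork_nth, Turing.Tape.write_nth, Function.update_apply, h2]
  split_ifs with e1 e2 e2
  · rfl
  · exact absurd (by omega) e2
  · exact absurd (by omega) e1
  · congr 1; ring

/-- The handler that does nothing but a change of the state. -/
def goto (q : ℕ) : ℕ → Instr := fun s => ⟨q, s, .stay, .stay, .idle⟩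

theorem EPM.Succ.idle {M : EPM} {R : ℕ} {c d : Config} (hs : M.Succ c d) {q : ℕ} {ct : ℤ → ℕ}
    {h : ℤ} {rh : ℕ} {Φ : List LabMove} (hc : c.At q ct h rh Φ) {hd : Handler} (hM : M.Has R q hd)
    (hct : ct h < 96 + 2 ^ (R + 1)) {q' w : ℕ} {a b : Shift}
    (hi : hd (ct h) (spell Φ)[rh]? = ⟨q', w, a, b, .idle⟩) :
    d.At q' (Function.update ct h w) (h + a.disp) (shiftRun b rh) Φ := by
  obtain ⟨-, h2, h3⟩ := hs.next hc hM hct hi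
  have : d.position = Φ := by
    have := h2
    simp only [Config.NextPosition] at this
    rw [this, hc.2.2.2]
  rwa [this] at h3

theorem EPM.Succ.idle_same {M : EPM} {R : ℕ} {c d : Config} (hs : M.Succ c d) {q : ℕ}
    {ct : ℤ → ℕ} {h : ℤ} {rh : ℕ} {Φ : List LabMove} (hc : c.At q ct h rh Φ) {hd : Handler}
    (hM : M.Has R q hd) (hct : ct h < 96 + 2 ^ (R + 1)) {q' : ℕ} {a b : Shift}
    (hi : hd (ct h) (spell Φ)[rh]? = ⟨q', ct h, a, b, .idle⟩) :
    d.At q' ct (h + a.disp) (shiftRun b rh) Φ := by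
  have := hs.idle hc hM hct hi
  rwa [Function.update_eq_self] at this

/-- All searches on the work tape are done by one state that returns to itself; the hypothesis on
the cells says that it does so in each of the `n` cells passed. -/
theorem EPM.walk_right {M : EPM} {R : ℕ} {B : ℕ → Config} (hB : ∀ n, M.Succ (B n) (B (n + 1)))
    {q : ℕ} {ct : ℤ → ℕ} {rh : ℕ} {Φ : List LabMove} {hd : Handler} (hM : M.Has R q hd)
    (n : ℕ) : ∀ (t : ℕ) (h : ℤ), (B t).At q ct h rh Φ →
    (∀ p, h ≤ p → p < h + n → ct p < 96 + 2 ^ (R + 1) ∧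
      hd (ct p) (spell Φ)[rh]? = ⟨q, ct p, .right, .stay, .idle⟩) →
    ∃ t' ≥ t, (B t').At q ct (h + n) rh Φ := by
  induction n with
  | zero => intro t h hc _; exact ⟨t, le_rfl, by simpa using hc⟩
  | succ n ih =>
    intro t h hc hp
    obtain ⟨p1, p2⟩ := hp h le_rfl (by push_cast; omega)
    have := (hB t).idle_same hc hM p1 p2
    obtain ⟨t', ht', h'⟩ := ih (t + 1) (h + 1) this fun p q1 q2 =>
      hp p (by omega) (by push_cast; omega)
    refine ⟨t', by omega, ?_⟩
    have e : h + 1 + (n : ℤ) = h + ((n + 1 : ℕ) : ℤ) := by push_cast; ring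
    rwa [e] at h'

theorem EPM.walk_left {M : EPM} {R : ℕ} {B : ℕ → Config} (hB : ∀ n, M.Succ (B n) (B (n + 1)))
    {q : ℕ} {ct : ℤ → ℕ} {rh : ℕ} {Φ : List LabMove} {hd : Handler} (hM : M.Has R q hd)
    (n : ℕ) : ∀ (t : ℕ) (h : ℤ), (B t).At q ct h rh Φ →
    (∀ p, h - n < p → p ≤ h → ct p < 96 + 2 ^ (R + 1) ∧
      hd (ct p) (spell Φ)[rh]? = ⟨q, ct p, .left, .stay, .idle⟩) →
    ∃ t' ≥ t, (B t').At q ct (h - n) rh Φ := by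
  induction n with
  | zero => intro t h hc _; exact ⟨t, le_rfl, by simpa using hc⟩
  | succ n ih =>
    intro t h hc hp
    obtain ⟨p1, p2⟩ := hp h (by push_cast; omega) le_rfl
    have := (hB t).idle_same hc hM p1 p2
    obtain ⟨t', ht', h'⟩ := ih (t + 1) (h + -1) this fun p q1 q2 =>
      hp p (by push_cast; omega) (by omega)
    refine ⟨t', by omega, ?_⟩
    have e : h + -1 - (n : ℤ) = h - ((n + 1 : ℕ) : ℤ) := by push_cast; ring
    rwa [e] at h'

theorem EPM.walk_erase {M : EPM} {R : ℕ} {B : ℕ → Config} (hB : ∀ n, M.Succ (B n) (B (n + 1)))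
    {q : ℕ} {rh : ℕ} {Φ : List LabMove} {hd : Handler} (hM : M.Has R q hd)
    (n : ℕ) : ∀ (t : ℕ) (h : ℤ) (ct : ℤ → ℕ), (B t).At q ct h rh Φ →
    (∀ p, h ≤ p → p < h + n → ct p < 96 + 2 ^ (R + 1) ∧
      hd (ct p) (spell Φ)[rh]? = ⟨q, 0, .right, .stay, .idle⟩) →
    ∃ t' ≥ t, (B t').At q (fun p => if h ≤ p ∧ p < h + n then 0 else ct p) (h + n) rh Φ := by
  induction n with
  | zero =>
    intro t h ct hc _
    refine ⟨t, le_rfl, ?_⟩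
    have : (fun p => if h ≤ p ∧ p < h + (0 : ℕ) then 0 else ct p) = ct := by
      funext p; rw [if_neg]; push_cast; omega
    rw [this]; simpa using hc
  | succ n ih =>
    intro t h ct hc hp
    obtain ⟨p1, p2⟩ := hp h le_rfl (by push_cast; omega)
    have := (hB t).idle hc hM p1 p2
    obtain ⟨t', ht', h'⟩ := ih (t + 1) (h + 1) _ this fun p q1 q2 => by
      rw [Function.update_of_ne (by omega)]
      exact hp p (by omega) (by push_cast; omega)
    refine ⟨t', by omega, ?_⟩
    have e : h + 1 + (n : ℤ) = h + ((n + 1 : ℕ) : ℤ) := by push_cast; ring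
    rw [e] at h'
    convert h' using 1
    funext p
    rw [Function.update_apply]
    push_cast
    split_ifs <;> first | rfl | omega

/-- The bit number `j` of a symbol of the right half of the work tape. -/
def bitAt (s j : ℕ) : Bool := (s - 96).testBit j

/-- The symbol with the bit number `j` set. -/
def setBit (s j : ℕ) : ℕ := 96 + ((s - 96) ||| 2 ^ j)

/-- The symbol with the bit number `j` inverted. -/
def flipBit (s j : ℕ) : ℕ := 96 + ((s - 96) ^^^ 2 ^ j)

theorem bitAt_setBit (s j i : ℕ) : bitAt (setBit s j) i = (bitAt s i || decide (j = i)) := by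
  simp [bitAt, setBit, Nat.testBit_or, Nat.testBit_two_pow]

theorem bitAt_flipBit (s j i : ℕ) : bitAt (flipBit s j) i = (bitAt s i ^^ decide (j = i)) := by
  simp [bitAt, flipBit, Nat.testBit_xor, Nat.testBit_two_pow]

theorem setBit_lt {s j R : ℕ} (hs : s < 96 + 2 ^ (R + 1)) (hj : j ≤ R) :
    setBit s j < 96 + 2 ^ (R + 1) := by
  have h1 : s - 96 < 2 ^ (R + 1) := by have := Nat.two_pow_pos (R + 1); omega
  have := Nat.or_lt_two_pow h1 (Nat.pow_lt_pow_right (by norm_num) (by omega : j < R + 1))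
  simp only [setBit]; omega

theorem flipBit_lt {s j R : ℕ} (hs : s < 96 + 2 ^ (R + 1)) (hj : j ≤ R) :
    flipBit s j < 96 + 2 ^ (R + 1) := by
  have h1 : s - 96 < 2 ^ (R + 1) := by have := Nat.two_pow_pos (R + 1); omega
  have := Nat.xor_lt_two_pow h1 (Nat.pow_lt_pow_right (by norm_num) (by omega : j < R + 1))
  simp only [flipBit]; omega

/-- Truncated subtraction makes the blank and the symbols of characters read as symbols with no
track set. Hence untouched cells need no initialization, and the search for the home cell may cross
the move in preparation. -/
theorem bitAt_small {s : ℕ} (hs : s ≤ 96) (j : ℕ) : bitAt s j = false := by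
  rw [bitAt, Nat.sub_eq_zero_of_le hs, Nat.zero_testBit]

/-- The state of a register program: the registers, the characters of the move in preparation, the
place of the head of the run tape, the position, and the number of permissions granted so far. -/
structure MState where
  regs : ℕ → ℕ
  buf : List ℕ
  rh : ℕ
  pos : List LabMove
  permits : ℕ

/-- The content of the work tape that represents a state: the registers are written in unary on the
tracks of the right half, and the left half holds the move in preparation. -/
structure MState.Tape (R : ℕ) (s : MState) (ct : ℤ → ℕ) : Prop where
  lt : ∀ p : ℕ, ct p < 96 + 2 ^ (R + 1)
  home : ∀ p : ℕ, bitAt (ct p) 0 = decide (p = 0)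
  reg : ∀ (p : ℕ) (j : ℕ), bitAt (ct p) (j + 1) = decide (p < s.regs j)
  -- The first character of the move stands farthest to the left and the last one next to the home
  -- cell. A move therefore grows at its front and is prepared from its last character on.
  buf : ∀ n : ℕ, ct (-(n : ℤ) - 1) = (s.buf.reverse[n]?).elim 0 (· + 1)
  buf_lt : ∀ k ∈ s.buf, k < 95

/-- `c` represents the state `s`, and is in the state number `q`. -/
def MState.Rep (R q : ℕ) (s : MState) (c : Config) : Prop :=
  ∃ ct, c.At q ct 0 s.rh s.pos ∧ s.Tape R ct

/-! ### Register programs and their compilation into states -/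

/-- Register programs. -/
inductive Prog where
  | inc (j : ℕ)
  | dec (j : ℕ)
  | push
  | bump
  | emit
  | permit
  | advance
  | skip
  | loop (j : ℕ) (P : Prog)
  | ifRun (r : RunSymbol) (P : Prog)
  | loopRun (P : Prog)
  | seq (P Q : Prog)

/-- The number of states of a register program. -/
def Prog.size : Prog → ℕ
  | .inc _ => 2
  | .dec _ => 3
  | .push => 3
  | .bump => 4
  | .emit => 4
  | .permit => 1
  | .advance => 1
  | .skip => 0
  | .loop _ P => P.size + 2
  | .ifRun _ P => P.size + 1
  | .loopRun P => P.size + 2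
  | .seq P Q => P.size + Q.size

/-- Walk to the home cell, from the right. -/
def homeLeft (q : ℕ) : Handler := fun s _ =>
  if bitAt s 0 then goto (q + 1) s else ⟨q, s, .left, .stay, .idle⟩

/-- Walk to the home cell, from the left. -/
def homeRight (q : ℕ) : Handler := fun s _ =>
  if bitAt s 0 then goto (q + 1) s else ⟨q, s, .right, .stay, .idle⟩

/-- Walk to the left end of the move in preparation. -/
def bufferEnd (q : ℕ) (i : Instr) : Handler := fun s _ =>
  if s = 0 then i else ⟨q, s, .left, .stay, .idle⟩

/-- Go to the state `q`. -/
def jump (q : ℕ) : Handler := fun s _ => goto q s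

/-- The handlers of the states of a register program that starts in state `q`. -/
def Prog.code : Prog → ℕ → List Handler
  | .inc j, q =>
    [fun s _ => if bitAt s (j + 1) then ⟨q, s, .right, .stay, .idle⟩
      else ⟨q + 1, setBit s (j + 1), .stay, .stay, .idle⟩, homeLeft (q + 1)]
  | .dec j, q =>
    [fun s _ => if bitAt s (j + 1) then ⟨q, s, .right, .stay, .idle⟩
      else if bitAt s 0 then goto (q + 3) s else ⟨q + 1, s, .left, .stay, .idle⟩,
      fun s _ => ⟨q + 2, flipBit s (j + 1), .stay, .stay, .idle⟩, homeLeft (q + 2)]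
  | .push, q =>
    [fun s _ => ⟨q + 1, s, .left, .stay, .idle⟩, bufferEnd (q + 1) ⟨q + 2, 1, .stay, .stay, .idle⟩,
      homeRight (q + 2)]
  | .bump, q =>
    [fun s _ => ⟨q + 1, s, .left, .stay, .idle⟩, bufferEnd (q + 1) ⟨q + 2, 0, .right, .stay, .idle⟩,
      fun s _ => ⟨q + 3, s + 1, .stay, .stay, .idle⟩, homeRight (q + 3)]
  | .emit, q =>
    [fun s _ => ⟨q + 1, s, .left, .stay, .idle⟩, bufferEnd (q + 1) ⟨q + 2, 0, .right, .stay, .idle⟩,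
      fun s _ => ⟨q + 3, s, .stay, .stay, .move⟩,
      fun s _ => if bitAt s 0 then goto (q + 4) s else ⟨q + 3, 0, .right, .stay, .idle⟩]
  | .permit, q => [fun s _ => ⟨q + 1, s, .stay, .stay, .permit⟩]
  | .advance, q => [fun s _ => ⟨q + 1, s, .stay, .right, .idle⟩]
  | .skip, _ => []
  | .loop j P, q =>
    (fun s _ => if bitAt s (j + 1) then goto (q + 1) s else goto (q + P.size + 2) s : Handler) ::
      (P.code (q + 1) ++ [jump q])
  | .ifRun r P, q =>
    (fun s r' => if r' = r then goto (q + 1) s else goto (q + P.size + 1) s : Handler) ::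
      P.code (q + 1)
  | .loopRun P, q =>
    (fun s r => if r = none then goto (q + P.size + 2) s else goto (q + 1) s : Handler) ::
      (P.code (q + 1) ++ [jump q])
  | .seq P Q, q => P.code q ++ Q.code (q + P.size)

theorem Prog.length_code (P : Prog) : ∀ q, (P.code q).length = P.size := by
  induction P with
  | loop j P ih => intro q; simp [code, size, ih]
  | ifRun r P ih => intro q; simp [code, size, ih]
  | loopRun P ih => intro q; simp [code, size, ih]
  | seq P Q ih1 ih2 => intro q; simp [code, size, ih1, ih2]
  | _ => intro q; rfl

/-- In every machine that contains the program `P`, a branch that starts `P` in the state `s` comes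
to the end of `P`, in a state for which `Post` holds. -/
def Prog.Real (R : ℕ) (P : Prog) (s : MState) (Post : MState → Prop) : Prop :=
  ∀ (M : EPM) (lo : ℕ) (B : ℕ → Config) (t : ℕ), M.CodeAt R lo (P.code lo) →
    (∀ n, M.Succ (B n) (B (n + 1))) → s.Rep R lo (B t) →
    -- The result is described by a predicate since the environment may move when permitted. The
    -- number of permissions is not on the tape; a change of it only serves to certify that
    -- permission was granted at some time from `t` on.
    ∃ t' s', t ≤ t' ∧ s'.Rep R (lo + P.size) (B t') ∧ Post s' ∧ (s.permits ≠ s'.permits →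
      ∃ n, t ≤ n ∧ ∃ i, M.instr (B n) = some i ∧ i.action = .permit)

theorem Prog.Real.mono {R : ℕ} {P : Prog} {s : MState} {Post Post' : MState → Prop}
    (h : P.Real R s Post) (hp : ∀ s', Post s' → Post' s') : P.Real R s Post' := by
  intro M lo B t h1 h2 h3
  obtain ⟨t', s', g1, g2, g3, g4⟩ := h M lo B t h1 h2 h3
  exact ⟨t', s', g1, g2, hp _ g3, g4⟩

theorem Prog.real_skip {R : ℕ} {s : MState} {Post : MState → Prop} (h : Post s) :
    Prog.skip.Real R s Post := fun _ _ _ t _ _ h3 =>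
  ⟨t, s, le_rfl, h3, h, fun h => absurd rfl h⟩

theorem Prog.Real.seq {R : ℕ} {P Q : Prog} {s : MState} {Mid Post : MState → Prop}
    (h : P.Real R s Mid) (h' : ∀ s', Mid s' → Q.Real R s' Post) : (P.seq Q).Real R s Post := by
  intro M lo B t h1 h2 h3
  obtain ⟨t', s', g1, g2, g3, g4⟩ := h M lo B t h1.left h2 h3
  have h1' := EPM.CodeAt.right h1
  rw [Prog.length_code] at h1'
  obtain ⟨t'', s'', k1, k2, k3, k4⟩ := h' s' g3 M _ B t' h1' h2 g2
  refine ⟨t'', s'', by omega, by rwa [Prog.size, ← add_assoc], k3, fun hne => ?_⟩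
  by_cases e : s.permits = s'.permits
  · obtain ⟨n, hn, hn'⟩ := k4 (by rwa [← e])
    exact ⟨n, by omega, hn'⟩
  · exact g4 e

theorem MState.Tape.neg_lt {R : ℕ} {s : MState} {ct : ℤ → ℕ} (h : s.Tape R ct) {p : ℤ}
    (hp : p < 0) : ct p ≤ 95 := by
  obtain ⟨n, rfl⟩ : ∃ n : ℕ, p = -(n : ℤ) - 1 := ⟨(-p - 1).toNat, by omega⟩
  rw [h.buf]
  cases e : s.buf.reverse[n]? with
  | none => simp
  | some k =>
    have := h.buf_lt k (by simpa using List.mem_of_getElem? e)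
    simp only [Option.elim_some]; omega

theorem MState.Tape.lt' {R : ℕ} {s : MState} {ct : ℤ → ℕ} (h : s.Tape R ct) (p : ℤ) :
    ct p < 96 + 2 ^ (R + 1) := by
  rcases lt_or_ge p 0 with hp | hp
  · have := h.neg_lt hp
    have := Nat.two_pow_pos (R + 1)
    omega
  · obtain ⟨n, rfl⟩ := Int.eq_ofNat_of_zero_le hp
    exact h.lt n

theorem MState.Tape.home' {R : ℕ} {s : MState} {ct : ℤ → ℕ} (h : s.Tape R ct) (p : ℤ) :
    bitAt (ct p) 0 = decide (p = 0) := by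
  rcases lt_or_ge p 0 with hp | hp
  · rw [bitAt_small (by have := h.neg_lt hp; omega), eq_comm]; simp; omega
  · obtain ⟨n, rfl⟩ := Int.eq_ofNat_of_zero_le hp
    simpa using h.home n

theorem MState.Tape.buf_eq_zero {R : ℕ} {s : MState} {ct : ℤ → ℕ} (h : s.Tape R ct) :
    ct (-(s.buf.length : ℤ) - 1) = 0 := by
  rw [h.buf, List.getElem?_eq_none (by simp)]; rfl

theorem MState.Tape.buf_ne_zero {R : ℕ} {s : MState} {ct : ℤ → ℕ} (h : s.Tape R ct) {p : ℤ}
    (hp : p < 0) (hp' : -(s.buf.length : ℤ) - 1 < p) : ct p ≠ 0 := by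
  obtain ⟨n, rfl⟩ : ∃ n : ℕ, p = -(n : ℤ) - 1 := ⟨(-p - 1).toNat, by omega⟩
  rw [h.buf, List.getElem?_eq_getElem (by simp; omega)]
  simp

theorem MState.Rep.home_left {M : EPM} {R q : ℕ} {s : MState} {B : ℕ → Config}
    (hB : ∀ n, M.Succ (B n) (B (n + 1))) {t : ℕ} {ct : ℤ → ℕ} (n : ℕ)
    (hc : (B t).At q ct n s.rh s.pos) (hct : s.Tape R ct) (hM : M.Has R q (homeLeft q)) :
    ∃ t' ≥ t, s.Rep R (q + 1) (B t') := by
  obtain ⟨t', h1, h2⟩ := EPM.walk_left hB hM n t n hc fun p h1 h2 =>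
    ⟨hct.lt' p, by rw [homeLeft, hct.home' p, if_neg]; simp; omega⟩
  rw [sub_self] at h2
  refine ⟨t' + 1, by omega, ct, ?_, hct⟩
  have := (hB t').idle_same h2 hM (hct.lt' 0) (q' := q + 1) (a := .stay) (b := .stay)
    (by rw [homeLeft, hct.home' 0]; simp [goto])
  simpa [Shift.disp, shiftRun] using this

theorem MState.Rep.home_right {M : EPM} {R q : ℕ} {s : MState} {B : ℕ → Config}
    (hB : ∀ n, M.Succ (B n) (B (n + 1))) {t : ℕ} {ct : ℤ → ℕ} (n : ℕ)
    (hc : (B t).At q ct (-n) s.rh s.pos) (hct : s.Tape R ct) (hM : M.Has R q (homeRight q)) :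
    ∃ t' ≥ t, s.Rep R (q + 1) (B t') := by
  obtain ⟨t', h1, h2⟩ := EPM.walk_right hB hM n t (-n) hc fun p h1 h2 =>
    ⟨hct.lt' p, by rw [homeRight, hct.home' p, if_neg]; simp; omega⟩
  rw [neg_add_cancel] at h2
  refine ⟨t' + 1, by omega, ct, ?_, hct⟩
  have := (hB t').idle_same h2 hM (hct.lt' 0) (q' := q + 1) (a := .stay) (b := .stay)
    (by rw [homeRight, hct.home' 0]; simp [goto])
  simpa [Shift.disp, shiftRun] using this

/-- The state with the register `j` set to `v`. -/
def MState.setReg (s : MState) (j v : ℕ) : MState := { s with regs := Function.update s.regs j v }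

/-- One cell is rewritten on one track. The last hypothesis says that this track is again a unary
number, now of value `v`. -/
theorem MState.Tape.update {R : ℕ} {s : MState} {ct : ℤ → ℕ} (h : s.Tape R ct) {j v n w : ℕ}
    (hw : w < 96 + 2 ^ (R + 1)) (hb : ∀ i ≠ j + 1, bitAt w i = bitAt (ct n) i)
    (hj : ∀ p : ℕ, (if p = n then bitAt w (j + 1) else decide (p < s.regs j)) = decide (p < v)) :
    (s.setReg j v).Tape R (Function.update ct (n : ℤ) w) := by
  refine ⟨fun p => ?_, fun p => ?_, fun p i => ?_, fun i => ?_, h.buf_lt⟩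
  · rw [Function.update_apply]; split_ifs
    exacts [hw, h.lt p]
  · rw [Function.update_apply]; split_ifs with e
    · rw [hb 0 (by omega), h.home, Nat.cast_inj.1 e]
    · exact h.home p
  · simp only [MState.setReg, Function.update_apply, Nat.cast_inj]
    by_cases e : i = j
    · subst e
      rw [if_pos rfl, ← hj p]
      split_ifs
      · rfl
      · exact h.reg p i
    · rw [if_neg e]
      split_ifs with e'
      · rw [hb _ (by omega), h.reg, e']
      · exact h.reg p i
  · rw [Function.update_of_ne (by omega)]; exact h.buf i

theorem Prog.real_inc {R j : ℕ} (hj : j < R) (s : MState) :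
    (Prog.inc j).Real R s fun s' => s' = s.setReg j (s.regs j + 1) := by
  intro M lo B t h1 hB ⟨ct, hc, hct⟩
  obtain ⟨t1, g1, g2⟩ := EPM.walk_right hB h1.head (s.regs j) t 0 hc fun p h1 h2 => by
    obtain ⟨n, rfl⟩ := Int.eq_ofNat_of_zero_le h1
    exact ⟨hct.lt' _, by rw [hct.reg, if_pos (by simp; omega)]⟩
  rw [zero_add] at g2
  have hb : bitAt (ct (s.regs j)) (j + 1) = false := by rw [hct.reg]; simp
  have g3 := (hB t1).idle g2 h1.head (hct.lt' _) (q' := lo + 1) (w := setBit (ct (s.regs j)) (j + 1))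
    (a := .stay) (b := .stay) (by simp [hb])
  have hT : (s.setReg j (s.regs j + 1)).Tape R
      (Function.update ct (s.regs j : ℤ) (setBit (ct (s.regs j)) (j + 1))) := by
    refine hct.update (setBit_lt (hct.lt' _) (by omega)) (fun i hi => ?_) fun p => ?_
    · rw [bitAt_setBit]; simp [hi.symm]
    · rw [bitAt_setBit]
      split_ifs with e
      · simp [e]
      · simp; omega
  obtain ⟨t', g4, g5⟩ := MState.Rep.home_left (s := s.setReg j (s.regs j + 1)) hB (s.regs j)
    (by simpa [Shift.disp, shiftRun, MState.setReg] using g3) hT h1.tail.head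
  exact ⟨t', _, by omega, g5, rfl, fun h => absurd rfl h⟩

/-- The first cell off the track is the home cell exactly if the register is empty; only then is the
program left at once. Otherwise the cell before it is cleared. -/
theorem Prog.real_dec {R j : ℕ} (hj : j < R) (s : MState) :
    (Prog.dec j).Real R s fun s' => s' = s.setReg j (s.regs j - 1) := by
  intro M lo B t h1 hB ⟨ct, hc, hct⟩
  obtain ⟨t1, g1, g2⟩ := EPM.walk_right hB h1.head (s.regs j) t 0 hc fun p h1 h2 => by
    obtain ⟨n, rfl⟩ := Int.eq_ofNat_of_zero_le h1
    exact ⟨hct.lt' _, by rw [hct.reg, if_pos (by simp; omega)]⟩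
  rw [zero_add] at g2
  have hb : bitAt (ct (s.regs j)) (j + 1) = false := by rw [hct.reg]; simp
  rcases Nat.eq_zero_or_pos (s.regs j) with h0 | h0
  · have g3 := (hB t1).idle_same g2 h1.head (hct.lt' _) (q' := lo + 3)
      (a := .stay) (b := .stay) (by rw [hb, hct.home']; simp [h0, goto])
    refine ⟨t1 + 1, s, by omega, ⟨ct, ?_, hct⟩, ?_, fun h => absurd rfl h⟩
    · simpa [Shift.disp, shiftRun, h0, Prog.size] using g3
    · have : Function.update s.regs j 0 = s.regs := by rw [← h0, Function.update_eq_self]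
      simp [MState.setReg, h0, this]
  · obtain ⟨m, hm⟩ : ∃ m, s.regs j = m + 1 := ⟨s.regs j - 1, by omega⟩
    have g3 := (hB t1).idle_same g2 h1.head (hct.lt' _) (q' := lo + 1)
      (a := .left) (b := .stay) (by rw [hb, hct.home', if_neg (by simp), if_neg (by simp; omega)])
    have e : (s.regs j : ℤ) + Shift.left.disp = (m : ℕ) := by simp [Shift.disp, hm]
    rw [e] at g3
    have g4 := (hB _).idle g3 h1.tail.head (hct.lt' _) (q' := lo + 2)
      (w := flipBit (ct m) (j + 1)) (a := .stay) (b := .stay) rfl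
    have hT : (s.setReg j (s.regs j - 1)).Tape R
        (Function.update ct (m : ℤ) (flipBit (ct m) (j + 1))) := by
      refine hct.update (flipBit_lt (hct.lt' _) (by omega)) (fun i hi => ?_) fun p => ?_
      · rw [bitAt_flipBit]; simp [hi.symm]
      · rw [bitAt_flipBit, hct.reg]
        split_ifs with e
        · simp [e, hm]
        · simp [hm]; omega
    obtain ⟨t', g5, g6⟩ := MState.Rep.home_left (s := s.setReg j (s.regs j - 1)) hB m
      (by simpa [Shift.disp, shiftRun, MState.setReg, add_assoc] using g4) hT h1.tail.tail.head
    exact ⟨t', _, by omega, g6, rfl, fun h => absurd rfl h⟩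

theorem MState.Rep.buffer_end {M : EPM} {R q : ℕ} {s : MState} {B : ℕ → Config}
    (hB : ∀ n, M.Succ (B n) (B (n + 1))) {t : ℕ} {ct : ℤ → ℕ} {h0 : Handler}
    (hc : (B t).At q ct 0 s.rh s.pos) (hct : s.Tape R ct) (hM : M.Has R q h0)
    (hh : ∀ s r, h0 s r = ⟨q + 1, s, .left, .stay, .idle⟩) {i : Instr}
    (hM' : M.Has R (q + 1) (bufferEnd (q + 1) i)) :
    ∃ t' ≥ t, (B t').At (q + 1) ct (-(s.buf.length : ℤ) - 1) s.rh s.pos := by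
  have g1 := (hB t).idle_same hc hM (hct.lt' _) (hh _ _)
  obtain ⟨t', g2, g3⟩ := EPM.walk_left hB hM' s.buf.length (t + 1) (-1) g1 fun p h1 h2 =>
    ⟨hct.lt' p, by
      rw [bufferEnd, if_neg (hct.buf_ne_zero (by omega) (by omega))]⟩
  exact ⟨t', by omega, by rwa [show (-1 : ℤ) - s.buf.length = -(s.buf.length : ℤ) - 1 by ring] at g3⟩

/-- A new character is always the one with number `0`, to be counted up by `bump` afterwards; so a
bounded number of states can write every character. -/
theorem Prog.real_push {R : ℕ} (s : MState) :
    Prog.push.Real R s fun s' => s' = { s with buf := 0 :: s.buf } := by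
  intro M lo B t h1 hB ⟨ct, hc, hct⟩
  obtain ⟨t1, g1, g2⟩ := MState.Rep.buffer_end hB hc hct h1.head (fun _ _ => rfl) h1.tail.head
  have g3 := (hB t1).idle g2 h1.tail.head (hct.lt' _) (q' := lo + 2) (w := 1)
    (a := .stay) (b := .stay) (by simp [bufferEnd, hct.buf_eq_zero])
  have hT : ({ s with buf := 0 :: s.buf } : MState).Tape R
      (Function.update ct (-(s.buf.length : ℤ) - 1) 1) := by
    refine ⟨fun p => ?_, fun p => ?_, fun p i => ?_, fun i => ?_, ?_⟩
    · rw [Function.update_of_ne (by omega)]; exact hct.lt p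
    · rw [Function.update_of_ne (by omega)]; exact hct.home p
    · rw [Function.update_of_ne (by omega)]; exact hct.reg p i
    · rw [Function.update_apply]
      simp only [List.reverse_cons]
      split_ifs with e
      · have : i = s.buf.length := by omega
        rw [this, List.getElem?_append_right (by simp)]; simp
      · rw [hct.buf]
        rcases lt_or_ge i s.buf.length with h | h
        · rw [List.getElem?_append_left (by simpa using h)]
        · rw [List.getElem?_eq_none (by simpa using h), List.getElem?_eq_none (by simp; omega)]
    · intro k hk
      rcases List.mem_cons.1 hk with rfl | hk
      exacts [by norm_num, hct.buf_lt k hk]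
  obtain ⟨t', g4, g5⟩ := MState.Rep.home_right (s := { s with buf := 0 :: s.buf }) hB
    (s.buf.length + 1) (by
      have : (-((s.buf.length + 1 : ℕ) : ℤ)) = -(s.buf.length : ℤ) - 1 := by push_cast; ring
      rw [this]
      simpa [Shift.disp, shiftRun] using g3) hT h1.tail.tail.head
  exact ⟨t', _, by omega, g5, rfl, fun h => absurd rfl h⟩

theorem Prog.real_bump {R : ℕ} (s : MState) {k : ℕ} {l : List ℕ} (hs : s.buf = k :: l)
    (hk : k + 1 < 95) : Prog.bump.Real R s fun s' => s' = { s with buf := (k + 1) :: l } := by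
  intro M lo B t h1 hB ⟨ct, hc, hct⟩
  obtain ⟨t1, g1, g2⟩ := MState.Rep.buffer_end hB hc hct h1.head (fun _ _ => rfl) h1.tail.head
  have g3 := (hB t1).idle_same g2 h1.tail.head (hct.lt' _) (q' := lo + 2)
    (a := .right) (b := .stay) (by simp [bufferEnd, hct.buf_eq_zero])
  have e : -(s.buf.length : ℤ) - 1 + Shift.right.disp = -(l.length : ℤ) - 1 := by
    simp [Shift.disp, hs]; ring
  rw [e] at g3
  have hk' : ct (-(l.length : ℤ) - 1) = k + 1 := by
    rw [hct.buf, hs, List.reverse_cons, List.getElem?_append_right (by simp)]; simp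
  have g4 := (hB _).idle g3 h1.tail.tail.head (hct.lt' _) (q' := lo + 3) (w := k + 2)
    (a := .stay) (b := .stay) (by simp [hk'])
  have hT : ({ s with buf := (k + 1) :: l } : MState).Tape R
      (Function.update ct (-(l.length : ℤ) - 1) (k + 2)) := by
    refine ⟨fun p => ?_, fun p => ?_, fun p i => ?_, fun i => ?_, ?_⟩
    · rw [Function.update_of_ne (by omega)]; exact hct.lt p
    · rw [Function.update_of_ne (by omega)]; exact hct.home p
    · rw [Function.update_of_ne (by omega)]; exact hct.reg p i
    · rw [Function.update_apply]
      simp only [List.reverse_cons]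
      split_ifs with e
      · have : i = l.length := by omega
        rw [this, List.getElem?_append_right (by simp)]; simp
      · rw [hct.buf, hs, List.reverse_cons]
        rcases lt_or_ge i l.length with h | h
        · rw [List.getElem?_append_left (by simpa using h),
            List.getElem?_append_left (by simpa using h)]
        · rw [List.getElem?_eq_none (by simp; omega), List.getElem?_eq_none (by simp; omega)]
    · intro k' hk'
      rcases List.mem_cons.1 hk' with rfl | hk'
      exacts [hk, hct.buf_lt k' (by simp [hs, hk'])]
  obtain ⟨t', g5, g6⟩ := MState.Rep.home_right (s := { s with buf := (k + 1) :: l }) hB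
    (l.length + 1) (by
      have : (-((l.length + 1 : ℕ) : ℤ)) = -(l.length : ℤ) - 1 := by push_cast; ring
      rw [this]
      simpa [Shift.disp, shiftRun] using g4) hT h1.tail.tail.tail.head
  exact ⟨t', _, by omega, g6, rfl, fun h => absurd rfl h⟩

/-- The move spelled by a list of numbers of characters. -/
def toMove (l : List ℕ) : Move := l.filterMap fun k => if h : k < 95 then some ⟨k, h⟩ else none

/-- The move is terminated by the home cell: its symbol has bit `0` set, hence exceeds `96` and
stands for no character, whatever the registers contain. -/
theorem readMove_eq {l : List ℕ} (hl : ∀ k ∈ l, k < 95) : ∀ (L : List ℕ),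
    (∀ n : ℕ, n < l.length → (L[n]?).getD 0 = (l[n]?).getD 0 + 1) →
    96 < (L[l.length]?).getD 0 → readMove L = toMove l := by
  induction l with
  | nil =>
    intro L _ h
    cases L with
    | nil => simp at h
    | cons a L =>
      simp only [List.length_nil, List.getElem?_cons_zero, Option.getD_some] at h
      obtain ⟨k, rfl⟩ : ∃ k, a = k + 1 := ⟨a - 1, by omega⟩
      rw [readMove, dif_neg (by omega)]; rfl
  | cons k l ih =>
    intro L h1 h2
    have h3 := h1 0 (by simp)
    cases L with
    | nil => simp at h3
    | cons a L =>
      simp only [List.getElem?_cons_zero, Option.getD_some] at h3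
      subst h3
      have hk : k < 95 := hl k (by simp)
      rw [readMove, dif_pos hk, ih (fun k hk => hl k (by simp [hk])) L
        (fun n hn => by simpa using h1 (n + 1) (by simpa using hn)) (by simpa using h2)]
      simp [toMove, hk]

theorem Config.spelledMove_eq (c : Config) {l : List ℕ} (hl : ∀ k ∈ l, k < 95)
    (h1 : ∀ n : ℕ, n < l.length → c.work.nth n = (l[n]?).getD 0 + 1)
    (h2 : 96 < c.work.nth l.length) : c.spelledMove = toMove l := by
  simp only [← Turing.Tape.right₀_nth] at h1 h2
  rw [Config.spelledMove]
  revert h1 h2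
  generalize c.work.right₀ = L
  induction L using Turing.ListBlank.induction_on with
  | h L =>
    intro h1 h2
    rw [Turing.ListBlank.nth_mk] at h2
    simp only [Turing.ListBlank.nth_mk] at h1
    refine readMove_eq hl L (fun n hn => ?_) ?_
    · rw [← h1 n hn, List.getI_eq_getElem?_getD]; rfl
    · rw [List.getI_eq_getElem?_getD] at h2; exact h2

theorem Prog.real_emit {R : ℕ} (s : MState) :
    Prog.emit.Real R s fun s' => s' =
      { s with buf := [], pos := s.pos ++ [(.top, toMove s.buf)] } := by
  intro M lo B t h1 hB ⟨ct, hc, hct⟩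
  obtain ⟨t1, g1, g2⟩ := MState.Rep.buffer_end hB hc hct h1.head (fun _ _ => rfl) h1.tail.head
  have g3 := (hB t1).idle_same g2 h1.tail.head (hct.lt' _) (q' := lo + 2)
    (a := .right) (b := .stay) (by simp [bufferEnd, hct.buf_eq_zero])
  have e : -(s.buf.length : ℤ) - 1 + Shift.right.disp = -(s.buf.length : ℤ) := by
    simp [Shift.disp]
  rw [e] at g3
  have hsp : (B (t1 + 1)).spelledMove = toMove s.buf := by
    refine Config.spelledMove_eq _ hct.buf_lt (fun n hn => ?_) ?_
    · rw [g3.2.1]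
      -- The head is at the left end of the move, so reading to the right undoes the reversal in the
      -- description of the tape.
      have : -(s.buf.length : ℤ) + n = -((s.buf.length - 1 - n : ℕ) : ℤ) - 1 := by omega
      rw [this, hct.buf, List.getElem?_reverse (by omega)]
      rw [show s.buf.length - 1 - (s.buf.length - 1 - n) = n by omega,
        List.getElem?_eq_getElem hn]
      rfl
    · rw [g3.2.1, neg_add_cancel]
      have := hct.home' 0
      by_contra hle
      rw [bitAt_small (by omega)] at this
      simp at this
  obtain ⟨-, g4, g5⟩ := (hB (t1 + 1)).next g3 h1.tail.tail.head (hct.lt' _) rfl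
  simp only [Config.NextPosition, hsp, g3.2.2.2] at g4
  simp only [g4, Function.update_eq_self] at g5
  have hshift : -(s.buf.length : ℤ) + Shift.stay.disp = -(s.buf.length : ℤ) := by simp [Shift.disp]
  rw [hshift] at g5
  obtain ⟨t2, g6, g7⟩ := EPM.walk_erase hB h1.tail.tail.tail.head s.buf.length (t1 + 1 + 1) _ ct g5
    fun p h1 h2 => ⟨hct.lt' _, by rw [hct.home' p, if_neg]; simp; omega⟩
  rw [neg_add_cancel] at g7
  set ct' : ℤ → ℕ := fun p => if -(s.buf.length : ℤ) ≤ p ∧ p < 0 then 0 else ct p with hct'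
  have hpos : ∀ p : ℕ, ct' p = ct p := fun p => by rw [hct']; dsimp only; rw [if_neg]; omega
  have hT : ({ s with buf := [], pos := s.pos ++ [(.top, toMove s.buf)] } : MState).Tape R ct' := by
    refine ⟨fun p => ?_, fun p => ?_, fun p i => ?_, fun i => ?_, by simp⟩
    · rw [hpos]; exact hct.lt p
    · rw [hpos]; exact hct.home p
    · rw [hpos]; exact hct.reg p i
    · rw [hct']; dsimp only
      split_ifs with e
      · rfl
      · rw [hct.buf, List.getElem?_eq_none (by simp; omega)]; rfl
  have g8 := (hB t2).idle_same g7 h1.tail.tail.tail.head (hT.lt' _) (q' := lo + 4)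
    (a := .stay) (b := .stay) (by simp [hT.home' 0, goto])
  exact ⟨t2 + 1, _, by omega, ⟨ct', by simpa [Shift.disp, shiftRun, Prog.size] using g8, hT⟩, rfl,
    fun h => absurd rfl h⟩

theorem MState.Tape.congr {R : ℕ} {s s' : MState} {ct : ℤ → ℕ} (h : s.Tape R ct)
    (h1 : s'.regs = s.regs) (h2 : s'.buf = s.buf) : s'.Tape R ct :=
  ⟨h.lt, h.home, by rw [h1]; exact h.reg, by rw [h2]; exact h.buf, by rw [h2]; exact h.buf_lt⟩

theorem Prog.real_permit {R : ℕ} (s : MState) :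
    Prog.permit.Real R s fun s' => s' = { s with permits := s.permits + 1 } ∨
      ∃ α, s' = { s with permits := s.permits + 1, pos := s.pos ++ [(.bot, α)] } := by
  intro M lo B t h1 hB ⟨ct, hc, hct⟩
  obtain ⟨g3, g4, g5⟩ := (hB t).next hc h1.head (hct.lt' _) rfl
  simp only [Config.NextPosition, hc.2.2.2] at g4
  simp only [Function.update_eq_self] at g5
  refine ⟨t + 1, { s with permits := s.permits + 1, pos := (B (t + 1)).position }, by omega,
    ⟨ct, by simpa [Shift.disp, shiftRun, Prog.size] using g5, hct.congr rfl rfl⟩, ?_,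
    fun _ => ⟨t, le_rfl, _, g3, rfl⟩⟩
  rcases g4 with g4 | ⟨α, g4⟩
  · left; rw [g4]
  · right; exact ⟨α, by rw [g4]⟩

theorem Prog.real_advance {R : ℕ} (s : MState) :
    Prog.advance.Real R s fun s' => s' = { s with rh := s.rh + 1 } := by
  intro M lo B t h1 hB ⟨ct, hc, hct⟩
  have g := (hB t).idle_same hc h1.head (hct.lt' _) rfl
  exact ⟨t + 1, { s with rh := s.rh + 1 }, by omega,
    ⟨ct, by simpa [Shift.disp, shiftRun, Prog.size] using g, hct.congr rfl rfl⟩, rfl, fun h => absurd rfl h⟩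

theorem MState.Rep.goto {M : EPM} {R q q' : ℕ} {s : MState} {c d : Config} (hs : M.Succ c d)
    (h : s.Rep R q c) {hd : Handler} (hM : M.Has R q hd)
    (hi : ∀ ct, s.Tape R ct → hd (ct 0) (spell s.pos)[s.rh]? = CoL.goto q' (ct 0)) :
    s.Rep R q' d := by
  obtain ⟨ct, hc, hct⟩ := h
  have := hs.idle_same hc hM (hct.lt' _) (hi ct hct)
  exact ⟨ct, by simpa [Shift.disp, shiftRun] using this, hct⟩

theorem Prog.real_loop_zero {R j : ℕ} {P : Prog} {s : MState} {Post : MState → Prop}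
    (h0 : s.regs j = 0) (h : Post s) : (Prog.loop j P).Real R s Post := by
  intro M lo B t h1 hB hR
  refine ⟨t + 1, s, by omega, hR.goto (hB t) h1.head fun ct hct => ?_, h, fun h => absurd rfl h⟩
  have := hct.reg 0 j
  simp only [Nat.cast_zero, h0] at this
  simp [this, Prog.size, add_assoc]

/-- One turn of the loop is split off. Termination is not built in; each use supplies an induction
that reaches `real_loop_zero`. -/
theorem Prog.real_loop_succ {R j : ℕ} {P : Prog} {s : MState} {Mid Post : MState → Prop}
    (h0 : s.regs j ≠ 0) (h : P.Real R s Mid)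
    (h' : ∀ s', Mid s' → (Prog.loop j P).Real R s' Post) : (Prog.loop j P).Real R s Post := by
  intro M lo B t h1 hB hR
  have r1 := hR.goto (hB t) h1.head (q' := lo + 1) fun ct hct => by
    have := hct.reg 0 j
    simp only [Nat.cast_zero, Nat.pos_of_ne_zero h0] at this
    simp [this]
  obtain ⟨t', s', g1, g2, g3, g4⟩ := h M _ B _ h1.tail.left hB r1
  have hj := h1.tail.right.head
  rw [Prog.length_code] at hj
  have r2 := g2.goto (hB t') hj (q' := lo) fun ct hct => rfl
  obtain ⟨t'', s'', k1, k2, k3, k4⟩ := h' s' g3 M lo B _ h1 hB r2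
  refine ⟨t'', s'', by omega, k2, k3, fun hne => ?_⟩
  by_cases e : s.permits = s'.permits
  · obtain ⟨n, hn, hn'⟩ := k4 (by rwa [← e])
    exact ⟨n, by omega, hn'⟩
  · obtain ⟨n, hn, hn'⟩ := g4 e
    exact ⟨n, by omega, hn'⟩

theorem Prog.real_ifRun_neg {R : ℕ} {r : RunSymbol} {P : Prog} {s : MState} {Post : MState → Prop}
    (h0 : (spell s.pos)[s.rh]? ≠ r) (h : Post s) : (Prog.ifRun r P).Real R s Post := by
  intro M lo B t h1 hB hR
  refine ⟨t + 1, s, by omega, hR.goto (hB t) h1.head fun ct hct => ?_, h, fun h => absurd rfl h⟩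
  simp [h0, Prog.size, add_assoc]

theorem Prog.real_ifRun_pos {R : ℕ} {r : RunSymbol} {P : Prog} {s : MState} {Post : MState → Prop}
    (h0 : (spell s.pos)[s.rh]? = r) (h : P.Real R s Post) : (Prog.ifRun r P).Real R s Post := by
  intro M lo B t h1 hB hR
  have r1 := hR.goto (hB t) h1.head (q' := lo + 1) fun ct hct => by simp [h0]
  obtain ⟨t', s', g1, g2, g3, g4⟩ := h M _ B _ h1.tail hB r1
  refine ⟨t', s', by omega, ?_, g3, fun hne => ?_⟩
  · rwa [add_assoc, add_comm 1] at g2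
  · obtain ⟨n, hn, hn'⟩ := g4 hne
    exact ⟨n, by omega, hn'⟩

theorem Prog.real_loopRun_none {R : ℕ} {P : Prog} {s : MState} {Post : MState → Prop}
    (h0 : (spell s.pos)[s.rh]? = none) (h : Post s) : (Prog.loopRun P).Real R s Post := by
  intro M lo B t h1 hB hR
  refine ⟨t + 1, s, by omega, hR.goto (hB t) h1.head fun ct hct => ?_, h, fun h => absurd rfl h⟩
  simp [h0, Prog.size, add_assoc]

theorem Prog.real_loopRun_some {R : ℕ} {P : Prog} {s : MState} {Mid Post : MState → Prop}
    (h0 : (spell s.pos)[s.rh]? ≠ none) (h : P.Real R s Mid)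
    (h' : ∀ s', Mid s' → (Prog.loopRun P).Real R s' Post) : (Prog.loopRun P).Real R s Post := by
  intro M lo B t h1 hB hR
  have r1 := hR.goto (hB t) h1.head (q' := lo + 1) fun ct hct => by rw [if_neg h0]
  obtain ⟨t', s', g1, g2, g3, g4⟩ := h M _ B _ h1.tail.left hB r1
  have hj := h1.tail.right.head
  rw [Prog.length_code] at hj
  have r2 := g2.goto (hB t') hj (q' := lo) fun ct hct => rfl
  obtain ⟨t'', s'', k1, k2, k3, k4⟩ := h' s' g3 M lo B _ h1 hB r2
  refine ⟨t'', s'', by omega, k2, k3, fun hne => ?_⟩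
  by_cases e : s.permits = s'.permits
  · obtain ⟨n, hn, hn'⟩ := k4 (by rwa [← e])
    exact ⟨n, by omega, hn'⟩
  · obtain ⟨n, hn, hn'⟩ := g4 e
    exact ⟨n, by omega, hn'⟩

/-! ### Copying and moving registers -/

/-- The state with other values of the registers. -/
def MState.withRegs (s : MState) (g : ℕ → ℕ) : MState := { s with regs := g }

theorem MState.withRegs_regs (s : MState) (g : ℕ → ℕ) : (s.withRegs g).regs = g := rfl

theorem MState.setReg_eq (s : MState) (j v : ℕ) :
    s.setReg j v = s.withRegs (Function.update s.regs j v) := rfl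

theorem MState.setReg_regs (s : MState) (j v : ℕ) :
    (s.setReg j v).regs = Function.update s.regs j v := rfl

theorem MState.eq_withRegs (s : MState) {g : ℕ → ℕ} (h : ∀ i, g i = s.regs i) :
    s.withRegs g = s := by
  have : g = s.regs := funext h
  rw [this]; rfl

theorem MState.withRegs_congr (s : MState) {g g' : ℕ → ℕ} (h : ∀ i, g i = g' i) :
    s.withRegs g = s.withRegs g' := by
  rw [funext h]

/-- Empty the register `j`. -/
def Prog.clear (j : ℕ) : Prog := .loop j (.dec j)

theorem Prog.real_clear {R j : ℕ} (hj : j < R) (s : MState) :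
    (Prog.clear j).Real R s fun s' => s' = s.setReg j 0 := by
  generalize h : s.regs j = n
  induction n generalizing s with
  | zero =>
    refine Prog.real_loop_zero h ?_
    rw [MState.setReg_eq, MState.eq_withRegs]
    intro i; by_cases e : i = j <;> simp [e, h]
  | succ n ih =>
    refine Prog.real_loop_succ (by omega) (Prog.real_dec hj s) ?_
    rintro _ rfl
    refine (ih _ (by simp [MState.setReg_regs, h])).mono ?_
    rintro _ rfl
    refine MState.withRegs_congr _ fun i => ?_
    simp only [MState.setReg_regs, Function.update_apply]
    split_ifs <;> rfl

/-- Add the register `a` to the register `d`, and empty the former. -/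
def Prog.transfer (a d : ℕ) : Prog := .loop a ((Prog.dec a).seq (.inc d))

theorem Prog.real_transfer {R a d : ℕ} (ha : a < R) (hd : d < R) (had : a ≠ d) (s : MState) :
    (Prog.transfer a d).Real R s fun s' =>
      s' = (s.setReg d (s.regs d + s.regs a)).setReg a 0 := by
  generalize h : s.regs a = n
  induction n generalizing s with
  | zero =>
    refine Prog.real_loop_zero h ?_
    refine (MState.eq_withRegs _ fun i => ?_).symm
    simp only [MState.setReg_regs, Function.update_apply]
    split_ifs with e1 e2
    · rw [e1, h]
    · rw [e2, add_zero]
    · rfl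
  | succ n ih =>
    refine Prog.real_loop_succ (by omega) ((Prog.real_dec ha s).seq ?_
      (Mid := fun s' => s' = s.setReg a (s.regs a - 1))) ?_
      (Mid := fun s' => s' = (s.setReg a n).setReg d (s.regs d + 1))
    · rintro _ rfl
      refine (Prog.real_inc hd _).mono ?_
      rintro _ rfl
      simp [MState.setReg_regs, h, Function.update_of_ne had.symm]
    · rintro _ rfl
      refine (ih _ (by simp [MState.setReg_regs, had])).mono ?_
      rintro _ rfl
      refine MState.withRegs_congr _ fun i => ?_
      simp only [MState.setReg_regs, Function.update_apply]
      split_ifs <;> first | rfl | omega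

/-- Add the register `a` to the registers `d` and `e`, and empty the former. -/
def Prog.spread (a d e : ℕ) : Prog := .loop a ((Prog.dec a).seq ((Prog.inc d).seq (.inc e)))

theorem Prog.real_spread {R a d e : ℕ} (ha : a < R) (hd : d < R) (he : e < R) (had : a ≠ d)
    (hae : a ≠ e) (hde : d ≠ e) (s : MState) :
    (Prog.spread a d e).Real R s fun s' =>
      s' = ((s.setReg d (s.regs d + s.regs a)).setReg e (s.regs e + s.regs a)).setReg a 0 := by
  generalize h : s.regs a = n
  induction n generalizing s with
  | zero =>
    refine Prog.real_loop_zero h ?_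
    refine (MState.eq_withRegs _ fun i => ?_).symm
    simp only [MState.setReg_regs, Function.update_apply]
    split_ifs with e1 e2 e3
    · rw [e1, h]
    · rw [e2, add_zero]
    · rw [e3, add_zero]
    · rfl
  | succ n ih =>
    refine Prog.real_loop_succ (by omega) ((Prog.real_dec ha s).seq ?_
      (Mid := fun s' => s' = s.setReg a (s.regs a - 1))) ?_
      (Mid := fun s' => s' = ((s.setReg a n).setReg d (s.regs d + 1)).setReg e (s.regs e + 1))
    · rintro _ rfl
      refine (Prog.real_inc hd _).seq ?_
      rintro _ rfl
      refine (Prog.real_inc he _).mono ?_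
      rintro _ rfl
      simp [MState.setReg_regs, h, Function.update_of_ne had.symm, Function.update_of_ne hae.symm,
        Function.update_of_ne hde.symm]
    · rintro _ rfl
      refine (ih _ (by simp [MState.setReg_regs, had, hae])).mono ?_
      rintro _ rfl
      refine MState.withRegs_congr _ fun i => ?_
      simp only [MState.setReg_regs, Function.update_apply]
      split_ifs <;> first | rfl | omega

/-- Copy the register `a` to the register `d`, with the auxiliary register `e`. -/
def Prog.assign (d a e : ℕ) : Prog :=
  (Prog.clear d).seq ((Prog.spread a d e).seq (Prog.transfer e a))

/-- Reading a register destroys it. It is therefore spread over `d` and the empty register `e`, and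
restored from `e`. -/
theorem Prog.real_assign {R a d e : ℕ} (ha : a < R) (hd : d < R) (he : e < R) (had : a ≠ d)
    (hae : a ≠ e) (hde : d ≠ e) (s : MState) (h0 : s.regs e = 0) :
    (Prog.assign d a e).Real R s fun s' => s' = s.setReg d (s.regs a) := by
  refine (Prog.real_clear hd s).seq ?_
  rintro _ rfl
  refine (Prog.real_spread ha hd he had hae hde _).seq ?_
  rintro _ rfl
  refine (Prog.real_transfer he ha hae.symm _).mono ?_
  rintro _ rfl
  refine MState.withRegs_congr _ fun i => ?_
  simp only [MState.setReg_regs, Function.update_apply]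
  split_ifs <;> first | rfl | omega | simp_all

theorem MState.setReg_setReg (s : MState) (j v w : ℕ) :
    (s.setReg j v).setReg j w = s.setReg j w := by
  refine MState.withRegs_congr _ fun i => ?_
  simp only [MState.setReg_regs, Function.update_apply]
  split_ifs <;> rfl

theorem MState.setReg_comm (s : MState) {i j : ℕ} (h : i ≠ j) (v w : ℕ) :
    (s.setReg i v).setReg j w = (s.setReg j w).setReg i v := by
  refine MState.withRegs_congr _ fun k => ?_
  simp only [MState.setReg_regs, Function.update_apply]
  split_ifs <;> first | rfl | omega

theorem MState.setReg_of_eq (s : MState) {j v : ℕ} (h : s.regs j = v) : s.setReg j v = s :=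
  MState.eq_withRegs _ fun i => by
    rw [Function.update_apply]; split_ifs with e
    exacts [by rw [e, h], rfl]

/-- Move the register `b` to `o`, with the auxiliary register `b + 1`. -/
theorem Prog.real_finish {R o b : ℕ} (ho : o < b) (hR : b + 2 ≤ R) (s : MState) {v : ℕ}
    (h0 : ∀ j ≥ b, s.regs j = 0) :
    ((Prog.assign o b (b + 1)).seq (Prog.clear b)).Real R (s.setReg b v)
      fun s' => s' = s.setReg o v := by
  refine (Prog.real_assign (by omega) (by omega) (by omega) (by omega) (by omega) (by omega) _ ?_).seq
    ?_
  · rw [MState.setReg_regs, Function.update_of_ne (by omega)]; exact h0 _ (by omega)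
  · rintro _ rfl
    refine (Prog.real_clear (by omega) _).mono ?_
    rintro _ rfl
    rw [MState.setReg_regs, Function.update_self, MState.setReg_comm _ (by omega),
      MState.setReg_setReg, MState.setReg_of_eq s (h0 b le_rfl)]

/-! ### Primitive recursive functions as register programs -/

/-- For the inputs in the registers `a i` and the output in the register `o`, all below `b`, there
is a program that computes `f`, using registers from `b` on as auxiliary ones. -/
def Programmable {n : ℕ} (f : List.Vector ℕ n → ℕ) : Prop :=
  ∀ (a : Fin n → ℕ) (o b : ℕ), (∀ i, a i < b) → o < b →
    -- The auxiliary registers are empty before and, since nothing but `o` changes, also after the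
    -- program. The number of tracks is only bounded from below, so that several programs can share
    -- one machine.
    ∃ (P : Prog) (R₀ : ℕ), ∀ R ≥ R₀, ∀ s : MState, (∀ j ≥ b, s.regs j = 0) →
      P.Real R s fun s' => s' = s.setReg o (f (List.Vector.ofFn fun i => s.regs (a i)))

theorem programmable_zero : Programmable (fun _ : List.Vector ℕ 0 => 0) := by
  intro a o b ha ho
  exact ⟨.clear o, o + 1, fun R hR s _ => Prog.real_clear (by omega) s⟩

theorem programmable_get {n : ℕ} (i : Fin n) : Programmable (fun v => v.get i) := by
  intro a o b ha ho
  -- The detour through `b` covers the case that `o` is itself the input register.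
  refine ⟨(Prog.assign b (a i) (b + 1)).seq ((Prog.assign o b (b + 1)).seq (Prog.clear b)), b + 2,
    fun R hR s h0 => ?_⟩
  have := ha i
  refine (Prog.real_assign (by omega) (by omega) (by omega) (by omega) (by omega) (by omega) _
    (h0 _ (by omega))).seq ?_
  rintro _ rfl
  refine (Prog.real_finish ho hR s h0).mono ?_
  rintro _ rfl
  simp

theorem programmable_succ : Programmable (fun v : List.Vector ℕ 1 => v.head.succ) := by
  intro a o b ha ho
  refine ⟨(Prog.assign b (a 0) (b + 1)).seq ((Prog.inc b).seq
    ((Prog.assign o b (b + 1)).seq (Prog.clear b))), b + 2, fun R hR s h0 => ?_⟩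
  have := ha 0
  refine (Prog.real_assign (by omega) (by omega) (by omega) (by omega) (by omega) (by omega) _
    (h0 _ (by omega))).seq ?_
  rintro _ rfl
  refine (Prog.real_inc (by omega) _).seq ?_
  rintro _ rfl
  rw [MState.setReg_setReg, MState.setReg_regs, Function.update_self]
  exact Prog.real_finish ho hR s h0

/-- For composition the inner values are collected in the registers `b, …, b + n - 1`. Each of them
is computed with auxiliary registers from `b + n` on, so that the earlier values are safe. -/
theorem exists_prog_family {m n : ℕ} {g : Fin n → List.Vector ℕ m → ℕ}
    (hg : ∀ i, Programmable (g i)) (a : Fin m → ℕ) (b : ℕ) (ha : ∀ i, a i < b) :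
    ∀ k ≤ n, ∃ (P : Prog) (R₀ : ℕ), ∀ R ≥ R₀, ∀ s : MState, (∀ j ≥ b, s.regs j = 0) →
      P.Real R s fun s' => s' = s.withRegs fun j => if h : b ≤ j ∧ j < b + k ∧ j - b < n then
        g ⟨j - b, h.2.2⟩ (List.Vector.ofFn fun i => s.regs (a i)) else s.regs j := by
  intro k
  induction k with
  | zero =>
    intro _
    refine ⟨.skip, 0, fun R _ s _ => Prog.real_skip (MState.eq_withRegs _ fun i => ?_).symm⟩
    rw [dif_neg (by omega)]
  | succ k ih =>
    intro hk
    obtain ⟨P, R₁, hP⟩ := ih (by omega)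
    obtain ⟨Q, R₂, hQ⟩ := hg ⟨k, by omega⟩ a (b + k) (b + n) (fun i => by have := ha i; omega)
      (by omega)
    refine ⟨P.seq Q, max R₁ R₂, fun R hR s h0 => (hP R (le_trans (le_max_left _ _) hR) s h0).seq ?_⟩
    rintro _ rfl
    refine (hQ R (le_trans (le_max_right _ _) hR) _ fun j hj => ?_).mono ?_
    · rw [MState.withRegs_regs, dif_neg (by omega)]
      exact h0 j (by omega)
    · rintro _ rfl
      refine MState.withRegs_congr _ fun j => ?_
      simp only [MState.withRegs_regs, Function.update_apply]
      by_cases e : j = b + k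
      · subst e
        rw [if_pos rfl, dif_pos (by omega)]
        have h1 : ∀ i, ¬ (b ≤ a i ∧ a i < b + k ∧ a i - b < n) := fun i => by have := ha i; omega
        simp only [h1, dite_false, Nat.add_sub_cancel_left]
      · rw [if_neg e]
        by_cases h : b ≤ j ∧ j < b + k ∧ j - b < n
        · rw [dif_pos h, dif_pos (by omega)]
        · rw [dif_neg h, dif_neg (by omega)]

theorem exists_prog_clear (b : ℕ) : ∀ k, ∃ P : Prog, ∀ R ≥ b + k, ∀ s : MState,
    P.Real R s fun s' => s' = s.withRegs fun j => if b ≤ j ∧ j < b + k then 0 else s.regs j := by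
  intro k
  induction k with
  | zero =>
    refine ⟨.skip, fun R _ s => Prog.real_skip (MState.eq_withRegs _ fun i => ?_).symm⟩
    rw [if_neg (by omega)]
  | succ k ih =>
    obtain ⟨P, hP⟩ := ih
    refine ⟨P.seq (.clear (b + k)), fun R hR s => (hP R (by omega) s).seq ?_⟩
    rintro _ rfl
    refine (Prog.real_clear (by omega) _).mono ?_
    rintro _ rfl
    refine MState.withRegs_congr _ fun j => ?_
    simp only [MState.withRegs_regs, Function.update_apply]
    split_ifs <;> first | rfl | omega

theorem Programmable.comp {m n : ℕ} {f : List.Vector ℕ n → ℕ} {g : Fin n → List.Vector ℕ m → ℕ}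
    (hf : Programmable f) (hg : ∀ i, Programmable (g i)) :
    Programmable fun v => f (List.Vector.ofFn fun i => g i v) := by
  intro a o b ha ho
  obtain ⟨P, R₁, hP⟩ := exists_prog_family hg a b ha n le_rfl
  obtain ⟨Q, R₂, hQ⟩ := hf (fun i => b + i) o (b + n) (fun i => by have := i.2; omega) (by omega)
  obtain ⟨S, hS⟩ := exists_prog_clear b n
  refine ⟨P.seq (Q.seq S), max (max R₁ R₂) (b + n), fun R hR s h0 => ?_⟩
  simp only [ge_iff_le, max_le_iff] at hR
  refine (hP R hR.1.1 s h0).seq ?_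
  rintro _ rfl
  refine (hQ R hR.1.2 _ fun j hj => ?_).seq ?_
  · rw [MState.withRegs_regs, dif_neg (by omega)]; exact h0 j (by omega)
  · rintro _ rfl
    refine (hS R hR.2 _).mono ?_
    rintro _ rfl
    refine MState.withRegs_congr _ fun j => ?_
    simp only [MState.setReg_regs, MState.withRegs_regs, Function.update_apply]
    by_cases h1 : b ≤ j ∧ j < b + n
    · rw [if_pos h1, if_neg (by omega), h0 j h1.1]
    · rw [if_neg h1]
      by_cases h2 : j = o
      · rw [if_pos h2, if_pos h2]
        congr 1
        refine congrArg List.Vector.ofFn (funext fun i => ?_)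
        rw [dif_pos (by have := i.2; omega)]
        congr 1
        ext; simp
      · rw [if_neg h2, if_neg h2, dif_neg (by omega)]

theorem Programmable.prec {n : ℕ} {f : List.Vector ℕ n → ℕ} {g : List.Vector ℕ (n + 2) → ℕ}
    (hf : Programmable f) (hg : Programmable g) :
    Programmable fun v : List.Vector ℕ (n + 1) =>
      v.head.rec (f v.tail) fun y IH => g (y ::ᵥ IH ::ᵥ v.tail) := by
  intro a o b ha ho
  obtain ⟨P, R₁, hP⟩ := hf (fun i => a i.succ) (b + 2) (b + 3)
    (fun i => by have := ha i.succ; omega) (by omega)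
  obtain ⟨Q, R₂, hQ⟩ := hg (Fin.cons (b + 1) (Fin.cons (b + 2) fun i => a i.succ)) (b + 2) (b + 3)
    (fun i => by
      refine Fin.cases ?_ (fun i => Fin.cases ?_ (fun i => ?_) i) i
      · simp
      · simp
      · have := ha i.succ; simp only [Fin.cons_succ]; omega) (by omega)
  -- Register `b` counts the remaining turns, `b + 1` is the recursion argument counted up from `0`,
  -- and `b + 2` holds the value reached; auxiliary registers start at `b + 3`.
  refine ⟨(Prog.assign b (a 0) (b + 3)).seq (P.seq
    ((Prog.loop b ((Prog.dec b).seq (Q.seq (Prog.inc (b + 1))))).seq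
      ((Prog.assign o (b + 2) (b + 3)).seq ((Prog.clear (b + 1)).seq (Prog.clear (b + 2)))))),
    max (max R₁ R₂) (b + 4), fun R hR s h0 => ?_⟩
  simp only [ge_iff_le, max_le_iff] at hR
  have ha0 := ha 0
  set w : List.Vector ℕ n := List.Vector.ofFn fun i => s.regs (a i.succ) with hw
  set N := s.regs (a 0) with hN
  set rec' : ℕ → ℕ := fun y => Nat.rec (f w) (fun y IH => g (y ::ᵥ IH ::ᵥ w)) y with hrec
  -- Loop invariant: the remaining turns and the turns made add up to `N`, and `b + 2` contains the
  -- value of the recursion at `y`.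
  have hloop : ∀ c y : ℕ, y + c = N →
      (Prog.loop b ((Prog.dec b).seq (Q.seq (Prog.inc (b + 1))))).Real R
        (((s.setReg b c).setReg (b + 1) y).setReg (b + 2) (rec' y)) fun s' =>
          s' = (s.setReg (b + 1) N).setReg (b + 2) (rec' N) := by
    intro c
    induction c with
    | zero =>
      intro y hy
      refine Prog.real_loop_zero ?_ ?_
      · simp [MState.setReg_regs]
      · obtain rfl : y = N := by omega
        rw [MState.setReg_of_eq s (h0 b le_rfl)]
    | succ c ih =>
      intro y hy
      refine Prog.real_loop_succ ?_ ((Prog.real_dec (by omega) _).seq (Post := fun s' =>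
        s' = ((s.setReg b c).setReg (b + 1) (y + 1)).setReg (b + 2) (rec' (y + 1))) ?_) ?_
      · simp [MState.setReg_regs]
      · rintro _ rfl
        refine (hQ R hR.1.2 _ fun j hj => ?_).seq ?_
        · simp only [MState.setReg_regs, Function.update_apply]
          rw [if_neg (by omega), if_neg (by omega), if_neg (by omega), if_neg (by omega)]
          exact h0 j (by omega)
        · rintro _ rfl
          refine (Prog.real_inc (by omega) _).mono ?_
          rintro _ rfl
          refine MState.withRegs_congr _ fun j => ?_
          simp only [MState.setReg_regs, Function.update_apply]
          have hv : (List.Vector.ofFn fun i =>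
              ((((s.setReg b (c + 1)).setReg (b + 1) y).setReg (b + 2) (rec' y)).setReg b c).regs
                ((Fin.cons (b + 1) (Fin.cons (b + 2) fun i => a i.succ : Fin (n + 1) → ℕ) :
                  Fin (n + 2) → ℕ) i)) = y ::ᵥ rec' y ::ᵥ w := by
            ext i
            refine Fin.cases ?_ (fun i => Fin.cases ?_ (fun i => ?_) i) i
            · simp [MState.setReg_regs]
            · simp [MState.setReg_regs]
              rfl
            · have := ha i.succ
              simp only [hw, List.Vector.get_ofFn, Fin.cons_succ, MState.setReg_regs,
                Function.update_apply, List.Vector.get_cons_succ]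
              rw [if_neg (by omega), if_neg (by omega), if_neg (by omega), if_neg (by omega)]
          have hv' := congrArg g hv
          simp only [MState.setReg_regs, Function.update_apply] at hv'
          by_cases e1 : j = b + 1
          · simp [e1]
          · by_cases e2 : j = b + 2
            · subst e2
              simp only [if_true]
              rw [if_neg (by omega)]
              simp [hrec] at hv' ⊢
              exact hv'
            · simp only [if_neg e1, if_neg e2]
              split_ifs <;> first | rfl | omega
      · rintro _ rfl
        exact ih (y + 1) (by omega)
  refine (Prog.real_assign (by omega) (by omega) (by omega) (by omega) (by omega) (by omega) _
    (h0 _ (by omega))).seq ?_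
  rintro _ rfl
  refine (hP R hR.1.1 _ fun j hj => ?_).seq ?_
  · rw [MState.setReg_regs, Function.update_of_ne (by omega)]; exact h0 j (by omega)
  rintro _ rfl
  have hstart : ((s.setReg b (s.regs (a 0))).setReg (b + 2) (f (List.Vector.ofFn fun i =>
      (s.setReg b (s.regs (a 0))).regs (a i.succ)))) =
      (((s.setReg b N).setReg (b + 1) 0).setReg (b + 2) (rec' 0)) := by
    refine MState.withRegs_congr _ fun j => ?_
    have hv : (List.Vector.ofFn fun i => (s.setReg b (s.regs (a 0))).regs (a i.succ)) = w := by
      rw [hw]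
      refine congrArg List.Vector.ofFn (funext fun i => ?_)
      have := ha i.succ
      rw [MState.setReg_regs, Function.update_of_ne (by omega)]
    rw [hv]
    simp only [MState.setReg_regs, Function.update_apply]
    split_ifs <;> first | rfl | omega | (rename_i e; rw [e]; exact h0 _ (by omega))
  rw [hstart]
  refine (hloop N 0 (by omega)).seq ?_
  rintro _ rfl
  refine (Prog.real_assign (by omega) (by omega) (by omega) (by omega) (by omega) (by omega) _
    ?_).seq ?_
  · simp only [MState.setReg_regs, Function.update_apply]
    rw [if_neg (by omega), if_neg (by omega)]; exact h0 _ (by omega)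
  rintro _ rfl
  refine (Prog.real_clear (by omega) _).seq ?_
  rintro _ rfl
  refine (Prog.real_clear (by omega) _).mono ?_
  rintro _ rfl
  refine MState.withRegs_congr _ fun j => ?_
  simp only [MState.setReg_regs, Function.update_apply]
  by_cases e1 : j = b + 2
  · rw [if_pos e1, if_neg (by omega), e1, h0 _ (by omega)]
  by_cases e2 : j = b + 1
  · rw [if_neg e1, if_pos e2, if_neg (by omega), e2, h0 _ (by omega)]
  rw [if_neg e1, if_neg e2]
  by_cases e3 : j = o
  · rw [if_pos e3, if_pos e3, if_pos trivial]
    have h1 : (List.Vector.ofFn fun i => s.regs (a i)).head = N := by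
      simp [hN]
    have h2 : (List.Vector.ofFn fun i => s.regs (a i)).tail = w := by
      simp [hw]
    rw [h1, h2]
  · rw [if_neg e3, if_neg e3, if_neg e1, if_neg e2]

theorem programmable_of_primrec' {n : ℕ} {f : List.Vector ℕ n → ℕ} (hf : Nat.Primrec' f) :
    Programmable f := by
  induction hf with
  | zero => exact programmable_zero
  | succ => exact programmable_succ
  | get i => exact programmable_get i
  | comp g _ _ ihf ihg => exact Programmable.comp ihf ihg
  | prec _ _ ihf ihg => exact Programmable.prec ihf ihg

theorem exists_prog_unary {f : ℕ → ℕ} (hf : Primrec f) (a o b : ℕ) (ha : a < b) (ho : o < b) :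
    ∃ (P : Prog) (R₀ : ℕ), ∀ R ≥ R₀, ∀ s : MState, (∀ j ≥ b, s.regs j = 0) →
      P.Real R s fun s' => s' = s.setReg o (f (s.regs a)) := by
  obtain ⟨P, R₀, h⟩ := programmable_of_primrec' (Nat.Primrec'.prim_iff₁.2 hf) (fun _ => a) o b
    (fun _ => ha) ho
  refine ⟨P, R₀, fun R hR s h0 => (h R hR s h0).mono ?_⟩
  rintro _ rfl
  simp

theorem exists_prog_binary {f : ℕ → ℕ → ℕ} (hf : Primrec₂ f) (a a' o b : ℕ) (ha : a < b)
    (ha' : a' < b) (ho : o < b) :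
    ∃ (P : Prog) (R₀ : ℕ), ∀ R ≥ R₀, ∀ s : MState, (∀ j ≥ b, s.regs j = 0) →
      P.Real R s fun s' => s' = s.setReg o (f (s.regs a) (s.regs a')) := by
  obtain ⟨P, R₀, h⟩ := programmable_of_primrec' (Nat.Primrec'.prim_iff₂.2 hf) ![a, a'] o b
    (fun i => by fin_cases i <;> assumption) ho
  refine ⟨P, R₀, fun R hR s h0 => (h R hR s h0).mono ?_⟩
  rintro _ rfl
  simp

end CoL

namespace CoL

open Encodable

/-! ### Reading the run tape -/

/-- The position read so far, in reversed order and with reversed moves, after one more symbol of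
the run tape. -/
def pushSym (acc : List LabMove) (x : Player ⊕ Key) : List LabMove :=
  x.elim (fun p => (p, []) :: acc) fun c => acc.head?.elim [] fun m => (m.1, c :: m.2) :: acc.tail

/-- The position from the form in which it has been read. -/
def unread (acc : List LabMove) : List LabMove := acc.reverse.map fun m => (m.1, m.2.reverse)

theorem foldl_pushSym_keys (p : Player) (w : List Key) (acc : List LabMove) : ∀ v : List Key,
    (w.map Sum.inr).foldl pushSym ((p, v) :: acc) = (p, w.reverse ++ v) :: acc := by
  induction w with
  | nil => intro v; rfl
  | cons c w ih => intro v; simp [pushSym, ih]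

theorem foldl_pushSym_spell (Φ : List LabMove) : ∀ acc,
    (spell Φ).foldl pushSym acc = (Φ.map fun m => (m.1, m.2.reverse)).reverse ++ acc := by
  induction Φ with
  | nil => intro acc; rfl
  | cons m Φ ih =>
    intro acc
    have h : (spell (m :: Φ)) = Sum.inl m.1 :: (m.2.map Sum.inr ++ spell Φ) := by simp [spell]
    rw [h, List.foldl_cons, List.foldl_append]
    have h' : pushSym acc (Sum.inl m.1) = (m.1, []) :: acc := rfl
    rw [h', foldl_pushSym_keys, ih]
    simp

theorem unread_foldl_pushSym (Φ : List LabMove) : unread ((spell Φ).foldl pushSym []) = Φ := by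
  simp [foldl_pushSym_spell, unread, Function.comp_def]

theorem primrec_pushSym : Primrec₂ pushSym := by
  have h : Primrec fun q : List LabMove × (Player ⊕ Key) =>
      (Sum.casesOn q.2 (fun p => (p, []) :: q.1) fun c =>
        (Option.casesOn q.1.head? [] fun m => (m.1, c :: m.2) :: q.1.tail) : List LabMove) := by
    refine Primrec.sumCasesOn Primrec.snd ?_ ?_
    · exact Primrec.list_cons.comp (Primrec.pair Primrec.snd (Primrec.const []))
        (Primrec.fst.comp Primrec.fst)
    · refine Primrec.option_casesOn (Primrec.list_head?.comp (Primrec.fst.comp Primrec.fst))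
        (Primrec.const []) ?_
      exact Primrec.list_cons.comp (Primrec.pair (Primrec.fst.comp Primrec.snd)
        (Primrec.list_cons.comp (Primrec.snd.comp Primrec.fst) (Primrec.snd.comp Primrec.snd)))
        (Primrec.list_tail.comp (Primrec.fst.comp (Primrec.fst.comp Primrec.fst)))
  refine h.of_eq ?_
  rintro ⟨acc, p | c⟩
  · rfl
  · cases acc <;> rfl

theorem primrec_unread : Primrec unread :=
  Primrec.list_map Primrec.list_reverse
    (Primrec.pair (Primrec.fst.comp Primrec.snd)
      (Primrec.list_reverse.comp (Primrec.snd.comp Primrec.snd))).to₂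

/-- The effect of reading the symbol `x` on the code of what has been read. -/
def pushCode (x : Player ⊕ Key) (X : ℕ) : ℕ :=
  encode (pushSym ((decode (α := List LabMove) X).getD []) x)

theorem primrec_pushCode (x : Player ⊕ Key) : Primrec (pushCode x) :=
  Primrec.encode.comp (primrec_pushSym.comp
    (Primrec.option_getD.comp Primrec.decode (Primrec.const [])) (Primrec.const x))

/-- The code of the response to the coded position `X`: `0` for granting permission, and otherwise
the successor of the code of the reversed move. -/
def responseCode (S : ℕ → List LabMove → Option Move) (n X : ℕ) : ℕ :=
  (S (n - 1) (unread ((decode (α := List LabMove) X).getD []))).elim 0 fun μ =>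
    encode (μ.reverse.map Fin.val) + 1

theorem primrec_responseCode {S : ℕ → List LabMove → Option Move} (hS : Primrec₂ S) :
    Primrec₂ (responseCode S) := by
  have h1 : Primrec fun q : ℕ × ℕ =>
      S (q.1 - 1) (unread ((decode (α := List LabMove) q.2).getD [])) :=
    hS.comp (Primrec.nat_sub.comp Primrec.fst (Primrec.const 1)) (primrec_unread.comp
      (Primrec.option_getD.comp (Primrec.decode.comp Primrec.snd) (Primrec.const [])))
  have h2 : Primrec₂ fun (_ : ℕ × ℕ) (μ : Move) => encode (μ.reverse.map Fin.val) + 1 :=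
    Primrec.succ.comp (Primrec.encode.comp (Primrec.list_map
      (Primrec.list_reverse.comp Primrec.snd) (Primrec.fin_val.comp Primrec.snd).to₂))
  refine (Primrec.option_casesOn h1 (Primrec.const 0) h2).of_eq fun q => ?_
  simp only [responseCode]
  cases S (q.1 - 1) (unread ((decode (α := List LabMove) q.2).getD [])) <;> rfl

/-- The symbols that may stand on the run tape. -/
def runSymbols : List (Player ⊕ Key) :=
  .inl .top :: .inl .bot :: (List.finRange 95).map .inr

theorem mem_runSymbols (x : Player ⊕ Key) : x ∈ runSymbols := by
  rcases x with (_ | _) | c <;> simp [runSymbols]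

/-- What has been read of the run tape is stored in register `1`. -/
def MState.HasRead (s : MState) : Prop :=
  s.rh ≤ (spell s.pos).length ∧
    s.regs 1 = encode (((spell s.pos).take s.rh).foldl pushSym [])

open Classical in
-- There is one test for each symbol. The scanned symbol does not change meanwhile, so at most one
-- test succeeds; without `Nodup` the symbol might be recorded twice.
theorem exists_prog_dispatch (l : List (Player ⊕ Key)) :
    ∃ (P : Prog) (R₀ : ℕ), ∀ R ≥ R₀, ∀ s : MState, (∀ j ≥ 5, s.regs j = 0) →
      ∀ x : Player ⊕ Key, (spell s.pos)[s.rh]? = some x → l.Nodup →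
        P.Real R s fun s' => s' = if x ∈ l then s.setReg 1 (pushCode x (s.regs 1)) else s := by
  induction l with
  | nil => exact ⟨.skip, 0, fun R _ s _ x _ _ => Prog.real_skip (by simp)⟩
  | cons y l ih =>
    obtain ⟨P, R₁, hP⟩ := ih
    obtain ⟨Q, R₂, hQ⟩ := exists_prog_unary (primrec_pushCode y) 1 1 5 (by norm_num) (by norm_num)
    refine ⟨(Prog.ifRun (some y) Q).seq P, max R₁ R₂, fun R hR s h0 x hx hl => ?_⟩
    simp only [ge_iff_le, max_le_iff] at hR
    rw [List.nodup_cons] at hl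
    by_cases e : x = y
    · subst e
      refine (Prog.real_ifRun_pos hx (hQ R hR.2 s h0)).seq ?_
      rintro _ rfl
      refine (hP R hR.1 (s.setReg 1 (pushCode x (s.regs 1))) (fun j hj => ?_) x hx hl.2).mono ?_
      · rw [MState.setReg_regs, Function.update_of_ne (by omega)]; exact h0 j hj
      · rintro _ rfl
        rw [if_neg hl.1, if_pos (by simp)]
    · refine (Prog.real_ifRun_neg (Post := fun s' => s' = s) ?_ rfl).seq ?_
      · rw [hx]; simpa using e
      · rintro _ rfl
        refine (hP R hR.1 _ h0 x hx hl.2).mono ?_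
        rintro _ rfl
        simp [e]

theorem nodup_runSymbols : runSymbols.Nodup := by
  simp [runSymbols, List.nodup_map_iff Sum.inr_injective, List.nodup_finRange]

/-- The run tape is only ever extended, so reading resumes where it stopped in the previous round,
and register `1` keeps the fold over everything read. -/
theorem exists_prog_read : ∃ (P : Prog) (R₀ : ℕ), ∀ R ≥ R₀, ∀ s : MState,
    (∀ j ≥ 5, s.regs j = 0) → s.HasRead →
      P.Real R s fun s' => s' = { (s.setReg 1 (encode ((spell s.pos).foldl pushSym [])))
        with rh := (spell s.pos).length } := by
  obtain ⟨P, R₀, hP⟩ := exists_prog_dispatch runSymbols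
  refine ⟨.loopRun (P.seq .advance), R₀, fun R hR s h0 hs => ?_⟩
  generalize hn : (spell s.pos).length - s.rh = n
  induction n generalizing s with
  | zero =>
    obtain ⟨h1, h2⟩ := hs
    have e : s.rh = (spell s.pos).length := by omega
    refine Prog.real_loopRun_none (List.getElem?_eq_none (by omega)) ?_
    rw [e, List.take_length] at h2
    rw [MState.setReg_of_eq s h2, ← e]
  | succ n ih =>
    have hlt : s.rh < (spell s.pos).length := by omega
    refine Prog.real_loopRun_some (Mid := fun s' =>
      s' = { (s.setReg 1 (pushCode (spell s.pos)[s.rh] (s.regs 1))) with rh := s.rh + 1 })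
      (by rw [List.getElem?_eq_getElem hlt]; simp) ?_ ?_
    · refine (hP R hR s h0 _ (List.getElem?_eq_getElem hlt) nodup_runSymbols).seq ?_
      rintro _ rfl
      rw [if_pos (mem_runSymbols _)]
      refine (Prog.real_advance _).mono ?_
      rintro _ rfl
      rfl
    · rintro _ rfl
      refine (ih _ (fun j hj => ?_) ⟨?_, ?_⟩ ?_).mono ?_
      · rw [MState.setReg_regs, Function.update_of_ne (by omega)]; exact h0 j hj
      · change s.rh + 1 ≤ (spell s.pos).length; omega
      · change (s.setReg 1 _).regs 1 = encode (((spell s.pos).take (s.rh + 1)).foldl pushSym [])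
        rw [MState.setReg_regs, Function.update_self, pushCode, hs.2, encodek, Option.getD_some,
          List.take_add_one, List.foldl_append, List.getElem?_eq_getElem hlt]
        rfl
      · change (spell s.pos).length - (s.rh + 1) = n; omega
      · rintro _ rfl
        simp only [MState.setReg, Function.update_idem]

/-- The code of `k :: L` is the successor of the pair of `k` and the code of `L`, so predecessor and
unpairing peel off one character per turn. Since pushing puts characters in front, the move comes
out reversed; this is why `responseCode` reverses it beforehand. -/
theorem exists_prog_prepare : ∃ (P : Prog) (R₀ : ℕ), ∀ R ≥ R₀, ∀ (L : List ℕ) (s : MState),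
    (∀ k ∈ L, k < 95) → (∀ j ≥ 5, s.regs j = 0) → s.regs 2 = encode L → s.regs 3 = 0 →
      P.Real R s fun s' => s' = { (s.setReg 2 0) with buf := L.reverse ++ s.buf } := by
  obtain ⟨P, R₁, hP⟩ := exists_prog_unary (f := fun Y => (Y - 1).unpair.1)
    (Primrec.fst.comp (Primrec.unpair.comp Primrec.pred)) 2 3 5 (by norm_num) (by norm_num)
  obtain ⟨Q, R₂, hQ⟩ := exists_prog_unary (f := fun Y => (Y - 1).unpair.2)
    (Primrec.snd.comp (Primrec.unpair.comp Primrec.pred)) 2 2 5 (by norm_num) (by norm_num)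
  -- The character just pushed is counted up as often as register `3` says.
  have hbump : ∀ R ≥ 5, ∀ (n k : ℕ) (s : MState) (l : List ℕ), s.regs 3 = n → s.buf = k :: l →
      k + n < 95 → (Prog.loop 3 (Prog.bump.seq (Prog.dec 3))).Real R s fun s' =>
        s' = { (s.setReg 3 0) with buf := (k + n) :: l } := by
    intro R hR n
    induction n with
    | zero =>
      intro k s l h3 hb _
      refine Prog.real_loop_zero h3 ?_
      rw [MState.setReg_of_eq s h3, add_zero, ← hb]
    | succ n ih =>
      intro k s l h3 hb hk
      refine Prog.real_loop_succ (by omega) ((Prog.real_bump s hb (by omega)).seq (Post := fun s' =>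
        s' = { (s.setReg 3 n) with buf := (k + 1) :: l }) ?_) ?_
      · rintro _ rfl
        refine (Prog.real_dec (by omega) _).mono ?_
        rintro _ rfl
        simp [MState.setReg, h3]
      · rintro _ rfl
        refine (ih (k + 1) _ l (by simp [MState.setReg]) rfl (by omega)).mono ?_
        rintro _ rfl
        simp [MState.setReg, add_assoc, add_comm 1]
  refine ⟨.loop 2 (P.seq (Q.seq (Prog.push.seq (Prog.loop 3 (Prog.bump.seq (Prog.dec 3)))))),
    max (max R₁ R₂) 5, fun R hR L => ?_⟩
  simp only [ge_iff_le, max_le_iff] at hR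
  induction L with
  | nil =>
    intro s _ h0 h2 h3
    refine Prog.real_loop_zero h2 ?_
    rw [MState.setReg_of_eq s (v := 0) h2]; rfl
  | cons k L ih =>
    intro s hL h0 h2 h3
    have e2 : s.regs 2 = Nat.pair k (encode L) + 1 := by rw [h2]; rfl
    refine Prog.real_loop_succ (by omega) (Mid := fun s' =>
      s' = { (s.setReg 2 (encode L)) with buf := k :: s.buf })
      ((hP R hR.1.1 s h0).seq ?_) ?_
    · rintro _ rfl
      refine (hQ R hR.1.2 _ fun j hj => ?_).seq ?_
      · rw [MState.setReg_regs, Function.update_of_ne (by omega)]; exact h0 j hj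
      rintro _ rfl
      refine (Prog.real_push _).seq ?_
      rintro _ rfl
      have hk := hL k (by simp)
      refine (hbump R hR.2 k 0 _ s.buf (by simp [MState.setReg, e2]) rfl (by omega)).mono ?_
      rintro _ rfl
      simp only [MState.setReg, zero_add, e2, MState.mk.injEq, and_true]
      funext j
      simp only [Function.update_apply]
      split_ifs <;> simp_all
    · rintro _ rfl
      refine (ih _ (fun k hk => hL k (by simp [hk])) (fun j hj => ?_) (by simp [MState.setReg])
        (by simpa [MState.setReg] using h3)).mono ?_
      · simp only [MState.setReg]; rw [Function.update_of_ne (by omega)]; exact h0 j hj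
      · rintro _ rfl
        simp [MState.setReg]

theorem toMove_val (μ : Move) : toMove (μ.map Fin.val) = μ := by
  induction μ with
  | nil => rfl
  | cons c μ ih => simp only [toMove, List.map_cons] at ih ⊢; simp [ih]

/-- The states between two rounds of the main loop. -/
structure MState.Ready (n : ℕ) (s : MState) : Prop where
  reg_zero : s.regs 0 = n
  read : s.HasRead
  rest : ∀ j ≥ 2, s.regs j = 0
  buf : s.buf = []

/-- The position `Φ'` may follow after `Φ` when `⊤` acts according to the response `o`. -/
def FollowsBy (o : Option Move) (Φ Φ' : List LabMove) : Prop :=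
  o.elim (Φ' = Φ ∨ ∃ α, Φ' = Φ ++ [(.bot, α)]) fun μ => Φ' = Φ ++ [(.top, μ)]

theorem MState.HasRead.append {s s' : MState} (h : s.HasRead)
    (hr : s.rh = (spell s.pos).length) (h1 : s'.rh = s.rh) (h2 : s'.regs 1 = s.regs 1)
    (m : List LabMove) (h3 : s'.pos = s.pos ++ m) : s'.HasRead := by
  have e : spell (s.pos ++ m) = spell s.pos ++ spell m := by simp [spell]
  refine ⟨?_, ?_⟩
  · rw [h1, h3, e, hr]; simp
  · rw [h2, h.2, h1, h3, e, hr, List.take_append_of_le_length le_rfl]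

/-- Registers `0` to `4` hold the parameter plus one, the position read, the code of the response, a
character and a flag. The two branches are loops on the flag that turn at most once: `1 - Y` opens
the one that grants permission, `min Y 1` the one that moves. In the former case `Y = 0`, so
preparing the move does nothing. -/
theorem exists_prog_round {S : ℕ → List LabMove → Option Move} (hS : Primrec₂ S) :
    ∃ (P : Prog) (R₀ : ℕ), ∀ R ≥ R₀, ∀ (n : ℕ) (s : MState), s.Ready n →
      P.Real R s fun s' => s'.Ready n ∧ FollowsBy (S (n - 1) s.pos) s.pos s'.pos ∧
        (S (n - 1) s.pos = none → s'.permits ≠ s.permits) := by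
  obtain ⟨P1, R1, h1⟩ := exists_prog_read
  obtain ⟨P2, R2, h2⟩ := exists_prog_binary (primrec_responseCode hS) 0 1 2 5 (by norm_num)
    (by norm_num) (by norm_num)
  obtain ⟨P3, R3, h3⟩ := exists_prog_unary (f := fun Y => 1 - Y)
    (Primrec.nat_sub.comp (Primrec.const 1) Primrec.id) 2 4 5 (by norm_num) (by norm_num)
  obtain ⟨P4, R4, h4⟩ := exists_prog_unary (f := fun Y => min Y 1)
    (Primrec.nat_min.comp Primrec.id (Primrec.const 1)) 2 4 5 (by norm_num) (by norm_num)
  obtain ⟨P5, R5, h5⟩ := exists_prog_prepare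
  refine ⟨P1.seq (P2.seq (P3.seq ((Prog.loop 4 (Prog.permit.seq (Prog.dec 4))).seq (P4.seq
    ((Prog.dec 2).seq (P5.seq (Prog.loop 4 (Prog.emit.seq (Prog.dec 4))))))))),
    max (max (max R1 R2) (max R3 R4)) (max R5 5), fun R hR n s hs => ?_⟩
  simp only [ge_iff_le, max_le_iff] at hR
  refine (h1 R hR.1.1.1 s (fun j hj => hs.rest j (by omega)) hs.read).seq ?_
  rintro _ rfl
  set s₁ : MState := { (s.setReg 1 (encode ((spell s.pos).foldl pushSym []))) with
    rh := (spell s.pos).length } with hs₁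
  have r1 : ∀ j ≥ 2, s₁.regs j = 0 := fun j hj => by
    rw [hs₁]; simp only [MState.setReg]; rw [Function.update_of_ne (by omega)]; exact hs.rest j hj
  have hr1 : s₁.HasRead := ⟨le_rfl, by simp [hs₁, MState.setReg]⟩
  have h01 : s₁.regs 0 = n := by simp [hs₁, MState.setReg, hs.reg_zero]
  have hY : responseCode S (s₁.regs 0) (s₁.regs 1) = (S (n - 1) s.pos).elim 0 fun μ =>
      encode (μ.reverse.map Fin.val) + 1 := by
    rw [h01]; simp [hs₁, MState.setReg, responseCode, unread_foldl_pushSym]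
  have hp1 : s₁.pos = s.pos := rfl
  have hq1 : s₁.permits = s.permits := rfl
  have hb1 : s₁.buf = [] := hs.buf
  have hrh1 : s₁.rh = (spell s₁.pos).length := rfl
  clear_value s₁
  refine (h2 R hR.1.1.2 s₁ fun j hj => r1 j (by omega)).seq ?_
  rintro _ rfl
  rw [hY]
  rw [← hp1, ← hq1]
  rw [← hp1] at hY
  refine (h3 R hR.1.2.1 _ fun j hj => ?_).seq ?_
  · rw [MState.setReg_regs, Function.update_of_ne (by omega)]; exact r1 j (by omega)
  rintro _ rfl
  cases hSs : S (n - 1) s₁.pos with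
  | none =>
    simp only [Option.elim_none]
    rw [MState.setReg_of_eq s₁ (r1 2 le_rfl), r1 2 le_rfl]
    refine Prog.Real.seq (Mid := fun s' => s'.Ready n ∧ (s'.pos = s₁.pos ∨
      ∃ α, s'.pos = s₁.pos ++ [(.bot, α)]) ∧ s'.permits = s₁.permits + 1) ?_ ?_
    · refine Prog.real_loop_succ (by simp [MState.setReg]) ((Prog.real_permit _).seq
        (Post := fun s' => s'.Ready n ∧ (s'.pos = s₁.pos ∨
          ∃ α, s'.pos = s₁.pos ++ [(.bot, α)]) ∧ s'.permits = s₁.permits + 1) ?_) ?_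
      · intro s' hs'
        refine (Prog.real_dec (by omega) _).mono ?_
        rintro _ rfl
        have hR1 : ∀ j ≥ 2, Function.update (Function.update s₁.regs 4 1) 4 0 j = 0 := by
          intro j hj
          rw [Function.update_idem, Function.update_apply]; split_ifs; exacts [rfl, r1 j hj]
        rcases hs' with rfl | ⟨α, rfl⟩
        · refine ⟨⟨?_, ?_, ?_, hb1⟩, Or.inl rfl, rfl⟩
          · simpa [MState.setReg] using h01
          · exact hr1.append hrh1 rfl (by simp [MState.setReg]) [] (by simp [MState.setReg])
          · simpa [MState.setReg] using hR1
        · refine ⟨⟨?_, ?_, ?_, hb1⟩, Or.inr ⟨α, rfl⟩, rfl⟩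
          · simpa [MState.setReg] using h01
          · exact hr1.append hrh1 rfl (by simp [MState.setReg]) _ rfl
          · simpa [MState.setReg] using hR1
      · rintro s' hs'
        exact Prog.real_loop_zero (hs'.1.rest 4 (by norm_num)) hs'
    · rintro s' ⟨g1, g2, g3⟩
      refine (h4 R hR.1.2.2 _ fun j hj => g1.rest j (by omega)).seq ?_
      rintro _ rfl
      rw [g1.rest 2 le_rfl, MState.setReg_of_eq s' (by simpa using g1.rest 4 (by norm_num))]
      refine (Prog.real_dec (by omega) _).seq ?_
      rintro _ rfl
      rw [g1.rest 2 le_rfl, MState.setReg_of_eq s' (by simpa using g1.rest 2 (by norm_num))]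
      refine (h5 R hR.2.1 [] s' (by simp) (fun j hj => g1.rest j (by omega)) (g1.rest 2 le_rfl)
        (g1.rest 3 (by norm_num))).seq ?_
      rintro _ rfl
      rw [MState.setReg_of_eq s' (by simpa using g1.rest 2 (by norm_num))]
      refine Prog.real_loop_zero (g1.rest 4 (by norm_num)) ⟨g1, g2, fun _ => ?_⟩
      change s'.permits ≠ _
      omega
  | some μ =>
    simp only [Option.elim_some]
    set Y := encode (μ.reverse.map Fin.val) with hYdef
    have e1 : ∀ v : ℕ, (s₁.setReg 2 v).regs 2 = v := fun v => by simp [MState.setReg]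
    rw [e1, show 1 - (Y + 1) = 0 by omega,
      MState.setReg_of_eq _ (by simpa [MState.setReg] using r1 4 (by norm_num))]
    refine (Prog.real_loop_zero (by simpa [MState.setReg] using r1 4 (by norm_num))
      (Post := fun s' => s' = s₁.setReg 2 (Y + 1)) rfl).seq ?_
    rintro _ rfl
    refine (h4 R hR.1.2.2 _ fun j hj => ?_).seq ?_
    · rw [MState.setReg_regs, Function.update_of_ne (by omega)]; exact r1 j (by omega)
    rintro _ rfl
    rw [e1, show min (Y + 1) 1 = 1 by omega]
    refine (Prog.real_dec (by omega) _).seq ?_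
    rintro _ rfl
    refine (h5 R hR.2.1 (μ.reverse.map Fin.val) _ ?_ (fun j hj => ?_) ?_ ?_).seq ?_
    · intro k hk
      obtain ⟨c, -, rfl⟩ := List.mem_map.1 hk
      exact c.2
    · simp only [MState.setReg_regs]
      rw [Function.update_of_ne (by omega), Function.update_of_ne (by omega),
        Function.update_of_ne (by omega)]
      exact r1 j (by omega)
    · simp [MState.setReg, hYdef]
    · simpa [MState.setReg] using r1 3 (by norm_num)
    rintro _ rfl
    refine Prog.real_loop_succ (by simp [MState.setReg]) ((Prog.real_emit _).seq
      (Post := fun s' => s' = { s₁ with pos := s₁.pos ++ [(.top, μ)] }) ?_) ?_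
    · rintro _ rfl
      refine (Prog.real_dec (by omega) _).mono ?_
      rintro _ rfl
      simp only [MState.setReg, hb1, List.append_nil, MState.mk.injEq, true_and, and_true]
      refine ⟨?_, ?_⟩
      · funext j
        have h2 := r1 2 le_rfl
        have h4 := r1 4 (by norm_num)
        simp only [Function.update_apply]
        split_ifs <;> simp_all
      · rw [← List.map_reverse, List.reverse_reverse, toMove_val]
    · rintro _ rfl
      refine Prog.real_loop_zero (r1 4 (by norm_num)) ⟨⟨h01, ?_, r1, hb1⟩, rfl, by simp⟩
      exact hr1.append hrh1 rfl rfl _ rfl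

end CoL

namespace CoL

/-! ### Limits of increasing sequences of positions -/

theorem limitRun_eq_of_cofinal {p q : ℕ → List LabMove} (hp : ∀ n k, n ≤ k → p n <+: p k)
    (hq : ∀ n k, n ≤ k → q n <+: q k) (h1 : ∀ n, ∃ k, p n <+: q k) (h2 : ∀ n, ∃ k, q n <+: p k) :
    limitRun p = limitRun q := by
  ext1 i
  by_cases h : ∃ n, i < (p n).length
  · obtain ⟨n, hn⟩ := h
    obtain ⟨k, t, hk⟩ := h1 n
    have hk' : i < (q k).length := by rw [← hk, List.length_append]; omega
    rw [limitRun_get? hp hn, limitRun_get? hq hk', ← hk, List.getElem?_append_left hn]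
  · rw [limitRun_get?_none h, limitRun_get?_none]
    rintro ⟨n, hn⟩
    obtain ⟨k, hk⟩ := h2 n
    exact h ⟨k, lt_of_lt_of_le hn hk.length_le⟩

theorem prefix_of_succ {p : ℕ → List LabMove} (h : ∀ n, p n <+: p (n + 1)) (n k : ℕ)
    (hk : n ≤ k) : p n <+: p k := by
  induction k, hk using Nat.le_induction with
  | base => exact List.prefix_rfl
  | succ k _ ih => exact ih.trans (h k)

theorem EPM.Succ.isPrefix {M : EPM} {c d : Config} (h : M.Succ c d) : c.position <+: d.position := by
  unfold EPM.Succ at h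
  cases hi : M.instr c with
  | none => rw [hi] at h; rw [h]
  | some i =>
    rw [hi] at h
    have h4 := h.2.2.2
    cases ha : i.action <;> rw [ha] at h4 <;> simp only [Config.NextPosition] at h4
    · rw [h4]
    · rw [h4]; exact List.prefix_append _ _
    · rcases h4 with h4 | ⟨α, h4⟩ <;> rw [h4]
      exact List.prefix_append _ _

/-! ### The machine of a strategy -/

/-- Instructions are found by `List.lookup`, which compares keys by `==`; this lets the comparison
be replaced by equality. -/
instance : LawfulBEq (Player ⊕ Key) where
  eq_of_beq {a b} h := by
    rcases a with a | a <;> rcases b with b | b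
    · exact congrArg Sum.inl (eq_of_beq (α := Player) h)
    · exact absurd (show false = true from h) (by simp)
    · exact absurd (show false = true from h) (by simp)
    · exact congrArg Sum.inr (eq_of_beq (α := Key) h)
  rfl {a} := by
    rcases a with a | a
    · exact beq_self_eq_true (α := Player) a
    · exact beq_self_eq_true (α := Key) a

theorem lookup_eq_some {κ ν : Type*} [BEq κ] [LawfulBEq κ] (F : κ → ν) (l : List (κ × ν)) (k : κ)
    (hF : ∀ x ∈ l, x.2 = F x.1) (hk : ∃ x ∈ l, x.1 = k) : List.lookup k l = some (F k) := by
  induction l with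
  | nil => simp at hk
  | cons a l ih =>
    obtain ⟨a, b⟩ := a
    rw [List.lookup_cons]
    by_cases e : k = a
    · subst e
      simpa using hF (k, b) (by simp)
    · have hne : (k == a) = false := by simpa using e
      rw [hne]
      refine ih (fun x hx => hF x (by simp [hx])) ?_
      obtain ⟨x, hx, rfl⟩ := hk
      rcases List.mem_cons.1 hx with rfl | hx
      · exact absurd rfl e
      · exact ⟨x, hx, rfl⟩

theorem lookup_append_right {κ ν : Type*} [BEq κ] [LawfulBEq κ] (l l' : List (κ × ν)) (k : κ)
    (h : ∀ x ∈ l, x.1 ≠ k) : List.lookup k (l ++ l') = List.lookup k l' := by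
  induction l with
  | nil => rfl
  | cons a l ih =>
    obtain ⟨a, b⟩ := a
    have hne : (k == a) = false := by simpa using Ne.symm (h (a, b) (by simp))
    rw [List.cons_append, List.lookup_cons, hne]
    exact ih fun x hx => h x (by simp [hx])

/-- The table of the handlers `H` for the states from `1` on. -/
def tableOf (R : ℕ) (H : List Handler) : EPM :=
  (List.range H.length).flatMap fun q => (List.range (96 + 2 ^ (R + 1))).flatMap fun s =>
    (none :: runSymbols.map some).map fun r =>
      -- The states are shifted by one because the start state `0` belongs to the setup. The default
      -- handler is never reached, as `q` is in range.
      ((q + 1, s, r), (H.getD q fun s _ => goto 0 s) s r)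

theorem lookup_tableOf {R : ℕ} {H : List Handler} {q s : ℕ} (hq : q < H.length)
    (hs : s < 96 + 2 ^ (R + 1)) (r : RunSymbol) :
    List.lookup (q + 1, s, r) (tableOf R H) = some (H[q] s r) := by
  have h := lookup_eq_some
    (fun k : ℕ × ℕ × RunSymbol => (H.getD (k.1 - 1) fun s _ => goto 0 s) k.2.1 k.2.2)
    (tableOf R H) (q + 1, s, r) ?_ ?_
  · rw [h]; simp [hq]
  · intro x hx
    simp only [tableOf, List.mem_flatMap, List.mem_map] at hx
    obtain ⟨q, -, s, -, r, -, rfl⟩ := hx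
    simp
  · refine ⟨((q + 1, s, r), (H.getD q fun s _ => goto 0 s) s r), ?_, rfl⟩
    simp only [tableOf, List.mem_flatMap, List.mem_map]
    refine ⟨q, List.mem_range.2 hq, s, List.mem_range.2 hs, r, ?_, rfl⟩
    cases r with
    | none => simp
    | some x => simp [mem_runSymbols]

/-- The instructions that write `n` into register `0`, in the state `0` and in states after `K`. -/
def setupTable (K n : ℕ) : EPM :=
  (List.range n).map fun p => ((if p = 0 then 0 else K + p, 0, none),
    -- The symbol `99 = 96 + 1 + 2` marks the home cell and the track of register `0`, and `98 = 96
    -- + 2` this track alone.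
    ⟨if p + 1 = n then 1 else K + (p + 1), if p = 0 then 99 else 98, .right, .stay, .idle⟩)

theorem lookup_setupTable {K n p : ℕ} (hp : p < n) (l : EPM) :
    List.lookup (if p = 0 then 0 else K + p, 0, none) (setupTable K n ++ l) =
      some ⟨if p + 1 = n then 1 else K + (p + 1), if p = 0 then 99 else 98, .right, .stay,
        .idle⟩ := by
  have h := lookup_eq_some (fun k : ℕ × ℕ × RunSymbol =>
    (⟨if k.1 - K + 1 = n then 1 else K + (k.1 - K + 1), if k.1 - K = 0 then 99 else 98, .right, .stay,
      .idle⟩ : Instr)) (setupTable K n) (if p = 0 then 0 else K + p, 0, none) ?_ ?_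
  · rw [List.lookup_append, h]
    have e : (if p = 0 then 0 else K + p) - K = p := by split_ifs <;> omega
    simp [e]
  · intro x hx
    simp only [setupTable, List.mem_map] at hx
    obtain ⟨p, -, rfl⟩ := hx
    have e : (if p = 0 then 0 else K + p) - K = p := by split_ifs <;> omega
    simp [e]
  · exact ⟨_, List.mem_map.2 ⟨p, List.mem_range.2 hp, rfl⟩, rfl⟩

theorem primrec_setupTable (K : ℕ) : Primrec (setupTable K) := by
  refine Primrec.list_map Primrec.list_range (Primrec.pair (Primrec.pair ?_ (Primrec.const _)) ?_)
  · exact Primrec.ite (Primrec.eq.comp Primrec.snd (Primrec.const 0)) (Primrec.const 0)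
      (Primrec.nat_add.comp (Primrec.const K) Primrec.snd)
  · refine (Primrec.of_equiv_iff Instr.equivProd).1 ?_
    have h1 : Primrec fun a : ℕ × ℕ => a.2 + 1 := Primrec.succ.comp Primrec.snd
    refine Primrec.pair (Primrec.ite (Primrec.eq.comp h1 Primrec.fst) (Primrec.const 1)
      (Primrec.nat_add.comp (Primrec.const K) h1)) (Primrec.pair (Primrec.ite (Primrec.eq.comp
        Primrec.snd (Primrec.const 0)) (Primrec.const 99) (Primrec.const 98))
          (Primrec.const (Shift.right, Shift.stay, Action.idle)))

/-- After the setup, the machine is at home and its register `0` contains `n`. -/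
theorem setup_reaches {K n R : ℕ} (hn : 0 < n) (hR : 1 ≤ R) {l : EPM} {B : ℕ → Config}
    (hB : (setupTable K n ++ l).IsBranch B) (hM : EPM.Has (setupTable K n ++ l) R 1 (homeLeft 1)) :
    ∃ t s, MState.Ready n s ∧ s.pos = [] ∧ s.Rep R 2 (B t) := by
  have hnext : ∀ p < n, (B p).At (if p = 0 then 0 else K + p)
      (fun i => if 0 ≤ i ∧ i < p then (if i = 0 then 99 else 98) else 0) p 0 [] →
      (B (p + 1)).At (if p + 1 = n then 1 else K + (p + 1))
      (fun i => if 0 ≤ i ∧ i < (p + 1 : ℕ) then (if i = 0 then 99 else 98) else 0)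
        (p + 1 : ℕ) 0 [] := by
    intro p hp hc
    obtain ⟨h1, h2, h3, h4⟩ := hc
    have hhead : (B p).work.head = 0 := by
      rw [← Turing.Tape.nth_zero, h2]
      exact if_neg (by omega)
    have hi : EPM.instr (setupTable K n ++ l) (B p) = some ⟨if p + 1 = n then 1 else K + (p + 1),
        if p = 0 then 99 else 98, .right, .stay, .idle⟩ := by
      rw [EPM.instr, h1, hhead, Config.scan, h4]
      exact lookup_setupTable hp l
    have hs := hB.2 p
    rw [EPM.Succ, hi] at hs
    obtain ⟨g1, g2, g3, g4⟩ := hs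
    refine ⟨g1, fun j => ?_, by rw [g3, h3]; rfl, by rw [g4, h4]⟩
    rw [g2, shiftWork_nth, Turing.Tape.write_nth, h2]
    change (if j + 1 = 0 then (if p = 0 then 99 else 98) else (if 0 ≤ (p : ℤ) + (j + 1) ∧
      (p : ℤ) + (j + 1) < p then (if (p : ℤ) + (j + 1) = 0 then 99 else 98) else 0)) = _
    push_cast
    by_cases e : j + 1 = 0
    · obtain rfl : j = -1 := by omega
      simp
    · rw [if_neg e]
      congr 1
      · simp only [eq_iff_iff]; omega
      · congr 1
        simp only [eq_iff_iff]; omega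
  have hall : ∀ p ≤ n, (B p).At (if p = 0 then 0 else if p = n then 1 else K + p)
      (fun i => if 0 ≤ i ∧ i < p then (if i = 0 then 99 else 98) else 0) p 0 [] := by
    intro p
    induction p with
    | zero =>
      intro _
      rw [hB.1]
      refine ⟨rfl, fun i => ?_, rfl, rfl⟩
      dsimp only
      rw [if_neg (by push_cast; omega)]
      simp only [Config.init]
      rcases i with (_ | i) | i <;> rfl
    | succ p ih =>
      intro hp
      have := ih (by omega)
      rw [show (if p = 0 then 0 else if p = n then 1 else K + p) = if p = 0 then 0 else K + p by
        split_ifs <;> first | rfl | omega] at this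
      have := hnext p (by omega) this
      rwa [show (if p + 1 = 0 then 0 else if p + 1 = n then 1 else K + (p + 1)) =
        if p + 1 = n then 1 else K + (p + 1) by split_ifs <;> first | rfl | omega]
  have hfin := hall n le_rfl
  rw [if_neg (by omega), if_pos rfl] at hfin
  set s : MState := ⟨fun j => if j = 0 then n else 0, [], 0, [], 0⟩ with hs
  -- The symbols `98` and `99` must be among the `96 + 2 ^ (R + 1)` admitted ones.
  have hpow : 4 ≤ 2 ^ (R + 1) := by
    calc 4 = 2 ^ 2 := by norm_num
      _ ≤ 2 ^ (R + 1) := Nat.pow_le_pow_right (by norm_num) (by omega)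
  have hT : s.Tape R (fun i => if 0 ≤ i ∧ i < n then (if i = 0 then 99 else 98) else 0) := by
    refine ⟨fun p => ?_, fun p => ?_, fun p j => ?_, fun i => ?_, by simp [hs]⟩
    · split_ifs <;> omega
    · by_cases e : p = 0
      · subst e; simp [hn, bitAt]
      · by_cases e' : p < n
        · simp [e, e', bitAt]
        · simp [e, e', bitAt]
    · by_cases e : p = 0
      · subst e
        by_cases ej : j = 0
        · subst ej; simp [hn, bitAt, hs, Nat.testBit_succ]
        · obtain ⟨j, rfl⟩ : ∃ k, j = k + 1 := ⟨j - 1, by omega⟩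
          simp [hn, bitAt, hs, Nat.testBit_succ]
      · by_cases e' : p < n
        · by_cases ej : j = 0
          · subst ej; simp [e, e', bitAt, hs, Nat.testBit_succ]
          · obtain ⟨j, rfl⟩ : ∃ k, j = k + 1 := ⟨j - 1, by omega⟩
            simp [e, e', bitAt, hs, Nat.testBit_succ]
        · by_cases ej : j = 0
          · subst ej; simp [e', bitAt, hs]
          · simp [e', bitAt, hs, ej]
    · rw [if_neg (by omega)]; simp [hs]
  obtain ⟨t, -, ht⟩ := MState.Rep.home_left (s := s) hB.2 n hfin hT hM
  exact ⟨t, s, ⟨by simp [hs], ⟨by simp [hs], by simp [hs, spell]⟩, fun j hj => by simp [hs]; omega,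
    rfl⟩, rfl, ht⟩

/-- For every primitive recursive strategy, given as a function of a parameter and the position,
there is a computable family of machines that follow it. -/
theorem exists_machine {S : ℕ → List LabMove → Option Move} (hS : Primrec₂ S) :
    ∃ M : ℕ → EPM, Primrec M ∧ ∀ (n : ℕ) (B : ℕ → Config), (M n).IsBranch B →
      ∃ p : ℕ → List LabMove, p 0 = [] ∧ (∀ i, FollowsBy (S n (p i)) (p i) (p (i + 1))) ∧
        spelledRun B = limitRun p ∧ ((∀ N, ∃ i ≥ N, S n (p i) = none) → (M n).Fair B) := by
  obtain ⟨P, R₀, hP⟩ := exists_prog_round hS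
  set R := R₀ + 1 with hR
  -- State `1` brings the head home after the setup, state `2` starts a round, and the last state
  -- leads back to `2`.
  set H : List Handler := homeLeft 1 :: (P.code 2 ++ [jump 2]) with hH
  set K := H.length with hK
  -- Only the setup depends on the parameter. It writes `n + 1` and not `n`, so that at least one
  -- cell is written and the home cell gets marked.
  refine ⟨fun n => setupTable K (n + 1) ++ tableOf R H,
    Primrec.list_append.comp ((primrec_setupTable K).comp Primrec.succ) (Primrec.const _),
    fun n B hB => ?_⟩
  set M : EPM := setupTable K (n + 1) ++ tableOf R H with hM
  have hcode : M.CodeAt R 1 H := by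
    intro i h hi s hs r
    obtain ⟨hi', rfl⟩ := List.getElem?_eq_some_iff.1 hi
    rw [hM, lookup_append_right, add_comm 1 i, lookup_tableOf hi' hs]
    intro x hx
    simp only [setupTable, List.mem_map] at hx
    obtain ⟨p, -, rfl⟩ := hx
    intro e
    have := congrArg Prod.fst e
    simp only at this
    split_ifs at this <;> omega
  obtain ⟨t₀, s₀, hs₀, hpos₀, hrep₀⟩ := setup_reaches (Nat.succ_pos n) (by omega) hB hcode.head
  have hcP : M.CodeAt R 2 (P.code 2) := hcode.tail.left
  have hjump : M.Has R (2 + P.size) (jump 2) := by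
    have := hcode.tail.right.head
    rwa [Prog.length_code] at this
  -- The branch is cut at the times when state `2` is entered with a ready register state; choosing
  -- successors yields the sequence of rounds.
  have hround : ∀ x : {x : ℕ × MState // x.2.Ready (n + 1) ∧ x.2.Rep R 2 (B x.1)},
      ∃ y : {x : ℕ × MState // x.2.Ready (n + 1) ∧ x.2.Rep R 2 (B x.1)},
        x.1.1 < y.1.1 ∧ FollowsBy (S n x.1.2.pos) x.1.2.pos y.1.2.pos ∧
        (S n x.1.2.pos = none → ∃ m ≥ x.1.1, ∃ i, M.instr (B m) = some i ∧ i.action = .permit) := by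
    rintro ⟨⟨t, s⟩, h1, h2⟩
    obtain ⟨t', s', g1, g2, ⟨g3, g4, g5⟩, g6⟩ := hP R (by omega) (n + 1) s h1 M 2 B t hcP hB.2 h2
    have g7 := g2.goto (hB.2 t') hjump (q' := 2) fun ct hct => rfl
    refine ⟨⟨(t' + 1, s'), g3, g7⟩, by dsimp only; omega, g4, fun h0 => ?_⟩
    obtain ⟨m, hm, hm'⟩ := g6 (g5 h0).symm
    exact ⟨m, hm, hm'⟩
  choose nxt hnxt using hround
  let x : ℕ → {x : ℕ × MState // x.2.Ready (n + 1) ∧ x.2.Rep R 2 (B x.1)} := fun i =>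
    Nat.rec ⟨(t₀, s₀), hs₀, hrep₀⟩ (fun _ y => nxt y) i
  have hx : ∀ i, x (i + 1) = nxt (x i) := fun i => rfl
  have hbpos : ∀ i, (B (x i).1.1).position = (x i).1.2.pos := fun i => by
    obtain ⟨ct, hc, -⟩ := (x i).2.2
    exact hc.2.2.2
  have htime : ∀ i, i ≤ (x i).1.1 := by
    intro i
    induction i with
    | zero => exact Nat.zero_le _
    | succ i ih =>
      have := (hnxt (x i)).1
      rw [hx]; omega
  have hBmono := prefix_of_succ (p := fun n => (B n).position) fun n => (hB.2 n).isPrefix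
  have hfollow : ∀ i, FollowsBy (S n (x i).1.2.pos) (x i).1.2.pos (x (i + 1)).1.2.pos := fun i =>
    (hnxt (x i)).2.1
  have hxmono := prefix_of_succ (p := fun i => (x i).1.2.pos) fun i => by
    simp only [← hbpos]
    refine hBmono _ _ ?_
    rw [hx]; exact (hnxt (x i)).1.le
  refine ⟨fun i => (x i).1.2.pos, hpos₀, hfollow, ?_, fun hinf N => ?_⟩
  -- Round number `t` starts at time `t` or later, so the positions between rounds are cofinal among
  -- all positions of the branch.
  · refine limitRun_eq_of_cofinal hBmono hxmono (fun t => ⟨t, ?_⟩) fun i => ⟨(x i).1.1, ?_⟩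
    · rw [← hbpos]; exact hBmono _ _ (htime t)
    · rw [hbpos]
  · obtain ⟨i, hi, hi'⟩ := hinf N
    obtain ⟨m, hm, hm'⟩ := (hnxt (x i)).2.2 hi'
    exact ⟨m, by have := htime i; omega, hm'⟩

/-! ### Subruns -/

theorem limitRun_take_prefix {p : ℕ → List LabMove} (hp : ∀ n k, n ≤ k → p n <+: p k) (n : ℕ) :
    ∃ k, (limitRun p).take n <+: p k := by
  set l := (limitRun p).take n with hl
  rcases Nat.eq_zero_or_pos l.length with h0 | hlen
  · exact ⟨0, by rw [List.length_eq_zero_iff.1 h0]; exact List.nil_prefix⟩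
  have hle : l.length ≤ n := by rw [hl]; exact Stream'.Seq.length_take_le
  have hget : l[l.length - 1]? = (limitRun p).get? (l.length - 1) := by
    have h1 : l.length - 1 < n := by omega
    conv_lhs => rw [hl, Stream'.Seq.getElem?_take]
    rw [if_pos h1]
  have hex : ∃ m, l.length - 1 < (p m).length := by
    by_contra hne
    rw [limitRun_get?_none hne, List.getElem?_eq_none_iff] at hget
    omega
  obtain ⟨m, hm⟩ := hex
  refine ⟨m, ?_⟩
  have h2 : l = (p m).take l.length := by
    rw [← limitRun_take hp (by omega), ← take_take_run (limitRun p) hle, ← hl, List.take_length]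
  rw [h2]
  exact List.take_prefix _ _

theorem limitRun_take_length {p : ℕ → List LabMove} (hp : ∀ n k, n ≤ k → p n <+: p k) (n : ℕ) :
    (limitRun p).take (p n).length = p n := by
  rw [limitRun_take hp le_rfl, List.take_length]

/-- The initial segments of the limit and the given positions are cofinal in each other, and
filtering preserves this. -/
theorem filterMap_limitRun (g : LabMove → Option LabMove) {p : ℕ → List LabMove}
    (hp : ∀ n k, n ≤ k → p n <+: p k) :
    Run.filterMap g (limitRun p) = limitRun fun n => (p n).filterMap g := by
  refine limitRun_eq_of_cofinal (filterMap_prefix g _) (fun n k h => (hp n k h).filterMap g)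
    (fun n => ?_) fun n => ⟨(p n).length, ?_⟩
  · obtain ⟨k, hk⟩ := limitRun_take_prefix hp n
    exact ⟨k, hk.filterMap g⟩
  · rw [limitRun_take_length hp]

theorem filterMap_filterMap (g g' : LabMove → Option LabMove) (Γ : Run) :
    Run.filterMap g' (Run.filterMap g Γ) = Run.filterMap (fun m => (g m).bind g') Γ := by
  rw [Run.filterMap, Run.filterMap, ← Run.filterMap, filterMap_limitRun _ (filterMap_prefix g Γ)]
  simp only [List.filterMap_filterMap, Run.filterMap]

theorem limitRun_const (l : List LabMove) : limitRun (fun _ => l) = pos l := by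
  ext1 i
  rw [Stream'.Seq.ofList_get?]
  by_cases h : i < l.length
  · rw [limitRun_get? (fun _ _ _ => List.prefix_rfl) (n := 0) h]
  · rw [limitRun_get?_none (by simpa using h), List.getElem?_eq_none (by omega)]

theorem filterMap_pos (g : LabMove → Option LabMove) (l : List LabMove) :
    Run.filterMap g (pos l) = pos (l.filterMap g) := by
  rw [← limitRun_const, filterMap_limitRun _ fun _ _ _ => List.prefix_rfl, limitRun_const]

theorem limitRun_take_self (Γ : Run) : limitRun (fun n => Γ.take n) = Γ := by
  ext1 i
  have hmono : ∀ n k, n ≤ k → Γ.take n <+: Γ.take k := fun n k h => take_prefix_run Γ h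
  have hget : (Γ.take (i + 1))[i]? = Γ.get? i := by
    rw [Stream'.Seq.getElem?_take, if_pos (Nat.lt_succ_self i)]
  by_cases h : i < (Γ.take (i + 1)).length
  · rw [limitRun_get? hmono h, hget]
  · rw [List.getElem?_eq_none (by omega)] at hget
    rw [← hget, limitRun_get?_none]
    rintro ⟨n, hn⟩
    have h1 : (Γ.take n)[i]? = Γ.get? i := by
      rw [Stream'.Seq.getElem?_take, if_pos]
      exact lt_of_lt_of_le hn Stream'.Seq.length_take_le
    rw [← hget, List.getElem?_eq_none_iff] at h1
    omega

theorem neg_limitRun {p : ℕ → List LabMove} (hp : ∀ n k, n ≤ k → p n <+: p k) :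
    (limitRun p).neg = limitRun fun n => (p n).map fun m => (m.1.neg, m.2) := by
  have hp' : ∀ n k, n ≤ k → (p n).map (fun m => (m.1.neg, m.2)) <+:
      (p k).map (fun m => (m.1.neg, m.2)) := fun n k h => (hp n k h).map _
  ext1 i
  rw [Run.neg, Stream'.Seq.map_get?]
  by_cases h : ∃ n, i < (p n).length
  · obtain ⟨n, hn⟩ := h
    rw [limitRun_get? hp hn, limitRun_get? hp' (n := n) (by simpa using hn), List.getElem?_map]
  · rw [limitRun_get?_none h, limitRun_get?_none (by simpa using h)]; rfl

/-- Apply `g` to the moves, keeping the labels, and delete the moves on which `g` is undefined. -/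
def liftMove (g : Move → Option Move) (m : LabMove) : Option LabMove :=
  (g m.2).map fun β => (m.1, β)

/-- The subrun that is extracted by `g`. -/
noncomputable def Run.via (g : Move → Option Move) (Γ : Run) : Run := Run.filterMap (liftMove g) Γ

theorem liftMove_bind (g g' : Move → Option Move) (m : LabMove) :
    (liftMove g m).bind (liftMove g') = liftMove (fun β => (g β).bind g') m := by
  obtain ⟨p, α⟩ := m
  simp only [liftMove]
  cases g α <;> rfl

/-- Sides, halves and threads are all partial maps on moves. Nested subruns thus become compositions
of such maps, and a whole address acts as a single one. -/
theorem Run.via_via (g g' : Move → Option Move) (Γ : Run) :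
    (Γ.via g).via g' = Γ.via fun m => (g m).bind g' := by
  rw [Run.via, Run.via, filterMap_filterMap, Run.via]
  congr 1
  funext m
  exact liftMove_bind g g' m

theorem Run.via_some (Γ : Run) : Γ.via some = Γ := by
  rw [Run.via, Run.filterMap]
  conv_rhs => rw [← limitRun_take_self Γ]
  congr 1
  funext n
  exact List.filterMap_some

/-- The move without the prefix `α`. -/
def stripMove (α m : Move) : Option Move := if α <+: m then some (m.drop α.length) else none

theorem Run.strip_eq_via (α : Move) (Γ : Run) : Γ.strip α = Γ.via (stripMove α) := by
  rw [Run.strip, Run.via]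
  congr 1
  funext m
  simp only [liftMove, stripMove]
  split_ifs <;> rfl

theorem Run.neg_via (g : Move → Option Move) (Γ : Run) : Γ.neg.via g = (Γ.via g).neg := by
  conv_lhs => rw [← limitRun_take_self Γ]
  have h1 : ∀ n k, n ≤ k → Γ.take n <+: Γ.take k := fun n k h => take_prefix_run Γ h
  rw [neg_limitRun h1, Run.via, filterMap_limitRun _ fun n k h => (h1 n k h).map _, Run.via,
    Run.filterMap, neg_limitRun (filterMap_prefix _ Γ)]
  congr 1
  funext n
  rw [List.filterMap_map, List.map_filterMap]
  congr 1
  funext m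
  simp only [liftMove, Function.comp]
  cases g m.2 <;> rfl

theorem Run.neg_neg (Γ : Run) : Γ.neg.neg = Γ := by
  ext1 i
  simp only [Run.neg, Stream'.Seq.map_get?, Option.map_map]
  cases Γ.get? i with
  | none => rfl
  | some m => obtain ⟨p, α⟩ := m; cases p <;> rfl

theorem Run.neg_get? (Γ : Run) (n : ℕ) : Γ.neg.get? n = (Γ.get? n).map fun m => (m.1.neg, m.2) :=
  Stream'.Seq.map_get? _ _ _

theorem Run.exists_of_via {g : Move → Option Move} {Γ : Run} {n : ℕ} {m : LabMove}
    (h : (Γ.via g).get? n = some m) :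
    ∃ k m', Γ.get? k = some m' ∧ g m'.2 = some m.2 := by
  have hmono := filterMap_prefix (liftMove g) Γ
  by_cases hex : ∃ k, n < ((Γ.take k).filterMap (liftMove g)).length
  · obtain ⟨k, hk⟩ := hex
    rw [Run.via, Run.filterMap, limitRun_get? hmono hk] at h
    obtain ⟨m', h1, h2⟩ := List.mem_filterMap.1 (List.mem_of_getElem? h)
    obtain ⟨j, hj⟩ := List.mem_iff_getElem?.1 h1
    rw [Stream'.Seq.getElem?_take] at hj
    split_ifs at hj
    refine ⟨j, m', hj, ?_⟩
    rw [liftMove, Option.map_eq_some_iff] at h2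
    obtain ⟨β, h3, rfl⟩ := h2
    exact h3
  · rw [Run.via, Run.filterMap, limitRun_get?_none hex] at h
    exact absurd h (by simp)

theorem via_pos (g : Move → Option Move) (l : List LabMove) :
    (pos l).via g = pos (l.filterMap (liftMove g)) := filterMap_pos _ _

/-! ### Legality and victory in compound games -/

/-- The components of a parallel combination. -/
def pick (A₁ A₂ : Game) (b : Bool) : Game := if b then A₂ else A₁

theorem mem_conj_Lr {A₁ A₂ : Game} {Γ : Run} : Γ ∈ (A₁.conj A₂).Lr ↔
    (∀ n m, Γ.get? n = some m → ∃ b α, m.2 = [Key.side b, Key.dot] ++ α) ∧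
      ∀ b, Γ.via (stripMove [Key.side b, Key.dot]) ∈ (pick A₁ A₂ b).Lr := by
  simp only [← Run.strip_eq_via]
  exact Iff.rfl

theorem mem_disj_Lr {A₁ A₂ : Game} {Γ : Run} : Γ ∈ (A₁.disj A₂).Lr ↔
    (∀ n m, Γ.get? n = some m → ∃ b α, m.2 = [Key.side b, Key.dot] ++ α) ∧
      ∀ b, Γ.via (stripMove [Key.side b, Key.dot]) ∈ (pick A₁ A₂ b).Lr := mem_conj_Lr

theorem mem_recur_Lr {A : Game} {Γ : Run} : Γ ∈ A.recur.Lr ↔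
    (∀ n m, Γ.get? n = some m → ∃ (w : List Bool) (α : Move),
      m.2 = w.map Key.bit ++ [Key.dot] ++ α) ∧ ∀ x : ℕ → Bool, Γ.via (threadMove x) ∈ A.Lr :=
  Iff.rfl

theorem mem_corecur_Lr {A : Game} {Γ : Run} : Γ ∈ A.corecur.Lr ↔
    (∀ n m, Γ.get? n = some m → ∃ (w : List Bool) (α : Move),
      m.2 = w.map Key.bit ++ [Key.dot] ++ α) ∧ ∀ x : ℕ → Bool, Γ.via (threadMove x) ∈ A.Lr :=
  Iff.rfl

theorem wn_ofWins {Lr : Set Run} {hL : IsLegalSet Lr} {W : Run → Prop} {Γ : Run} (h : Γ ∈ Lr) :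
    (Game.ofWins Lr hL W).Wn Γ = .top ↔ W Γ := by
  simp only [Game.ofWins, if_pos h]
  split_ifs with hW <;> simp [hW]

theorem wn_conj {A₁ A₂ : Game} {Γ : Run} (h : Γ ∈ (A₁.conj A₂).Lr) : (A₁.conj A₂).Wn Γ = .top ↔
    ∀ b, (pick A₁ A₂ b).Wn (Γ.via (stripMove [Key.side b, Key.dot])) = .top := by
  simp only [← Run.strip_eq_via]
  exact wn_ofWins h

theorem wn_disj {A₁ A₂ : Game} {Γ : Run} (h : Γ ∈ (A₁.disj A₂).Lr) : (A₁.disj A₂).Wn Γ = .top ↔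
    ∃ b, (pick A₁ A₂ b).Wn (Γ.via (stripMove [Key.side b, Key.dot])) = .top := by
  simp only [← Run.strip_eq_via]
  exact wn_ofWins h

theorem wn_recur {A : Game} {Γ : Run} (h : Γ ∈ A.recur.Lr) : A.recur.Wn Γ = .top ↔
    ∀ x, EssFinite x → A.Wn (Γ.via (threadMove x)) = .top := wn_ofWins h

theorem wn_corecur {A : Game} {Γ : Run} (h : Γ ∈ A.corecur.Lr) : A.corecur.Wn Γ = .top ↔
    ∃ x, EssFinite x ∧ A.Wn (Γ.via (threadMove x)) = .top := wn_ofWins h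

theorem Player.ne_top_iff {p : Player} : p ≠ .top ↔ p = .bot := by cases p <;> simp

/-- `B` is the negation of `A`, as far as legal runs are concerned. -/
def Game.Dual (A B : Game) : Prop :=
  ∀ Γ : Run, (Γ ∈ B.Lr ↔ Γ.neg ∈ A.Lr) ∧ (Γ ∈ B.Lr → (B.Wn Γ = .top ↔ A.Wn Γ.neg ≠ .top))

theorem dual_neg (A : Game) : A.Dual A.neg := fun Γ =>
  ⟨Iff.rfl, fun h => (wn_ofWins h).trans (by rw [Player.ne_top_iff])⟩

theorem Game.Dual.symm {A B : Game} (h : A.Dual B) : B.Dual A := by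
  intro Γ
  obtain ⟨h1, h2⟩ := h Γ.neg
  rw [Run.neg_neg] at h1 h2
  refine ⟨h1.symm, fun hΓ => ?_⟩
  rw [ne_eq, h2 (h1.2 hΓ), not_not]

theorem neg_get?_forall {Γ : Run} {ok : Move → Prop} :
    (∀ n m, Γ.neg.get? n = some m → ok m.2) ↔ ∀ n m, Γ.get? n = some m → ok m.2 := by
  constructor
  · intro h n m hm
    exact h n (m.1.neg, m.2) (by rw [Run.neg_get?, hm]; rfl)
  · intro h n m hm
    rw [Run.neg_get?, Option.map_eq_some_iff] at hm
    obtain ⟨m', h1, rfl⟩ := hm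
    exact h n m' h1

theorem Game.Dual.pick {A₁ A₂ B₁ B₂ : Game} (h₁ : A₁.Dual B₁) (h₂ : A₂.Dual B₂) (b : Bool) :
    (pick A₁ A₂ b).Dual (pick B₁ B₂ b) := by
  cases b
  exacts [h₁, h₂]

theorem Game.Dual.conj_disj {A₁ A₂ B₁ B₂ : Game} (h₁ : A₁.Dual B₁) (h₂ : A₂.Dual B₂) :
    (A₁.conj A₂).Dual (B₁.disj B₂) := by
  have h := h₁.pick h₂
  intro Γ
  have hL : Γ ∈ (B₁.disj B₂).Lr ↔ Γ.neg ∈ (A₁.conj A₂).Lr := by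
    rw [mem_disj_Lr, mem_conj_Lr]
    refine and_congr (neg_get?_forall (ok := fun m => ∃ b α, m = [Key.side b, Key.dot] ++ α)).symm
      (forall_congr' fun b => ?_)
    rw [(h b _).1, Run.neg_via]
  refine ⟨hL, fun hΓ => ?_⟩
  rw [wn_disj hΓ, ne_eq, wn_conj (hL.1 hΓ), not_forall]
  refine exists_congr fun b => ?_
  rw [Run.neg_via, (h b _).2 ((mem_disj_Lr.1 hΓ).2 b)]

theorem Game.Dual.recur_corecur {A B : Game} (h : A.Dual B) : A.recur.Dual B.corecur := by
  intro Γ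
  have hL : Γ ∈ B.corecur.Lr ↔ Γ.neg ∈ A.recur.Lr := by
    rw [mem_corecur_Lr, mem_recur_Lr]
    refine and_congr (neg_get?_forall (ok := fun m => ∃ (w : List Bool) (α : Move),
      m = w.map Key.bit ++ [Key.dot] ++ α)).symm (forall_congr' fun x => ?_)
    rw [(h _).1, Run.neg_via]
  refine ⟨hL, fun hΓ => ?_⟩
  rw [wn_corecur hΓ, ne_eq, wn_recur (hL.1 hΓ), not_forall]
  refine exists_congr fun x => ?_
  rw [Run.neg_via, Classical.not_imp, (h _).2 ((mem_corecur_Lr.1 hΓ).2 x)]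

/-- The game of the De Morgan dual is not literally the negated game; comparing legality, and the
winner on legal runs, is what the induction carries and what the copycat argument uses. -/
theorem dual_interp (I : Interpretation) (F : Formula) : (F.interp I).Dual (F.neg.interp I) := by
  induction F with
  | atom P => exact dual_neg _
  | natom P => exact (dual_neg _).symm
  | conj F G hF hG => exact hF.conj_disj hG
  | disj F G hF hG => exact (hF.symm.conj_disj hG.symm).symm
  | recur F hF => exact hF.recur_corecur
  | corecur F hF => exact hF.symm.recur_corecur.symm

/-! ### Threads -/

theorem Key.bit_ne_dot (b : Bool) : Key.bit b ≠ Key.dot := by cases b <;> decide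

theorem Key.bit_injective : Function.Injective Key.bit := by
  intro b c h
  cases b <;> cases c <;> first | rfl | exact absurd h (by decide)

theorem Key.side_injective : Function.Injective Key.side := by
  intro b c h
  cases b <;> cases c <;> first | rfl | exact absurd h (by decide)

/-- The initial segment of length `k` of an infinite bitstring, spelled in characters. -/
def word (x : ℕ → Bool) (k : ℕ) : Move := (List.range k).map fun n => Key.bit (x n)

theorem word_succ (x : ℕ → Bool) (k : ℕ) :
    word x (k + 1) = Key.bit (x 0) :: word (fun n => x (n + 1)) k := by
  simp [word, List.range_succ_eq_map, Function.comp_def]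

theorem word_congr {x y : ℕ → Bool} {k : ℕ} (h : ∀ n < k, x n = y n) : word x k = word y k := by
  refine List.map_congr_left fun n hn => ?_
  rw [h n (List.mem_range.1 hn)]

theorem threadMove_word (x y : ℕ → Bool) (k : ℕ) (β : Move) :
    threadMove x (word y k ++ Key.dot :: β) =
      if ∀ n < k, x n = y n then some β else none := by
  induction k generalizing x y with
  | zero => simp [word, threadMove]
  | succ k ih =>
    rw [word_succ, List.cons_append, threadMove, if_neg (Key.bit_ne_dot _), ih]
    simp only [Key.bit_injective.eq_iff, Nat.forall_lt_succ_left]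
    by_cases h : x 0 = y 0
    · simp [h]
    · simp [h, Ne.symm h]

theorem threadMove_eq_some {x : ℕ → Bool} {m β : Move} :
    threadMove x m = some β ↔ ∃ k, m = word x k ++ Key.dot :: β := by
  constructor
  · intro h
    induction m generalizing x with
    | nil => simp [threadMove] at h
    | cons c m ih =>
      rw [threadMove] at h
      split_ifs at h with h1 h2
      · cases h
        exact ⟨0, by simp [word, h1]⟩
      · obtain ⟨k, hk⟩ := ih h
        exact ⟨k + 1, by rw [word_succ, hk, h2]; rfl⟩
  · rintro ⟨k, rfl⟩
    rw [threadMove_word, if_pos fun _ _ => rfl]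

/-- A move cannot spell more bits than it has characters. This is the source of all finiteness in
the copycat strategy. -/
theorem threadMove_congr {x y : ℕ → Bool} {m : Move} (h : ∀ n < m.length, x n = y n) :
    threadMove x m = threadMove y m := by
  induction m generalizing x y with
  | nil => rfl
  | cons c m ih =>
    rw [threadMove, threadMove, h 0 (by simp), ih fun n hn => h (n + 1) (by simpa using hn)]

theorem length_threadMove_le {x : ℕ → Bool} {m β : Move} (h : threadMove x m = some β) :
    β.length ≤ m.length := by
  obtain ⟨k, rfl⟩ := threadMove_eq_some.1 h
  simp only [List.length_append, List.length_cons]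
  omega

/-- What stands after the first dot. -/
def afterDot : Move → Move
  | [] => []
  | c :: m => if c = Key.dot then m else afterDot m

theorem afterDot_of_threadMove {x : ℕ → Bool} {m β : Move} (h : threadMove x m = some β) :
    afterDot m = β := by
  induction m generalizing x with
  | nil => simp [threadMove] at h
  | cons c m ih =>
    rw [threadMove] at h
    rw [afterDot]
    split_ifs at h ⊢ with h1 h2
    · simpa using h
    · exact ih h

/-- The move `m` of a corecurrence, as seen in the half of the threads that start with `b`. -/
def halfMove (b : Bool) : Move → Option Move
  | [] => none
  -- A move with the empty bitstring belongs to all threads, hence to both halves, and keeps its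
  -- dot.
  | c :: m => if c = Key.dot then some (c :: m) else if c = Key.bit b then some m else none

/-- The thread `x` of the half `b` is the thread of the whole that starts with `b` and continues as
`x`. So a half is again a run of the same corecurrence, which is what Contraction needs. -/
theorem halfMove_threadMove (b : Bool) (x : ℕ → Bool) (m : Move) :
    (halfMove b m).bind (threadMove x) = threadMove (fun n => n.casesOn b x) m := by
  cases m with
  | nil => rfl
  | cons c m =>
    rw [halfMove, threadMove]
    change _ = if c = Key.dot then some m else if c = Key.bit b then threadMove x m else none
    split_ifs with h1 h2 <;> simp [threadMove, h1]

theorem afterDot_of_halfMove {b : Bool} {m m' : Move} (h : halfMove b m = some m') :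
    afterDot m' = afterDot m := by
  cases m with
  | nil => simp [halfMove] at h
  | cons c m =>
    rw [halfMove] at h
    split_ifs at h with h1 h2
    · cases h; rfl
    · cases h
      rw [afterDot, if_neg h1]

theorem halfMove_eq_some_of_dot {b : Bool} {m m' : Move} (h : halfMove b m = some m')
    (hm : ∃ (w : List Bool) (α : Move), m = w.map Key.bit ++ [Key.dot] ++ α) :
    ∃ (w : List Bool) (α : Move), m' = w.map Key.bit ++ [Key.dot] ++ α := by
  obtain ⟨w, α, rfl⟩ := hm
  cases w with
  | nil =>
    simp only [List.map_nil, List.nil_append, List.cons_append, halfMove, if_true] at h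
    cases h
    exact ⟨[], α, rfl⟩
  | cons c w =>
    simp only [List.map_cons, List.cons_append, halfMove, if_neg (Key.bit_ne_dot _)] at h
    split_ifs at h
    cases h
    exact ⟨w, α, by simp⟩

/-! ### Addresses -/

/-- A step from a formula to a subformula occurrence in one copy: `inl (false, b)` leads to a side
of a parallel combination, `inl (true, b)` to a half of a corecurrence, and `inr L` to the thread
that is the interleaving of the bitstrings named by the variables in `L`. -/
abbrev Step := (Bool × Bool) ⊕ List ℕ

/-- An address is a path of steps. -/
abbrev Addr := List Step

/-- The infinite bitstring whose places are taken in turn by the bitstrings named by `L`. -/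
def interleave (σ : ℕ → ℕ → Bool) (L : List ℕ) (n : ℕ) : Bool :=
  -- The empty list names the thread that consists of zeros only.
  (L[n % L.length]?).elim false fun v => σ v (n / L.length)

theorem interleave_congr {σ τ : ℕ → ℕ → Bool} {L : List ℕ} {k n : ℕ}
    (h : ∀ v ∈ L, ∀ n < k, σ v n = τ v n) (hn : n < k) : interleave σ L n = interleave τ L n := by
  rw [interleave, interleave]
  cases h1 : L[n % L.length]? with
  | none => rfl
  | some v => exact h v (List.mem_of_getElem? h1) _ (lt_of_le_of_lt (Nat.div_le_self _ _) hn)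

/-- Bit `n` of the variable at place `q` of `L` stands at the place `q + L.length * n`. The factor
is `L.length + 1` so that at least `k` bits are spelled even when `L` is empty. -/
theorem eq_of_interleave {σ τ : ℕ → ℕ → Bool} {L : List ℕ} {k : ℕ}
    (h : ∀ n < k * (L.length + 1), interleave σ L n = interleave τ L n) :
    ∀ v ∈ L, ∀ n < k, σ v n = τ v n := by
  intro v hv n hn
  obtain ⟨q, hq⟩ := List.mem_iff_getElem?.1 hv
  have hq' : q < L.length := (List.getElem?_eq_some_iff.1 hq).1
  have h1 := h (q + L.length * n) (by nlinarith)
  simp only [interleave, Nat.add_mul_mod_self_left, Nat.mod_eq_of_lt hq', hq, Option.elim,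
    Nat.add_mul_div_left _ _ (by omega : 0 < L.length), Nat.div_eq_of_lt hq', Nat.zero_add] at h1
  exact h1

theorem interleave_singleton (σ : ℕ → ℕ → Bool) (v : ℕ) : interleave σ [v] = σ v := by
  funext n
  simp [interleave, Nat.mod_one]

/-- Each of the finitely many bitstrings vanishes from some place on; the sum of these places bounds
them all. This makes the thread chosen for a corecurrence an admissible witness. -/
theorem essFinite_interleave {σ : ℕ → ℕ → Bool} (hσ : ∀ v, EssFinite (σ v)) (L : List ℕ) :
    EssFinite (interleave σ L) := by
  have h1 : ∀ v, ∃ B, ∀ n, σ v n = true → n < B := fun v => by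
    obtain ⟨B, hB⟩ := (hσ v).bddAbove
    exact ⟨B + 1, fun n hn => Nat.lt_succ_of_le (hB hn)⟩
  choose B hB using h1
  refine Set.Finite.subset (Set.finite_Iio (((L.map B).sum + 1) * L.length)) fun n hn => ?_
  simp only [Set.mem_ofPred_eq, interleave] at hn
  cases h2 : L[n % L.length]? with
  | none => rw [h2] at hn; exact absurd hn (by simp)
  | some v =>
    rw [h2] at hn
    have hv := List.mem_of_getElem? h2
    have h3 : n / L.length < B v := hB v _ hn
    have h4 : B v ≤ (L.map B).sum := List.single_le_sum (by simp) _ (List.mem_map_of_mem hv)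
    have hpos : 0 < L.length := List.length_pos_of_mem hv
    rw [Set.mem_Iio]
    exact (Nat.div_lt_iff_lt_mul hpos).1 (by omega)

/-- The variables in a step. -/
def stepVars : Step → List ℕ
  | .inl _ => []
  | .inr L => L

/-- The variables in an address. -/
def addrVars (A : Addr) : List ℕ := A.flatMap stepVars

/-- The move as seen after a step. -/
def stepMove (σ : ℕ → ℕ → Bool) : Step → Move → Option Move
  | .inl (false, b) => stripMove [Key.side b, Key.dot]
  | .inl (true, b) => halfMove b
  | .inr L => threadMove (interleave σ L)

/-- The move as seen at an address. -/
def addrMove (σ : ℕ → ℕ → Bool) : Addr → Move → Option Move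
  | [], m => some m
  | s :: A, m => (stepMove σ s m).bind (addrMove σ A)

/-- A move that is seen as `m` after a step; the thread is singled out by at least `k` bits of each
of the bitstrings that it is composed of. -/
def stepBuild (σ : ℕ → ℕ → Bool) (k : ℕ) : Step → Move → Move
  | .inl (false, b), m => [Key.side b, Key.dot] ++ m
  | .inl (true, b), m => Key.bit b :: m
  | .inr L, m => word (interleave σ L) (k * (L.length + 1)) ++ Key.dot :: m

/-- A move that is seen as `α` at an address. -/
def build (σ : ℕ → ℕ → Bool) (k : ℕ) (A : Addr) (α : Move) : Move := A.foldr (stepBuild σ k) α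

/-- Two addresses part at different sides or halves of the same formula occurrence. -/
inductive Apart : Addr → Addr → Prop
  | head (h b : Bool) (A A' : Addr) : Apart (.inl (h, b) :: A) (.inl (h, !b) :: A')
  | cons (s : Step) {A A' : Addr} : Apart A A' → Apart (s :: A) (s :: A')

theorem Apart.append {A A' : Addr} (h : Apart A A') (B B' : Addr) :
    Apart (A ++ B) (A' ++ B') := by
  induction h with
  | head h b A A' => exact Apart.head h b _ _
  | cons s _ ih => exact ih.cons s

theorem Apart.append_left {A A' : Addr} (h : Apart A A') (B : Addr) :
    Apart (B ++ A) (B ++ A') := by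
  induction B with
  | nil => exact h
  | cons s B ih => exact ih.cons s

theorem stripMove_side (b c : Bool) (m : Move) :
    stripMove [Key.side b, Key.dot] ([Key.side c, Key.dot] ++ m) =
      if b = c then some m else none := by
  by_cases h : b = c
  · subst h; simp [stripMove]
  · have : Key.side b ≠ Key.side c := fun h' => h (Key.side_injective h')
    simp [stripMove, h, this]

theorem stripMove_eq_some {α m β : Move} (h : stripMove α m = some β) : m = α ++ β := by
  rw [stripMove] at h
  split_ifs at h with h1
  obtain ⟨t, rfl⟩ := h1
  simp at h
  rw [h]

theorem halfMove_bit (b c : Bool) (m : Move) :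
    halfMove b (Key.bit c :: m) = if b = c then some m else none := by
  rw [halfMove, if_neg (Key.bit_ne_dot c)]
  simp only [Key.bit_injective.eq_iff, eq_comm]

theorem length_stepMove_le {σ : ℕ → ℕ → Bool} {s : Step} {m β : Move}
    (h : stepMove σ s m = some β) : β.length ≤ m.length := by
  rcases s with ⟨_ | _, b⟩ | L
  · rw [stripMove_eq_some h, List.length_append]; omega
  · cases m with
    | nil => simp [stepMove, halfMove] at h
    | cons c m =>
      simp only [stepMove, halfMove] at h
      split_ifs at h <;> cases h <;> simp
  · exact length_threadMove_le h

theorem stepMove_stepBuild_self (σ : ℕ → ℕ → Bool) (k : ℕ) (s : Step) (m : Move) :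
    stepMove σ s (stepBuild σ k s m) = some m := by
  rcases s with ⟨_ | _, b⟩ | L
  · exact (stripMove_side b b m).trans (if_pos rfl)
  · exact (halfMove_bit b b m).trans (if_pos rfl)
  · exact (threadMove_word _ _ _ _).trans (if_pos fun _ _ => rfl)

theorem stepMove_stepBuild {σ τ : ℕ → ℕ → Bool} {k : ℕ} {s : Step} {m m' : Move}
    (h : stepMove σ s (stepBuild τ k s m) = some m') :
    m' = m ∧ stepBuild σ k s = stepBuild τ k s ∧ ∀ v ∈ stepVars s, ∀ n < k, σ v n = τ v n := by
  rcases s with ⟨_ | _, b⟩ | L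
  · rw [stepMove, stepBuild, stripMove_side, if_pos rfl] at h
    cases h
    exact ⟨rfl, rfl, by simp [stepVars]⟩
  · rw [stepMove, stepBuild, halfMove_bit, if_pos rfl] at h
    cases h
    exact ⟨rfl, rfl, by simp [stepVars]⟩
  · rw [stepMove, stepBuild, threadMove_word] at h
    split_ifs at h with h1
    cases h
    refine ⟨rfl, ?_, eq_of_interleave h1⟩
    funext m
    rw [stepBuild, stepBuild, word_congr h1]

theorem addrMove_build_self (σ : ℕ → ℕ → Bool) (k : ℕ) (A : Addr) (α : Move) :
    addrMove σ A (build σ k A α) = some α := by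
  induction A with
  | nil => rfl
  | cons s A ih =>
    rw [build, List.foldr_cons, addrMove, stepMove_stepBuild_self]
    exact ih

/-- A built move spells at least `k` bits of every variable of its address, so it is seen there only
under assignments that agree with the builder's on these bits. -/
theorem addrMove_build {σ τ : ℕ → ℕ → Bool} {k : ℕ} {A : Addr} {α β : Move}
    (h : addrMove σ A (build τ k A α) = some β) :
    β = α ∧ build σ k A = build τ k A ∧ ∀ v ∈ addrVars A, ∀ n < k, σ v n = τ v n := by
  induction A with
  | nil =>
    cases h
    exact ⟨rfl, rfl, by simp [addrVars]⟩
  | cons s A ih =>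
    rw [build, List.foldr_cons, addrMove, Option.bind_eq_some_iff] at h
    obtain ⟨m, h1, h2⟩ := h
    obtain ⟨rfl, h3, h4⟩ := stepMove_stepBuild h1
    obtain ⟨rfl, h5, h6⟩ := ih h2
    refine ⟨rfl, ?_, fun v hv => ?_⟩
    · funext γ
      rw [build, List.foldr_cons, ← build, h5, h3]
      rfl
    · rw [addrVars, List.flatMap_cons, List.mem_append] at hv
      exact hv.elim (h4 v) (h6 v)

/-- Common steps either hide the move or remove the same prefix; where the addresses part, the move
carries the name of the other side or half. -/
theorem addrMove_build_of_apart {A A' : Addr} (h : Apart A A') (σ τ : ℕ → ℕ → Bool) (k : ℕ)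
    (α : Move) : addrMove σ A (build τ k A' α) = none := by
  induction h with
  | head h b A A' =>
    rw [build, List.foldr_cons, addrMove]
    cases h
    · rw [stepMove, stepBuild, stripMove_side, if_neg (by simp)]; rfl
    · rw [stepMove, stepBuild, halfMove_bit, if_neg (by simp)]; rfl
  | cons s h ih =>
    rw [build, List.foldr_cons, addrMove]
    cases h1 : stepMove σ s (stepBuild τ k s (List.foldr (stepBuild τ k) α _)) with
    | none => rfl
    | some m =>
      rw [(stepMove_stepBuild h1).1]
      exact ih

theorem addrMove_congr {σ τ : ℕ → ℕ → Bool} {k : ℕ} {A : Addr} {m : Move} (hm : m.length ≤ k)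
    (h : ∀ v ∈ addrVars A, ∀ n < k, σ v n = τ v n) : addrMove σ A m = addrMove τ A m := by
  induction A generalizing m with
  | nil => rfl
  | cons s A ih =>
    have h1 : stepMove σ s m = stepMove τ s m := by
      rcases s with ⟨_ | _, b⟩ | L
      · rfl
      · rfl
      · refine threadMove_congr fun n hn => ?_
        refine interleave_congr (k := k) (fun v hv => h v ?_) (by omega)
        rw [addrVars, List.flatMap_cons]
        exact List.mem_append_left _ hv
    rw [addrMove, addrMove, h1]
    cases h2 : stepMove τ s m with
    | none => rfl
    | some m' =>
      refine ih ((length_stepMove_le h2).trans hm) fun v hv => h v ?_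
      rw [addrVars, List.flatMap_cons]
      exact List.mem_append_right _ hv

/-- Only finitely many bits of the assignment enter a built move. Hence finitely many assignments
produce all possible copies. -/
theorem build_congr {σ τ : ℕ → ℕ → Bool} {k K : ℕ} {A : Addr}
    (hK : k * ((addrVars A).length + 1) ≤ K)
    (h : ∀ v ∈ addrVars A, ∀ n < K, σ v n = τ v n) : build σ k A = build τ k A := by
  induction A with
  | nil => rfl
  | cons s A ih =>
    rw [addrVars, List.flatMap_cons, ← addrVars] at hK h
    rw [List.length_append] at hK
    have h1 : stepBuild σ k s = stepBuild τ k s := by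
      rcases s with ⟨_ | _, b⟩ | L
      · rfl
      · rfl
      · funext m
        rw [stepBuild, stepBuild]
        congr 1
        refine word_congr fun n hn => interleave_congr (k := K)
          (fun v hv => h v (List.mem_append_left _ hv)) ?_
        simp only [stepVars] at hK
        nlinarith
    funext α
    rw [build, build, List.foldr_cons, List.foldr_cons, h1]
    congr 1
    exact congrFun (ih (by nlinarith) fun v hv => h v (List.mem_append_right _ hv)) α

theorem addrMove_append (σ : ℕ → ℕ → Bool) (A B : Addr) (m : Move) :
    addrMove σ (A ++ B) m = (addrMove σ A m).bind (addrMove σ B) := by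
  induction A generalizing m with
  | nil => rfl
  | cons s A ih =>
    rw [List.cons_append, addrMove, addrMove, Option.bind_assoc]
    congr 1
    funext m'
    exact ih m'

theorem via_addrMove_append (σ : ℕ → ℕ → Bool) (A B : Addr) (Γ : Run) :
    Γ.via (addrMove σ (A ++ B)) = (Γ.via (addrMove σ A)).via (addrMove σ B) := by
  rw [Run.via_via]
  congr 1
  funext m
  exact addrMove_append σ A B m

theorem addrMove_singleton (σ : ℕ → ℕ → Bool) (s : Step) : addrMove σ [s] = stepMove σ s := by
  funext m
  rw [addrMove]
  cases stepMove σ s m <;> rfl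

theorem addrMove_eq_of_vars {σ τ : ℕ → ℕ → Bool} {A : Addr} (h : ∀ v ∈ addrVars A, σ v = τ v) :
    addrMove σ A = addrMove τ A := by
  funext m
  exact addrMove_congr le_rfl fun v hv n _ => by rw [h v hv]

/-! ### The formula at an address -/

/-- The formula to which a step leads. -/
def stepForm : Formula → Step → Option Formula
  | .conj F G, .inl (false, b) => some (if b then G else F)
  | .disj F G, .inl (false, b) => some (if b then G else F)
  | .recur F, .inr _ => some F
  | .corecur F, .inr _ => some F
  -- Halving a corecurrence does not change the formula.
  | .corecur F, .inl (true, _) => some (.corecur F)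
  | _, _ => none

/-- The formula at an address. -/
def target : Formula → Addr → Option Formula
  | F, [] => some F
  | F, s :: A => (stepForm F s).bind fun G => target G A

theorem target_append (F : Formula) (A B : Addr) :
    target F (A ++ B) = (target F A).bind fun G => target G B := by
  induction A generalizing F with
  | nil => rfl
  | cons s A ih =>
    rw [List.cons_append, target, target, Option.bind_assoc]
    congr 1
    funext G
    exact ih G

theorem stepForm_cases {F G : Formula} {s : Step} (h : stepForm F s = some G) :
    (∃ b E H, s = .inl (false, b) ∧ (F = .conj E H ∨ F = .disj E H) ∧ G = if b then H else E) ∨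
    (∃ L, s = .inr L ∧ (F = .recur G ∨ F = .corecur G)) ∨
    ∃ b E, s = .inl (true, b) ∧ F = .corecur E ∧ G = F := by
  rcases s with ⟨_ | _, b⟩ | L <;> cases F <;> simp_all [stepForm, eq_comm]

theorem interp_pick (I : Interpretation) (E H : Formula) (b : Bool) :
    pick (E.interp I) (H.interp I) b = (if b then H else E).interp I := by
  cases b <;> rfl

theorem legal_stepMove {I : Interpretation} {F G : Formula} {s : Step} {Γ : Run}
    (hΓ : Γ ∈ (F.interp I).Lr) (h : stepForm F s = some G) (σ : ℕ → ℕ → Bool) :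
    Γ.via (stepMove σ s) ∈ (G.interp I).Lr := by
  rcases stepForm_cases h with ⟨b, E, H, rfl, hF, rfl⟩ | ⟨L, rfl, hF⟩ | ⟨b, E, rfl, rfl, rfl⟩
  · rw [← interp_pick]
    rcases hF with rfl | rfl
    · exact (mem_conj_Lr.1 hΓ).2 b
    · exact (mem_disj_Lr.1 hΓ).2 b
  · rcases hF with rfl | rfl
    · exact (mem_recur_Lr.1 hΓ).2 _
    · exact (mem_corecur_Lr.1 hΓ).2 _
  · obtain ⟨h1, h2⟩ := mem_corecur_Lr.1 hΓ
    refine mem_corecur_Lr.2 ⟨fun n m hm => ?_, fun x => ?_⟩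
    · obtain ⟨k, m', h3, h4⟩ := Run.exists_of_via hm
      exact halfMove_eq_some_of_dot h4 (h1 k m' h3)
    · rw [Run.via_via]
      simp only [stepMove, halfMove_threadMove]
      exact h2 _

theorem legal_addrMove {I : Interpretation} {F G : Formula} {A : Addr} {Γ : Run}
    (hΓ : Γ ∈ (F.interp I).Lr) (h : target F A = some G) (σ : ℕ → ℕ → Bool) :
    Γ.via (addrMove σ A) ∈ (G.interp I).Lr := by
  induction A generalizing F Γ with
  | nil =>
    cases h
    exact (Run.via_some Γ).symm ▸ hΓ
  | cons s A ih =>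
    rw [target, Option.bind_eq_some_iff] at h
    obtain ⟨E, h1, h2⟩ := h
    have := ih (legal_stepMove hΓ h1 σ) h2
    rwa [Run.via_via] at this

/-- The formula occurrences of `F` to which a move can contribute. -/
def visited : Formula → Move → List Formula
  | .atom P, _ => [.atom P]
  | .natom P, _ => [.natom P]
  | .conj F G, m => .conj F G ::
      if m.head? = some (Key.side true) then visited G (m.drop 2) else visited F (m.drop 2)
  | .disj F G, m => .disj F G ::
      if m.head? = some (Key.side true) then visited G (m.drop 2) else visited F (m.drop 2)
  | .recur F, m => .recur F :: visited F (afterDot m)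
  | .corecur F, m => .corecur F :: visited F (afterDot m)

theorem self_mem_visited (F : Formula) (m : Move) : F ∈ visited F m := by
  cases F <;> simp [visited]

/-- The first character of a move dictates the side, and all threads that show a move show the same
remainder after the dot. A move thus runs down one branch of the formula tree, whatever the
assignment. -/
theorem mem_visited {F G : Formula} {A : Addr} {σ : ℕ → ℕ → Bool} {m α : Move}
    (h : target F A = some G) (hm : addrMove σ A m = some α) : G ∈ visited F m := by
  induction A generalizing F m with
  | nil =>
    cases h
    exact self_mem_visited _ _
  | cons s A ih =>
    rw [target, Option.bind_eq_some_iff] at h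
    rw [addrMove, Option.bind_eq_some_iff] at hm
    obtain ⟨E, h1, h2⟩ := h
    obtain ⟨m', h3, h4⟩ := hm
    have h5 := ih h2 h4
    rcases stepForm_cases h1 with ⟨b, E', H, rfl, hF, rfl⟩ | ⟨L, rfl, hF⟩ | ⟨b, E', rfl, rfl, rfl⟩
    · have h6 := stripMove_eq_some h3
      subst h6
      cases b
      · rcases hF with rfl | rfl <;>
          simpa [visited, Key.side_injective.eq_iff] using Or.inr h5
      · rcases hF with rfl | rfl <;> simpa [visited] using Or.inr h5
    · rw [← afterDot_of_threadMove h3] at h5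
      rcases hF with rfl | rfl <;> exact List.mem_cons_of_mem _ h5
    · rw [visited, afterDot_of_halfMove h3] at h5
      exact h5

theorem sizeOf_le_of_mem_visited {F G : Formula} {m : Move} (h : G ∈ visited F m) :
    sizeOf G ≤ sizeOf F := by
  induction F generalizing m with
  | atom P => rw [List.mem_singleton.1 h]
  | natom P => rw [List.mem_singleton.1 h]
  | conj E H hE hH | disj E H hE hH =>
    rw [visited, List.mem_cons] at h
    rcases h with rfl | h
    · exact le_rfl
    · split_ifs at h
      · have := hH h; simp; omega
      · have := hE h; simp; omega
  | recur E hE | corecur E hE =>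
    rw [visited, List.mem_cons] at h
    rcases h with rfl | h
    · exact le_rfl
    · have := hE h; simp; omega

theorem pairwise_visited (F : Formula) (m : Move) :
    (visited F m).Pairwise fun G H => sizeOf H < sizeOf G := by
  induction F generalizing m with
  | atom P => exact List.pairwise_singleton _ _
  | natom P => exact List.pairwise_singleton _ _
  | conj E H hE hH | disj E H hE hH =>
    rw [visited]
    split_ifs
    · refine List.pairwise_cons.2 ⟨fun G hG => ?_, hH _⟩
      have := sizeOf_le_of_mem_visited hG
      simp; omega
    · refine List.pairwise_cons.2 ⟨fun G hG => ?_, hE _⟩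
      have := sizeOf_le_of_mem_visited hG
      simp; omega
  | recur E hE | corecur E hE =>
    refine List.pairwise_cons.2 ⟨fun G hG => ?_, hE _⟩
    have := sizeOf_le_of_mem_visited hG
    simp; omega

/-- Sizes strictly decrease along the branch. As `G` and `¬G` are different formulas of equal size,
they cannot both be visited by one move. -/
theorem eq_of_mem_visited {F G H : Formula} {m : Move} (hG : G ∈ visited F m)
    (hH : H ∈ visited F m) (h : sizeOf G = sizeOf H) : G = H := by
  by_contra hne
  have h1 : (visited F m).Pairwise fun G H => sizeOf G ≠ sizeOf H :=
    (pairwise_visited F m).imp fun h => h.ne'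
  have : Std.Symm fun G H : Formula => sizeOf G ≠ sizeOf H := ⟨fun _ _ h => h.symm⟩
  exact h1.forall hG hH hne h

theorem sizeOf_neg (F : Formula) : sizeOf F.neg = sizeOf F := by
  induction F <;> simp_all [Formula.neg]

theorem neg_ne (F : Formula) : F.neg ≠ F := by cases F <;> simp [Formula.neg]

/-- No move is seen both at an address of `G` and at an address of `¬G`. -/
theorem addrMove_eq_none_of_neg {F G : Formula} {A B : Addr} {σ τ : ℕ → ℕ → Bool} {m α : Move}
    (hA : target F A = some G) (hB : target F B = some G.neg) (h : addrMove σ A m = some α) :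
    addrMove τ B m = none := by
  by_contra h'
  obtain ⟨β, hβ⟩ := Option.ne_none_iff_exists'.1 h'
  exact neg_ne G (eq_of_mem_visited (mem_visited hB hβ) (mem_visited hA h) (sizeOf_neg G))

/-! ### Legality of the moves made at an address -/

theorem mem_pos_of_forall {ok : Move → Prop} {l : List LabMove} :
    (∀ n m, (pos l).get? n = some m → ok m.2) ↔ ∀ m ∈ l, ok m.2 := by
  simp only [Stream'.Seq.ofList_get?]
  exact ⟨fun h m hm => (List.mem_iff_getElem?.1 hm).elim fun n hn => h n m hn,
    fun h n m hn => h m (List.mem_of_getElem? hn)⟩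

/-- The subrun of a position at an address. -/
def proj (σ : ℕ → ℕ → Bool) (A : Addr) (Φ : List LabMove) : List LabMove :=
  Φ.filterMap (liftMove (addrMove σ A))

theorem mem_filterMap_liftMove {g : Move → Option Move} {Φ : List LabMove} {m : LabMove} :
    m ∈ Φ.filterMap (liftMove g) ↔ ∃ α, (m.1, α) ∈ Φ ∧ g α = some m.2 := by
  rw [List.mem_filterMap]
  constructor
  · rintro ⟨m', h1, h2⟩
    rw [liftMove, Option.map_eq_some_iff] at h2
    obtain ⟨β, h3, rfl⟩ := h2
    exact ⟨m'.2, h1, h3⟩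
  · rintro ⟨α, h1, h2⟩
    exact ⟨_, h1, by simp [liftMove, h2]⟩

/-- The moves that do not interfere with the moves built at the address `A`. -/
def Tame (k : ℕ) (A : Addr) (m : Move) : Prop :=
  m.length ≤ k ∨ ∃ τ A' α, (A' = A ∨ Apart A' A) ∧ m = build τ k A' α

theorem Tame.stepMove {k : ℕ} {s : Step} {A : Addr} {m m' : Move} (h : Tame k (s :: A) m)
    {σ : ℕ → ℕ → Bool} (hm : CoL.stepMove σ s m = some m') : Tame k A m' := by
  rcases h with h | ⟨τ, A', α, h1, rfl⟩
  · exact Or.inl ((length_stepMove_le hm).trans h)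
  · have key : ∀ B, (B = A ∨ Apart B A) → A' = s :: B → Tame k A m' := by
      rintro B hB rfl
      exact Or.inr ⟨τ, B, α, hB, (stepMove_stepBuild hm).1⟩
    rcases h1 with rfl | h1
    · exact key A (Or.inl rfl) rfl
    · cases h1 with
      | head h b B _ =>
        have := addrMove_build_of_apart (Apart.head h (!b) [] B) σ τ k α
        rw [Bool.not_not, addrMove_singleton, hm] at this
        exact absurd this (by simp)
      | cons _ h2 => exact key _ (Or.inr h2) rfl

/-- This is the purpose of `Tame`: a move that is short, or was built at the same or an apart
address, does not distinguish threads that agree on as many bits as a move built here spells. -/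
theorem Tame.threadMove_eq {k : ℕ} {L : List ℕ} {A : Addr} {m : Move}
    (h : Tame k (.inr L :: A) m) {x y : ℕ → Bool} (hxy : ∀ n < k * (L.length + 1), x n = y n) :
    threadMove x m = threadMove y m := by
  rcases h with h | ⟨τ, A', α, h1, rfl⟩
  · exact threadMove_congr fun n hn => hxy n (by nlinarith)
  · obtain ⟨B, rfl⟩ : ∃ B, A' = .inr L :: B := by
      rcases h1 with rfl | h1
      · exact ⟨_, rfl⟩
      · cases h1 with
        | cons _ h2 => exact ⟨_, rfl⟩
    rw [build, List.foldr_cons, stepBuild, threadMove_word, threadMove_word]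
    refine if_congr (forall₂_congr fun n hn => ?_) rfl rfl
    rw [hxy n hn]

theorem word_eq_map (x : ℕ → Bool) (k : ℕ) : word x k = ((List.range k).map x).map Key.bit := by
  simp [word]

theorem filterMap_append_singleton {g : Move → Option Move} {Φ : List LabMove} {p : Player}
    {m : Move} : (Φ ++ [(p, m)]).filterMap (liftMove g) = Φ.filterMap (liftMove g) ++
      ((g m).map fun β => (p, β)).toList := by
  rw [List.filterMap_append]
  cases h : g m <;> simp [liftMove, h]

/-- Descend along the address. Sides and threads that do not show the new move are as before. Every
thread that shows it has, by tameness, the same past as the thread of the address, so legality in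
that one thread suffices for all of them. -/
theorem legal_build {I : Interpretation} {F G : Formula} {A : Addr} {σ : ℕ → ℕ → Bool} {k : ℕ}
    {p : Player} {α : Move} {Φ : List LabMove} (hΦ : pos Φ ∈ (F.interp I).Lr)
    (hA : target F A = some G) (hα : pos (proj σ A Φ ++ [(p, α)]) ∈ (G.interp I).Lr)
    (hT : ∀ m ∈ Φ, Tame k A m.2) : pos (Φ ++ [(p, build σ k A α)]) ∈ (F.interp I).Lr := by
  induction A generalizing F Φ with
  | nil =>
    cases hA
    rwa [proj, show liftMove (addrMove σ []) = some from rfl, List.filterMap_some] at hα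
  | cons s A ih =>
    rw [target, Option.bind_eq_some_iff] at hA
    obtain ⟨E, h1, h2⟩ := hA
    have hlegal : pos (Φ.filterMap (liftMove (stepMove σ s))) ∈ (E.interp I).Lr := by
      rw [← via_pos]
      exact legal_stepMove hΦ h1 σ
    have hproj : proj σ A (Φ.filterMap (liftMove (stepMove σ s))) = proj σ (s :: A) Φ := by
      rw [proj, proj, List.filterMap_filterMap]
      congr 1
      funext m
      exact liftMove_bind _ _ m
    have h3 := ih hlegal h2 (by rwa [hproj]) fun m hm => by
      obtain ⟨β, h4, h5⟩ := mem_filterMap_liftMove.1 hm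
      exact (hT _ h4).stepMove h5
    set μ := build σ k A α with hμ
    have hb : build σ k (s :: A) α = stepBuild σ k s μ := rfl
    rw [hb]
    rcases stepForm_cases h1 with ⟨b, E', H, rfl, hF, rfl⟩ | ⟨L, rfl, hF⟩ | ⟨b, E', rfl, rfl, rfl⟩
    · have key : (∀ n m, (pos (Φ ++ [(p, stepBuild σ k (.inl (false, b)) μ)])).get? n = some m →
          ∃ b α, m.2 = [Key.side b, Key.dot] ++ α) ∧
          ∀ c, (pos (Φ ++ [(p, stepBuild σ k (.inl (false, b)) μ)])).via
            (stripMove [Key.side c, Key.dot]) ∈ (pick (E'.interp I) (H.interp I) c).Lr := by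
        have hΦ' : (∀ n m, (pos Φ).get? n = some m → ∃ b α, m.2 = [Key.side b, Key.dot] ++ α) ∧
            ∀ c, (pos Φ).via (stripMove [Key.side c, Key.dot]) ∈
              (pick (E'.interp I) (H.interp I) c).Lr := by
          rcases hF with rfl | rfl
          · exact mem_conj_Lr.1 hΦ
          · exact mem_disj_Lr.1 hΦ
        refine ⟨(mem_pos_of_forall (ok := fun m => ∃ b α, m = [Key.side b, Key.dot] ++ α)).2
          fun m hm => ?_, fun c => ?_⟩
        · rcases List.mem_append.1 hm with hm | hm
          · exact (mem_pos_of_forall (ok := fun m => ∃ b α, m = [Key.side b, Key.dot] ++ α)).1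
              hΦ'.1 m hm
          · rw [List.mem_singleton.1 hm]
            exact ⟨b, μ, rfl⟩
        · rw [via_pos, filterMap_append_singleton, stepBuild, stripMove_side]
          by_cases hc : c = b
          · subst hc
            rw [if_pos rfl, interp_pick]
            exact h3
          · rw [if_neg hc]
            have := hΦ'.2 c
            rw [via_pos] at this
            simpa using this
      rcases hF with rfl | rfl
      · exact mem_conj_Lr.2 key
      · exact mem_disj_Lr.2 key
    · have key : (∀ n m, (pos (Φ ++ [(p, stepBuild σ k (.inr L) μ)])).get? n = some m →
          ∃ (w : List Bool) (α : Move), m.2 = w.map Key.bit ++ [Key.dot] ++ α) ∧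
          ∀ x, (pos (Φ ++ [(p, stepBuild σ k (.inr L) μ)])).via (threadMove x) ∈
            (E.interp I).Lr := by
        have hΦ' : (∀ n m, (pos Φ).get? n = some m →
            ∃ (w : List Bool) (α : Move), m.2 = w.map Key.bit ++ [Key.dot] ++ α) ∧
            ∀ x, (pos Φ).via (threadMove x) ∈ (E.interp I).Lr := by
          rcases hF with rfl | rfl
          · exact mem_recur_Lr.1 hΦ
          · exact mem_corecur_Lr.1 hΦ
        refine ⟨(mem_pos_of_forall (ok := fun m => ∃ (w : List Bool) (α : Move),
          m = w.map Key.bit ++ [Key.dot] ++ α)).2 fun m hm => ?_, fun x => ?_⟩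
        · rcases List.mem_append.1 hm with hm | hm
          · exact (mem_pos_of_forall (ok := fun m => ∃ (w : List Bool) (α : Move),
              m = w.map Key.bit ++ [Key.dot] ++ α)).1 hΦ'.1 m hm
          · rw [List.mem_singleton.1 hm]
            exact ⟨_, μ, by rw [stepBuild, word_eq_map, List.append_assoc]; rfl⟩
        · rw [via_pos, filterMap_append_singleton, stepBuild, threadMove_word]
          by_cases hx : ∀ n < k * (L.length + 1), x n = interleave σ L n
          · have h6 : Φ.filterMap (liftMove (threadMove x)) =
                Φ.filterMap (liftMove (stepMove σ (.inr L))) := by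
              refine List.filterMap_congr fun m hm => ?_
              rw [liftMove, liftMove, (hT m hm).threadMove_eq hx]
              rfl
            rw [if_pos hx, h6]
            exact h3
          · rw [if_neg hx]
            have := hΦ'.2 x
            rw [via_pos] at this
            simpa using this
      rcases hF with rfl | rfl
      · exact mem_recur_Lr.2 key
      · exact mem_corecur_Lr.2 key
    · obtain ⟨h4, h5⟩ := mem_corecur_Lr.1 hΦ
      obtain ⟨h6, h7⟩ := mem_corecur_Lr.1 h3
      refine mem_corecur_Lr.2 ⟨(mem_pos_of_forall (ok := fun m => ∃ (w : List Bool) (α : Move),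
        m = w.map Key.bit ++ [Key.dot] ++ α)).2 fun m hm => ?_, fun x => ?_⟩
      · rcases List.mem_append.1 hm with hm | hm
        · exact (mem_pos_of_forall (ok := fun m => ∃ (w : List Bool) (α : Move),
            m = w.map Key.bit ++ [Key.dot] ++ α)).1 h4 m hm
        · rw [List.mem_singleton.1 hm]
          obtain ⟨w, γ, hw⟩ := (mem_pos_of_forall (ok := fun m => ∃ (w : List Bool) (α : Move),
            m = w.map Key.bit ++ [Key.dot] ++ α)).1 h6 (p, μ) (by simp)
          exact ⟨b :: w, γ, by simp only at hw; rw [stepBuild, hw]; rfl⟩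
      -- The first bit of the thread decides whether it lies in the half that shows the new move.
      · obtain ⟨c, y, rfl⟩ : ∃ c y, x = fun n => Nat.casesOn n c y :=
          ⟨x 0, fun n => x (n + 1), by funext n; cases n <;> rfl⟩
        by_cases hc : c = b
        · subst hc
          have := h7 y
          have h8 : Φ.filterMap (liftMove (stepMove σ (.inl (true, c)))) ++ [(p, μ)] =
              (Φ ++ [(p, stepBuild σ k (.inl (true, c)) μ)]).filterMap
                (liftMove (halfMove c)) := by
            rw [filterMap_append_singleton, stepBuild, halfMove_bit, if_pos rfl]
            rfl
          rw [h8, ← via_pos, Run.via_via] at this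
          simpa only [halfMove_threadMove] using this
        · have := h5 (fun n => Nat.casesOn n c y)
          rw [via_pos] at this ⊢
          rw [filterMap_append_singleton, stepBuild, ← halfMove_threadMove, halfMove_bit,
            if_neg hc]
          simpa using this

/-! ### The copycat strategy -/

/-- The other member of the pair `{2j, 2j + 1}` that contains `a`. -/
def partner (a : ℕ) : ℕ := if a % 2 = 0 then a + 1 else a - 1

theorem partner_partner (a : ℕ) : partner (partner a) = a := by
  unfold partner
  split_ifs <;> omega

/-- The assignment of bitstrings to variables that is coded by a number. -/
def oracle (r v n : ℕ) : Bool := r.testBit (Nat.pair v n)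

/-- The needed bits are stored at the places `Nat.pair v n` of one number; all these places lie
below `(N + K + 1) ^ 2`, which gives the bound for the search in `copies`. -/
theorem exists_oracle (σ : ℕ → ℕ → Bool) (N K : ℕ) :
    ∃ r < 2 ^ (N + K + 1) ^ 2, ∀ v < N, ∀ n < K, oracle r v n = σ v n := by
  refine ⟨Nat.ofBits fun i : Fin ((N + K + 1) ^ 2) => σ (Nat.unpair i).1 (Nat.unpair i).2,
    Nat.ofBits_lt_two_pow _, fun v hv n hn => ?_⟩
  have h : Nat.pair v n < (N + K + 1) ^ 2 :=
    (Nat.pair_lt_max_add_one_sq v n).trans_le (Nat.pow_le_pow_left (by omega) 2)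
  rw [oracle, Nat.testBit_ofBits_lt _ _ h]
  simp

/-- A bound, for the addresses `As`, on the places of the bits that are spelled in built moves. -/
def depth (As : List Addr) (k : ℕ) : ℕ := k * ((addrVars As.flatten).length + 1)

theorem length_addrVars_le {As : List Addr} {A : Addr} (h : A ∈ As) :
    (addrVars A).length ≤ (addrVars As.flatten).length := by
  induction As with
  | nil => simp at h
  | cons B As ih =>
    have h1 : addrVars (B :: As).flatten = addrVars B ++ addrVars As.flatten := by
      simp [addrVars]
    rw [h1, List.length_append]
    rcases List.mem_cons.1 h with rfl | h
    · exact Nat.le_add_right _ _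
    · exact (ih h).trans (Nat.le_add_left _ _)

/-- The copies, at the address number `partner a`, of what is seen of `m` at the address number `a`
under the assignment `r`. -/
def copyMove (As : List Addr) (k : ℕ) (m : Move) (a r : ℕ) : Option Move :=
  As[a]?.bind fun A => As[partner a]?.bind fun B =>
    (addrMove (oracle r) A m).map (build (oracle r) k B)

/-- All the copies of `m`. -/
def copies (N : ℕ) (As : List Addr) (k : ℕ) (m : Move) : List Move :=
  (List.range As.length).flatMap fun a =>
    (List.range (2 ^ (N + depth As k + 1) ^ 2)).filterMap (copyMove As k m a)

/-- The moves of the machine after the last move of the environment. -/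
def tailMoves (Φ : List LabMove) : List Move :=
  (Φ.reverse.takeWhile fun m => m.1 = .top).map Prod.snd

/-- The position up to the last move of the environment, reversed. -/
def beforeTail (Φ : List LabMove) : List LabMove := Φ.reverse.dropWhile fun m => m.1 = .top

/-- The total length of the moves of a position. -/
def totalLength (Φ : List LabMove) : ℕ := (Φ.map fun m => m.2.length).sum

/-- The copycat strategy: copy the last move of the environment in all possible ways. -/
def respond (D : ℕ × List Addr) (Φ : List LabMove) : Option Move :=
  (beforeTail Φ).head?.bind fun m =>
    -- The number of bits to be spelled is the total length of the position up to and including the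
    -- last environment move. It bounds the length of every move up to that point and stays the same
    -- while the copies are being made.
    ((copies D.1 D.2 (totalLength (beforeTail Φ)) m.2).filter fun c => c ∉ tailMoves Φ).head?

/-- The addresses are as in an axiom: those in a pair belong to opposite formulas and have the same
variables. -/
structure Paired (F : Formula) (N : ℕ) (As : List Addr) : Prop where
  vars : ∀ (a : ℕ) (A B : Addr), As[a]? = some A → As[partner a]? = some B → addrVars B ⊆ addrVars A
  vars_lt : ∀ A ∈ As, ∀ v ∈ addrVars A, v < N
  apart : ∀ (a b : ℕ) (A B : Addr), As[a]? = some A → As[b]? = some B → a ≠ b → Apart A B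
  neg : ∀ (a : ℕ) (A B : Addr), As[a]? = some A → As[partner a]? = some B →
    ∃ G, target F A = some G ∧ target F B = some G.neg

/-- In each pair, the subrun at one address is the negation of that at the other. -/
def Mirror (As : List Addr) (Φ : List LabMove) : Prop :=
  ∀ σ a A B, As[a]? = some A → As[partner a]? = some B →
    proj σ A Φ = (proj σ B Φ).map fun m => (m.1.neg, m.2)

theorem mem_copies {N : ℕ} {As : List Addr} {k : ℕ} {m c : Move} (h : c ∈ copies N As k m) :
    ∃ a A B r α, As[a]? = some A ∧ As[partner a]? = some B ∧
      addrMove (oracle r) A m = some α ∧ c = build (oracle r) k B α := by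
  simp only [copies, List.mem_flatMap, List.mem_filterMap, copyMove, Option.bind_eq_some_iff,
    Option.map_eq_some_iff] at h
  obtain ⟨a, -, r, -, A, hA, B, hB, α, hα, rfl⟩ := h
  exact ⟨a, A, B, r, α, hA, hB, hα, rfl⟩

/-- An assignment that sees a copy at `B` agrees with the copying one on `k` bits of the variables
of `B`, hence of those of `A`, and `m` has length at most `k`. So it sees the original at `A`, and
the copy is the very one that it would build itself: no assignment sees two different copies at `B`.
Copies made for other pairs are hidden by apartness. -/
theorem Paired.hit {F : Formula} {N : ℕ} {As : List Addr} (hP : Paired F N As) {k : ℕ} {m c : Move}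
    (hm : m.length ≤ k) (hc : c ∈ copies N As k m) {a : ℕ} {A B : Addr} (hA : As[a]? = some A)
    (hB : As[partner a]? = some B) {σ : ℕ → ℕ → Bool} {β : Move}
    (h : addrMove σ B c = some β) : addrMove σ A m = some β ∧ c = build σ k B β := by
  obtain ⟨a', A', B', r, α, hA', hB', hα, rfl⟩ := mem_copies hc
  by_cases hab : partner a = partner a'
  · have haa : a = a' := by rw [← partner_partner a, hab, partner_partner]
    subst haa
    rw [hA] at hA'
    rw [hB] at hB'
    cases hA'
    cases hB'
    obtain ⟨rfl, h1, h2⟩ := addrMove_build h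
    refine ⟨?_, by rw [h1]⟩
    rw [← hα]
    refine addrMove_congr hm fun v hv => h2 v ?_
    have := hP.vars _ B A hB
    rw [partner_partner] at this
    exact this hA hv
  · rw [addrMove_build_of_apart (hP.apart _ _ B B' hB hB' hab)] at h
    exact absurd h (by simp)

/-- An arbitrary assignment may be replaced by one coded by a number in the search range, since only
finitely many bits matter. -/
theorem Paired.build_mem_copies {F : Formula} {N : ℕ} {As : List Addr} (hP : Paired F N As) {k : ℕ}
    {m : Move} (hm : m.length ≤ k) {a : ℕ} {A B : Addr} (hA : As[a]? = some A)
    (hB : As[partner a]? = some B) {σ : ℕ → ℕ → Bool} {β : Move}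
    (h : addrMove σ A m = some β) : build σ k B β ∈ copies N As k m := by
  obtain ⟨r, hr, hσ⟩ := exists_oracle σ N (depth As k)
  have hAm := List.mem_of_getElem? hA
  have hBm := List.mem_of_getElem? hB
  simp only [copies, List.mem_flatMap, List.mem_filterMap, copyMove, Option.bind_eq_some_iff,
    Option.map_eq_some_iff, List.mem_range]
  refine ⟨a, (List.getElem?_eq_some_iff.1 hA).1, r, hr, A, hA, B, hB, β, ?_, ?_⟩
  · rw [← h]
    refine addrMove_congr hm fun v hv n hn => hσ v (hP.vars_lt A hAm v hv) n (hn.trans_le ?_)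
    exact Nat.le_mul_of_pos_right k (Nat.succ_pos _)
  · refine congrFun (build_congr (K := depth As k) ?_
      fun v hv n hn => hσ v (hP.vars_lt B hBm v hv) n hn) β
    exact Nat.mul_le_mul_left k (Nat.succ_le_succ (length_addrVars_le hBm))

theorem filterMap_eq_singleton {α β : Type*} {f : α → Option β} {l : List α} {c : α} {b : β}
    (hl : l.Nodup) (hc : c ∈ l) (hb : f c = some b) (h : ∀ d ∈ l, d ≠ c → f d = none) :
    l.filterMap f = [b] := by
  induction l with
  | nil => simp at hc
  | cons d l ih =>
    rw [List.nodup_cons] at hl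
    by_cases hd : d = c
    · subst hd
      rw [List.filterMap_cons_some hb, List.cons.injEq]
      refine ⟨rfl, List.filterMap_eq_nil_iff.2 fun e he => h e (List.mem_cons_of_mem _ he) ?_⟩
      rintro rfl
      exact hl.1 he
    · rw [List.filterMap_cons_none (h d List.mem_cons_self hd)]
      exact ih hl.2 ((List.mem_cons.1 hc).resolve_left fun h' => hd h'.symm)
        fun e he => h e (List.mem_cons_of_mem _ he)

/-- The position `Φ` followed by the environment's move `m` and the machine's moves `ms`. -/
def roundPos (Φ : List LabMove) (m : Move) (ms : List Move) : List LabMove :=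
  Φ ++ [(.bot, m)] ++ ms.map fun c => (.top, c)

theorem proj_roundPos (σ : ℕ → ℕ → Bool) (A : Addr) (Φ : List LabMove) (m : Move)
    (ms : List Move) : proj σ A (roundPos Φ m ms) = proj σ A Φ ++
      (addrMove σ A m).toList.map (fun β => (.bot, β)) ++
        (ms.filterMap (addrMove σ A)).map fun β => (.top, β) := by
  rw [proj, roundPos, List.filterMap_append, filterMap_append_singleton, ← proj]
  congr 1
  · congr 1
    cases addrMove σ A m <;> rfl
  · rw [List.filterMap_map, List.map_filterMap]
    rfl

/-- The state of play in a round of the copycat strategy. -/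
structure Round (N : ℕ) (As : List Addr) (Φ : List LabMove) (m : Move) (ms : List Move) : Prop where
  mirror : Mirror As Φ
  nodup : ms.Nodup
  mem : ∀ c ∈ ms, c ∈ copies N As (totalLength (Φ ++ [(.bot, m)])) m

theorem length_le_totalLength {Φ : List LabMove} {m : LabMove} (h : m ∈ Φ) :
    m.2.length ≤ totalLength Φ :=
  List.single_le_sum (by simp) _ (List.mem_map_of_mem (f := fun m : LabMove => m.2.length) h)

theorem respond_roundPos (D : ℕ × List Addr) (Φ : List LabMove) (m : Move) (ms : List Move) :
    respond D (roundPos Φ m ms) =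
      ((copies D.1 D.2 (totalLength (Φ ++ [(.bot, m)])) m).filter fun c => c ∉ ms).head? := by
  have h1 : beforeTail (roundPos Φ m ms) = (.bot, m) :: Φ.reverse := by
    simp only [beforeTail, roundPos, List.reverse_append, ← List.map_reverse]
    rw [List.dropWhile_append_of_pos (by simp)]
    rfl
  have h2 : tailMoves (roundPos Φ m ms) = ms.reverse := by
    simp only [tailMoves, roundPos, List.reverse_append, ← List.map_reverse]
    rw [List.takeWhile_append_of_pos (by simp)]
    simp [Function.comp_def]
  have h3 : totalLength ((.bot, m) :: Φ.reverse) = totalLength (Φ ++ [(.bot, m)]) := by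
    simp [totalLength, List.sum_reverse, Nat.add_comm]
  simp only [respond, h1, h2, h3, List.mem_reverse, List.head?_cons, Option.bind_some]

theorem respond_nil (D : ℕ × List Addr) : respond D [] = none := rfl

theorem Round.step {N : ℕ} {As : List Addr} {Φ : List LabMove} {m c : Move} {ms : List Move}
    (h : Round N As Φ m ms) (hc : respond (N, As) (roundPos Φ m ms) = some c) :
    Round N As Φ m (ms ++ [c]) ∧ c ∈ copies N As (totalLength (Φ ++ [(.bot, m)])) m ∧ c ∉ ms := by
  rw [respond_roundPos] at hc
  have h1 := List.mem_filter.1 (List.mem_of_head? hc)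
  have h2 : c ∉ ms := by simpa using h1.2
  refine ⟨⟨h.mirror, ?_, ?_⟩, h1.1, h2⟩
  · exact List.nodup_append.2 ⟨h.nodup, List.nodup_singleton _, by
      rintro a ha b hb rfl
      rw [List.mem_singleton.1 hb] at ha
      exact h2 ha⟩
  · intro d hd
    rcases List.mem_append.1 hd with hd | hd
    · exact h.mem d hd
    · rw [List.mem_singleton.1 hd]
      exact h1.1

theorem roundPos_append (Φ : List LabMove) (m c : Move) (ms : List Move) :
    roundPos Φ m (ms ++ [c]) = roundPos Φ m ms ++ [(.top, c)] := by
  simp [roundPos]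

theorem length_le_roundLength (Φ : List LabMove) (m : Move) :
    m.length ≤ totalLength (Φ ++ [(.bot, m)]) :=
  length_le_totalLength (m := (Player.bot, m)) (by simp)

/-- When no copy is missing, every assignment that sees something of `m` at `A` sees exactly one
copy of it at `B`, and any other assignment sees none. -/
theorem Paired.mirror_roundPos {F : Formula} {N : ℕ} {As : List Addr} (hP : Paired F N As)
    {Φ : List LabMove} {m : Move} {ms : List Move} (h : Round N As Φ m ms)
    (hc : respond (N, As) (roundPos Φ m ms) = none) : Mirror As (roundPos Φ m ms) := by
  rw [respond_roundPos, List.head?_eq_none_iff, List.filter_eq_nil_iff] at hc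
  have hall : ∀ c ∈ copies N As (totalLength (Φ ++ [(.bot, m)])) m, c ∈ ms := fun c h => by
    simpa using hc c h
  have hm := length_le_roundLength Φ m
  have key : ∀ (σ : ℕ → ℕ → Bool) (a : ℕ) (A B : Addr), As[a]? = some A →
      As[partner a]? = some B → ms.filterMap (addrMove σ B) = (addrMove σ A m).toList := by
    intro σ a A B hA hB
    cases hβ : addrMove σ A m with
    | none =>
      refine List.filterMap_eq_nil_iff.2 fun c hcm => ?_
      by_contra hne
      obtain ⟨β, hβ'⟩ := Option.ne_none_iff_exists'.1 hne
      rw [(hP.hit hm (h.mem c hcm) hA hB hβ').1] at hβ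
      exact absurd hβ (by simp)
    | some β =>
      refine filterMap_eq_singleton h.nodup (hall _ (hP.build_mem_copies hm hA hB hβ))
        (addrMove_build_self _ _ _ _) fun c hcm hne => ?_
      by_contra hne'
      obtain ⟨β', hβ'⟩ := Option.ne_none_iff_exists'.1 hne'
      obtain ⟨h1, h2⟩ := hP.hit hm (h.mem c hcm) hA hB hβ'
      rw [hβ] at h1
      cases h1
      exact hne h2
  intro σ a A B hA hB
  have hA' : As[partner (partner a)]? = some A := by rw [partner_partner, hA]
  rw [proj_roundPos, proj_roundPos, key σ a A B hA hB, key σ (partner a) B A hB hA',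
    h.mirror σ a A B hA hB]
  obtain ⟨G, hG, hG'⟩ := hP.neg a A B hA hB
  -- The move is seen at most at one of the two opposite addresses, so one subrun grows by an
  -- environment move and the other by the machine's copy of it; no question of order arises.
  cases h1 : addrMove σ A m with
  | none =>
    cases h2 : addrMove σ B m with
    | none => simp
    | some β => simp [Player.neg]
  | some α => simp [addrMove_eq_none_of_neg (τ := σ) hG hG' h1, Player.neg]

/-- Under the copying assignment, the subrun at `B` is still the mirror image of the one at `A`
before the environment's move. That move was legal at `A`, so by duality its copy is legal at `B`,
and `legal_build` lifts this to `F`. -/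
theorem Paired.legal_respond {F : Formula} {N : ℕ} {As : List Addr} (hP : Paired F N As)
    {Φ : List LabMove} {m c : Move} {ms : List Move} (h : Round N As Φ m ms)
    (hc : respond (N, As) (roundPos Φ m ms) = some c) {I : Interpretation}
    (hL : pos (roundPos Φ m ms) ∈ (F.interp I).Lr) :
    pos (roundPos Φ m ms ++ [(.top, c)]) ∈ (F.interp I).Lr := by
  obtain ⟨-, hcm, hcn⟩ := h.step hc
  have hm := length_le_roundLength Φ m
  obtain ⟨a, A, B, r, α, hA, hB, hα, rfl⟩ := mem_copies hcm
  obtain ⟨G, hG, hG'⟩ := hP.neg a A B hA hB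
  refine legal_build hL hG' ?_ fun m' hm' => ?_
  -- An earlier copy seen here would, by `Paired.hit`, coincide with the present one, which is new.
  · have h1 : proj (oracle r) B (roundPos Φ m ms) = proj (oracle r) B Φ := by
      have h2 : ms.filterMap (addrMove (oracle r) B) = [] := by
        refine List.filterMap_eq_nil_iff.2 fun c hc => ?_
        by_contra hne
        obtain ⟨β, hβ⟩ := Option.ne_none_iff_exists'.1 hne
        obtain ⟨h3, h4⟩ := hP.hit hm (h.mem c hc) hA hB hβ
        rw [hα] at h3
        cases h3
        exact hcn (h4 ▸ hc)
      rw [proj_roundPos, h2, addrMove_eq_none_of_neg hG hG' hα]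
      simp
    have h2 : pos (Φ ++ [(.bot, m)]) ∈ (F.interp I).Lr := by
      have := (F.interp I).legal.take_mem hL (Φ ++ [(Player.bot, m)]).length
      rwa [pos_take, roundPos, List.take_left] at this
    have h3 := legal_addrMove h2 hG (oracle r)
    rw [via_pos, filterMap_append_singleton, hα, ← proj, h.mirror _ a A B hA hB] at h3
    rw [h1, ((dual_interp I G) _).1, neg_pos]
    simpa [Player.neg] using h3
  · rw [roundPos] at hm'
    -- Moves up to the environment's last one are short; the later ones are copies, built at the
    -- same or at an apart address.
    rcases List.mem_append.1 hm' with hm' | hm'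
    · exact Or.inl (length_le_totalLength hm')
    · obtain ⟨c, hc, rfl⟩ := List.mem_map.1 hm'
      obtain ⟨a', A', B', r', α', hA', hB', -, rfl⟩ := mem_copies (h.mem c hc)
      refine Or.inr ⟨_, B', _, ?_, rfl⟩
      by_cases hab : partner a' = partner a
      · rw [hab, hB] at hB'
        cases hB'
        exact Or.inl rfl
      · exact Or.inr (hP.apart _ _ _ _ hB' hB hab)

/-- A position that can arise when the copycat strategy is followed. -/
def Reached (N : ℕ) (As : List Addr) (Ψ : List LabMove) : Prop :=
  Ψ = [] ∨ ∃ Φ m ms, Ψ = roundPos Φ m ms ∧ Round N As Φ m ms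

theorem Paired.mirror_of_none {F : Formula} {N : ℕ} {As : List Addr} (hP : Paired F N As)
    {Ψ : List LabMove} (h : Reached N As Ψ) (hc : respond (N, As) Ψ = none) : Mirror As Ψ := by
  rcases h with rfl | ⟨Φ, m, ms, rfl, h⟩
  · intro σ a A B _ _
    rfl
  · exact hP.mirror_roundPos h hc

theorem Paired.reached_step {F : Formula} {N : ℕ} {As : List Addr} (hP : Paired F N As)
    {Ψ Ψ' : List LabMove} (h : Reached N As Ψ) (hs : FollowsBy (respond (N, As) Ψ) Ψ Ψ') :
    Reached N As Ψ' := by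
  cases hc : respond (N, As) Ψ with
  | none =>
    rw [hc] at hs
    rcases hs with rfl | ⟨α, rfl⟩
    · exact h
    · refine Or.inr ⟨Ψ, α, [], by simp [roundPos], hP.mirror_of_none h hc, List.nodup_nil, ?_⟩
      simp
  | some c =>
    rw [hc] at hs
    rcases h with rfl | ⟨Φ, m, ms, rfl, h⟩
    · rw [respond_nil] at hc
      exact absurd hc (by simp)
    · exact Or.inr ⟨Φ, m, ms ++ [c], by rw [roundPos_append]; exact hs, (h.step hc).1⟩

theorem FollowsBy.isPrefix {o : Option Move} {Φ Φ' : List LabMove} (h : FollowsBy o Φ Φ') :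
    Φ <+: Φ' := by
  cases o with
  | none =>
    rcases h with rfl | ⟨α, rfl⟩
    · exact List.prefix_rfl
    · exact List.prefix_append _ _
  | some μ =>
    have h' : Φ' = Φ ++ [(.top, μ)] := h
    rw [h']
    exact List.prefix_append _ _

/-- Each environment move has finitely many copies, none of which is made twice, so permission
recurs. The machine never makes the first illegal move. The mirror property holds whenever
permission is granted, hence also in the limit. -/
theorem Paired.copycat {F : Formula} {N : ℕ} {As : List Addr} (hP : Paired F N As)
    {p : ℕ → List LabMove} (h0 : p 0 = [])
    (hs : ∀ i, FollowsBy (respond (N, As) (p i)) (p i) (p (i + 1))) :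
    (∀ i, ∃ j ≥ i, respond (N, As) (p j) = none) ∧
    (∀ I, (F.interp I).Illegal .bot (limitRun p) ∨ limitRun p ∈ (F.interp I).Lr) ∧
    ∀ σ a A B, As[a]? = some A → As[partner a]? = some B →
      (limitRun p).via (addrMove σ A) = ((limitRun p).via (addrMove σ B)).neg := by
  have hpre : ∀ n k, n ≤ k → p n <+: p k := prefix_of_succ fun i => (hs i).isPrefix
  have hreach : ∀ i, Reached N As (p i) := by
    intro i
    induction i with
    | zero => exact Or.inl h0
    | succ i ih => exact hP.reached_step ih (hs i)
  have hnone : ∀ i, ∃ j ≥ i, respond (N, As) (p j) = none := by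
    intro i
    by_contra hne
    push Not at hne
    rcases hreach i with h1 | ⟨Φ, m, ms, h1, h2⟩
    · exact hne i le_rfl (by rw [h1, respond_nil])
    have key : ∀ j, ∃ ms', p (i + j) = roundPos Φ m ms' ∧ Round N As Φ m ms' ∧ j ≤ ms'.length := by
      intro j
      induction j with
      | zero => exact ⟨ms, h1, h2, Nat.zero_le _⟩
      | succ j ih =>
        obtain ⟨ms', h3, h4, h5⟩ := ih
        obtain ⟨c, hc⟩ := Option.ne_none_iff_exists'.1 (hne (i + j) (Nat.le_add_right _ _))
        have h6 := hs (i + j)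
        rw [hc] at h6
        rw [h3] at hc h6
        exact ⟨ms' ++ [c], by rw [roundPos_append]; exact h6, (h4.step hc).1, by simpa using h5⟩
    obtain ⟨ms', -, h3, h4⟩ := key ((copies N As (totalLength (Φ ++ [(.bot, m)])) m).length + 1)
    -- A duplicate-free list of copies cannot be longer than the list of all copies.
    have := (h3.nodup.subperm h3.mem).length_le
    omega
  refine ⟨hnone, fun I => ?_, fun σ a A B hA hB => ?_⟩
  · by_contra hcon
    rw [not_or, (F.interp I).legal.limitRun_mem hpre, not_forall] at hcon
    obtain ⟨h1, h2⟩ := hcon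
    classical
    -- Consider the first illegal position; it is not the initial one, so it arises from a legal
    -- position by a single move.
    obtain ⟨n, hn⟩ : ∃ n, Nat.find h2 = n + 1 := by
      refine Nat.exists_eq_succ_of_ne_zero fun h => ?_
      have := Nat.find_spec h2
      rw [h, h0] at this
      exact this (F.interp I).legal.nil_mem
    have h3 : pos (p (n + 1)) ∉ (F.interp I).Lr := hn ▸ Nat.find_spec h2
    have h4 : pos (p n) ∈ (F.interp I).Lr := not_not.1 (Nat.find_min h2 (by omega))
    have h5 := hs n
    cases hc : respond (N, As) (p n) with
    | some c =>
      rw [hc] at h5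
      have h5' : p (n + 1) = p n ++ [(.top, c)] := h5
      rcases hreach n with h6 | ⟨Φ, m, ms, h6, h7⟩
      · rw [h6, respond_nil] at hc
        exact absurd hc (by simp)
      · rw [h6] at hc h4 h5'
        exact h3 (h5' ▸ hP.legal_respond h7 hc h4)
    | none =>
      rw [hc] at h5
      rcases h5 with h5 | ⟨α, h5⟩
      · exact h3 (h5 ▸ h4)
      · refine h1 ⟨(p n).length, α, ?_, fun k hk => ?_, ?_⟩
        · rw [limitRun_get? hpre (n := n + 1) (by simp [h5]), h5]
          simp
        · rw [limitRun_take hpre hk, ← pos_take]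
          exact (F.interp I).legal.take_mem h4 k
        · rw [limitRun_take hpre (n := n + 1) (by simp [h5]), h5]
          rw [h5] at h3
          rwa [List.take_of_length_le (by simp)]
  · rw [Run.via, Run.via, filterMap_limitRun _ hpre, filterMap_limitRun _ hpre, neg_limitRun
      fun n k h => (hpre n k h).filterMap _]
    have hm : ∀ j, respond (N, As) (p j) = none →
        (p j).filterMap (liftMove (addrMove σ A)) =
          ((p j).filterMap (liftMove (addrMove σ B))).map fun m => (m.1.neg, m.2) :=
      fun j hj => hP.mirror_of_none (hreach j) hj σ a A B hA hB
    refine limitRun_eq_of_cofinal (fun n k h => (hpre n k h).filterMap _)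
      (fun n k h => ((hpre n k h).filterMap _).map _) (fun n => ?_) fun n => ?_
    · obtain ⟨j, hj, hj'⟩ := hnone n
      exact ⟨j, hm j hj' ▸ (hpre n j hj).filterMap _⟩
    · obtain ⟨j, hj, hj'⟩ := hnone n
      exact ⟨j, hm j hj' ▸ ((hpre n j hj).filterMap _).map _⟩

/-! ### Rules as maps between the oformulas of premise and conclusion

The kinds of rules are numbered: `0` covers the rules that change no oformula, `1` exchange of
oformulas, `2` weakening with deletion, `3` contraction, `4` disjunction, `5` conjunction,
`6` recurrence and `7` corecurrence introduction. -/

/-- The group contains the oformula number `a`. -/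
abbrev InGroup (X : Group) (a : ℕ) : Prop := X[a]? = some true

/-- The oformula of the conclusion from which the oformula number `a` of the premise comes. -/
def parent (k i a : ℕ) : ℕ :=
  if k = 1 then (if a = i then i + 1 else if a = i + 1 then i else a)
  else if k = 2 then (if a < i then a else a + 1)
  else if 3 ≤ k ∧ k ≤ 5 then (if a ≤ i then a else a - 1)
  else a

/-- The steps from its parent to the oformula number `a` of the premise. -/
def extension (k i v : ℕ) (L : List ℕ) (a : ℕ) : Addr :=
  if k < 3 then []
  else if a = i then
    -- Contraction leads to halves of a corecurrence, disjunction and conjunction to sides,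
    -- recurrence to the thread of a fresh variable, corecurrence to an interleaving.
    (if k ≤ 5 then [.inl (decide (k = 3), false)] else if k = 6 then [.inr [v]] else [.inr L])
  else if a = i + 1 ∧ k ≤ 5 then [.inl (decide (k = 3), true)]
  else []

/-- The overgroup `X` of the premise is mapped into the overgroup `Y` of the conclusion, not
counting the oformula introduced by the corecurrence rule. -/
def Cover (k i n : ℕ) (X Y : Group) : Prop :=
  ∀ a < n, InGroup X a → (k = 7 ∧ a = i) ∨ InGroup Y (parent k i a)

instance (k i n : ℕ) (X Y : Group) : Decidable (Cover k i n X Y) := by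
  unfold Cover; infer_instance

/-- The group contains at most the oformula number `i`. -/
def Sole (i n : ℕ) (X : Group) : Prop := ∀ a < n, InGroup X a → a = i

instance (i n : ℕ) (X : Group) : Decidable (Sole i n X) := by
  unfold Sole; infer_instance

/-- The formula `G` of the conclusion is related to the formulas `E` and `H` of the premise as in the
rules of kind `k`. -/
def SplitOk (k : ℕ) (G E H : Option Formula) : Prop :=
  -- The remainder `5` of the Gödel number says that the formula is a corecurrence.
  (k = 3 → G = E ∧ G = H ∧ (G.elim 0 Formula.toNat) % 6 = 5) ∧
  (k = 4 → G = E.bind fun e => H.map (Formula.disj e)) ∧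
  (k = 5 → G = E.bind fun e => H.map (Formula.conj e)) ∧
  (k = 6 → G = E.map Formula.recur) ∧ (k = 7 → G = E.map Formula.corecur)

instance (k : ℕ) (G E H : Option Formula) : Decidable (SplitOk k G E H) := by
  unfold SplitOk; infer_instance

/-- The oformulas of the premise that have to be avoided in turn. -/
def avoid (k i n : ℕ) : List ℕ := if k = 5 then [i, i + 1] else [n]

/-- A condition that is implied by the rules of kind `k` at the oformula number `i` and that ensures
the transfer of victory from the premise `A` to the conclusion `C`. -/
def RuleOk (k i : ℕ) (A C : Cirquent) : Prop :=
  (3 ≤ k → i < C.forms.length) ∧ k < 8 ∧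
  (∀ a < A.forms.length, (a = i ∧ 3 ≤ k) ∨ (a = i + 1 ∧ 3 ≤ k ∧ k ≤ 5) ∨
    A.forms[a]? = C.forms[parent k i a]?) ∧
  SplitOk k C.forms[i]? A.forms[i]? A.forms[i + 1]? ∧
  -- A variable attached to `Y` passes to those premise overgroups that are mapped into `Y`. This
  -- clause ensures that no oformula loses a variable of its parent.
  (∀ Y ∈ C.ogroups, ∀ a < A.forms.length, InGroup Y (parent k i a) →
    ∃ X ∈ A.ogroups, InGroup X a ∧ Cover k i A.forms.length X Y) ∧
  (k = 6 → ∃ X ∈ A.ogroups, InGroup X i ∧ Sole i A.forms.length X) ∧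
  -- For a conjunction there must be one such undergroup without the left and one without the right
  -- conjunct. For the other rules `avoid` yields the index past the last oformula, which no group
  -- of the right length contains.
  (∀ Y ∈ C.ugroups, ∀ b ∈ avoid k i A.forms.length, ∃ X ∈ A.ugroups, ¬ InGroup X b ∧
    ∀ a < A.forms.length, InGroup X a → InGroup Y (parent k i a))

instance (k i : ℕ) (A C : Cirquent) : Decidable (RuleOk k i A C) := by
  unfold RuleOk; infer_instance

/-! ### Addresses for the oformulas of a proof -/

/-- A number above all the variables in use, addresses of the oformulas, and the overgroups with
lists of variables attached to them. -/
abbrev Annot := ℕ × List Addr × List (Group × List ℕ)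

/-- The variables attached to the overgroups of the premise. -/
def nextTerms (k i v n : ℕ) (T : List (Group × List ℕ)) (O : List Group) :
    List (Group × List ℕ) :=
  O.map fun X => (X, (T.flatMap fun x => if Cover k i n X x.1 then x.2 else []) ++
    if k = 6 ∧ Sole i n X then [v] else [])

/-- The variables attached to the overgroups of the oformula number `i`. -/
def joined (i : ℕ) (T : List (Group × List ℕ)) : List ℕ :=
  T.flatMap fun x => if InGroup x.1 i then x.2 else []

/-- The annotation of the premise. -/
def nextAnnot (k i : ℕ) (A : Cirquent) (s : Annot) : Annot :=
  (s.1 + 1,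
    (List.range A.forms.length).map fun a => s.2.1.getD (parent k i a) [] ++
      extension k i s.1 (joined i (nextTerms k i s.1 A.forms.length s.2.2 A.ogroups)) a,
    nextTerms k i s.1 A.forms.length s.2.2 A.ogroups)

/-- The annotation fits the cirquent. -/
structure Fits (F : Formula) (C : Cirquent) (s : Annot) : Prop where
  length_eq : s.2.1.length = C.forms.length
  fst_eq : s.2.2.map Prod.fst = C.ogroups
  target_eq : ∀ a G, C.forms[a]? = some G → target F (s.2.1.getD a []) = some G
  vars : ∀ a < C.forms.length, ∀ v, v ∈ addrVars (s.2.1.getD a []) ↔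
    ∃ x ∈ s.2.2, InGroup x.1 a ∧ v ∈ x.2
  lt : ∀ x ∈ s.2.2, ∀ v ∈ x.2, v < s.1
  apart : ∀ a < C.forms.length, ∀ b < C.forms.length, a ≠ b →
    Apart (s.2.1.getD a []) (s.2.1.getD b [])

/-- The oformula number `a` is won under `σ`. -/
def WonAt (I : Interpretation) (C : Cirquent) (s : Annot) (Γ : Run) (σ : ℕ → ℕ → Bool) (a : ℕ) :
    Prop :=
  ∃ G, C.forms[a]? = some G ∧ (G.interp I).Wn (Γ.via (addrMove σ (s.2.1.getD a []))) = .top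

/-- Every undergroup contains a won oformula, for every choice of essentially finite bitstrings. -/
def Won (I : Interpretation) (C : Cirquent) (s : Annot) (Γ : Run) : Prop :=
  ∀ σ : ℕ → ℕ → Bool, (∀ v, EssFinite (σ v)) → ∀ U ∈ C.ugroups,
    ∃ a < C.forms.length, InGroup U a ∧ WonAt I C s Γ σ a

theorem eq_corecur_of_toNat {F : Formula} (h : F.toNat % 6 = 5) : ∃ E, F = .corecur E := by
  cases F with
  | corecur E => exact ⟨E, rfl⟩
  | _ => simp only [Formula.toNat] at h; omega

theorem RuleOk.target_extension {k i : ℕ} {A C : Cirquent} (h : RuleOk k i A C) (v : ℕ)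
    (L : List ℕ) {a : ℕ} {G' : Formula} (hG : A.forms[a]? = some G') :
    ∃ G, C.forms[parent k i a]? = some G ∧ target G (extension k i v L a) = some G' := by
  obtain ⟨hi, hk, hforms, hsplit, -⟩ := h
  have ha : a < A.forms.length := (List.getElem?_eq_some_iff.1 hG).1
  by_cases h3 : 3 ≤ k
  · have hi' := hi h3
    obtain ⟨G, hGi⟩ : ∃ G, C.forms[i]? = some G := ⟨_, List.getElem?_eq_getElem hi'⟩
    rw [hGi] at hsplit
    obtain ⟨s3, s4, s5, s6, s7⟩ := hsplit
    by_cases hai : a = i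
    · subst hai
      rw [hG] at s3 s4 s5 s6 s7
      have hp : parent k a a = a := by simp only [parent]; split_ifs <;> omega
      refine ⟨G, by rw [hp, hGi], ?_⟩
      interval_cases k
      · obtain ⟨h1, -, h2⟩ := s3 rfl
        cases h1
        obtain ⟨E, rfl⟩ := eq_corecur_of_toNat h2
        simp [extension, target, stepForm]
      · have := (s4 rfl).symm
        rw [Option.bind_some, Option.map_eq_some_iff] at this
        obtain ⟨H, -, rfl⟩ := this
        simp [extension, target, stepForm]
      · have := (s5 rfl).symm
        rw [Option.bind_some, Option.map_eq_some_iff] at this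
        obtain ⟨H, -, rfl⟩ := this
        simp [extension, target, stepForm]
      · have := s6 rfl
        cases this
        simp [extension, target, stepForm]
      · have := s7 rfl
        cases this
        simp [extension, target, stepForm]
    · by_cases hai' : k ≤ 5 ∧ a = i + 1
      · obtain ⟨hk5, rfl⟩ := hai'
        rw [hG] at s3 s4 s5
        have hp : parent k i (i + 1) = i := by simp only [parent]; split_ifs <;> omega
        refine ⟨G, by rw [hp, hGi], ?_⟩
        interval_cases k
        · obtain ⟨-, h1, h2⟩ := s3 rfl
          cases h1
          obtain ⟨E, rfl⟩ := eq_corecur_of_toNat h2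
          simp [extension, target, stepForm]
        · have := (s4 rfl).symm
          simp only [Option.map_some] at this
          rw [Option.bind_eq_some_iff] at this
          obtain ⟨H, -, h2⟩ := this
          cases h2
          simp [extension, target, stepForm]
        · have := (s5 rfl).symm
          simp only [Option.map_some] at this
          rw [Option.bind_eq_some_iff] at this
          obtain ⟨H, -, h2⟩ := this
          cases h2
          simp [extension, target, stepForm]
      · have he : extension k i v L a = [] := by simp only [extension]; split_ifs <;> first | rfl | omega
        refine ⟨G', ?_, by rw [he]; rfl⟩
        rw [← ((hforms a ha).resolve_left fun h => hai h.1).resolve_left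
          fun h => hai' ⟨h.2.2, h.1⟩, hG]
  · have he : extension k i v L a = [] := by simp only [extension]; split_ifs <;> first | rfl | omega
    refine ⟨G', ?_, by rw [he]; rfl⟩
    rw [← ((hforms a ha).resolve_left fun h => h3 h.2).resolve_left fun h => h3 h.2.1, hG]

theorem RuleOk.parent_lt {k i : ℕ} {A C : Cirquent} (h : RuleOk k i A C) {a : ℕ}
    (ha : a < A.forms.length) : parent k i a < C.forms.length := by
  obtain ⟨G, hG, -⟩ := h.target_extension 0 [] (List.getElem?_eq_getElem ha)
  exact (List.getElem?_eq_some_iff.1 hG).1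

theorem getD_nextAnnot {k i : ℕ} {A : Cirquent} {s : Annot} {a : ℕ} (ha : a < A.forms.length) :
    (nextAnnot k i A s).2.1.getD a [] = s.2.1.getD (parent k i a) [] ++
      extension k i s.1 (joined i (nextTerms k i s.1 A.forms.length s.2.2 A.ogroups)) a := by
  simp [nextAnnot, ha]

/-- Two oformulas have a common parent only if a rule has split it, and then they lie at its two
different sides or halves. -/
theorem extension_apart {k i v : ℕ} {L : List ℕ} {a b : ℕ} (hab : a ≠ b)
    (h : parent k i a = parent k i b) : Apart (extension k i v L a) (extension k i v L b) := by
  have key : ∀ a b, a < b → parent k i a = parent k i b → (3 ≤ k ∧ k ≤ 5) ∧ a = i ∧ b = i + 1 := by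
    intro a b hab h
    simp only [parent] at h
    split_ifs at h <;> omega
  rcases lt_or_gt_of_ne hab with hlt | hlt
  · obtain ⟨⟨h3, h5⟩, rfl, rfl⟩ := key a b hlt h
    simp only [extension, if_neg (by omega : ¬ k < 3), h5, if_true, and_true,
      if_neg (by omega : ¬ a + 1 = a)]
    exact Apart.head _ false _ _
  · obtain ⟨⟨h3, h5⟩, rfl, rfl⟩ := key b a hlt h.symm
    simp only [extension, if_neg (by omega : ¬ k < 3), h5, if_true, and_true,
      if_neg (by omega : ¬ b + 1 = b)]
    exact Apart.head _ true _ _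

theorem addrVars_append (A B : Addr) : addrVars (A ++ B) = addrVars A ++ addrVars B := by
  simp [addrVars]

theorem mem_addrVars_extension {k i v : ℕ} {L : List ℕ} {a w : ℕ} (hk : k < 8) :
    w ∈ addrVars (extension k i v L a) ↔ a = i ∧ ((k = 6 ∧ w = v) ∨ (k = 7 ∧ w ∈ L)) := by
  simp only [extension]
  split_ifs <;> simp_all [addrVars, stepVars] <;> omega

theorem mem_nextTerms {k i v n : ℕ} {T : List (Group × List ℕ)} {O : List Group}
    {a w : ℕ} : (∃ x ∈ nextTerms k i v n T O, InGroup x.1 a ∧ w ∈ x.2) ↔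
      ∃ X ∈ O, InGroup X a ∧ ((∃ y ∈ T, Cover k i n X y.1 ∧ w ∈ y.2) ∨
        (k = 6 ∧ Sole i n X ∧ w = v)) := by
  have key : ∀ X : Group, (w ∈ (T.flatMap fun x => if Cover k i n X x.1 then x.2 else []) ++
      if k = 6 ∧ Sole i n X then [v] else []) ↔
      ((∃ y ∈ T, Cover k i n X y.1 ∧ w ∈ y.2) ∨ (k = 6 ∧ Sole i n X ∧ w = v)) := by
    intro X
    rw [List.mem_append, List.mem_flatMap]
    refine or_congr (exists_congr fun y => and_congr_right fun _ => ?_) ?_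
    · split_ifs with h <;> simp [h]
    · split_ifs with h
      · simp [h]
      · simp only [List.not_mem_nil, false_iff]
        exact fun h' => h ⟨h'.1, h'.2.1⟩
  simp only [nextTerms, List.mem_map, exists_exists_and_eq_and, key]

theorem mem_joined {i : ℕ} {T : List (Group × List ℕ)} {w : ℕ} :
    w ∈ joined i T ↔ ∃ x ∈ T, InGroup x.1 i ∧ w ∈ x.2 := by
  rw [joined, List.mem_flatMap]
  refine exists_congr fun x => and_congr_right fun _ => ?_
  split_ifs with h
  · exact (and_iff_right h).symm
  · simp [h]

/-- The point is that addresses keep exactly the variables of their overgroups. The fresh variable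
goes only to overgroups that contain nothing but the oformula of the recurrence. Whatever a
corecurrence oformula gains by joining overgroups is put into the interleaving of its new step. -/
theorem RuleOk.fits {k i : ℕ} {A C : Cirquent} (h : RuleOk k i A C) {F : Formula} {s : Annot}
    (hs : Fits F C s) : Fits F A (nextAnnot k i A s) := by
  have hk := h.2.1
  obtain ⟨-, -, -, -, hover, hfresh, -⟩ := id h
  refine ⟨by simp [nextAnnot], by simp [nextAnnot, nextTerms, Function.comp_def], ?_, ?_, ?_, ?_⟩
  · intro a G hG
    rw [getD_nextAnnot (List.getElem?_eq_some_iff.1 hG).1, target_append]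
    obtain ⟨G', h1, h2⟩ := h.target_extension s.1
      (joined i (nextTerms k i s.1 A.forms.length s.2.2 A.ogroups)) hG
    rw [hs.target_eq _ _ h1]
    exact h2
  · intro a ha w
    have hpa := h.parent_lt ha
    rw [getD_nextAnnot ha, addrVars_append, List.mem_append, hs.vars _ hpa,
      mem_addrVars_extension hk, mem_joined]
    change _ ↔ ∃ x ∈ nextTerms k i s.1 A.forms.length s.2.2 A.ogroups, _
    constructor
    · rintro (⟨x, hx, hxa, hw⟩ | ⟨rfl, ⟨rfl, rfl⟩ | ⟨rfl, hw⟩⟩)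
      · obtain ⟨X, hX, hXa, hc⟩ := hover x.1
          (hs.fst_eq ▸ List.mem_map_of_mem (f := Prod.fst) hx) a ha hxa
        exact mem_nextTerms.2 ⟨X, hX, hXa, Or.inl ⟨x, hx, hc, hw⟩⟩
      · obtain ⟨X, hX, hXa, hc⟩ := hfresh rfl
        exact mem_nextTerms.2 ⟨X, hX, hXa, Or.inr ⟨rfl, hc, rfl⟩⟩
      · exact hw
    · intro hx
      obtain ⟨X, hX, hXa, ⟨y, hy, hc, hw⟩ | ⟨rfl, hc, rfl⟩⟩ := mem_nextTerms.1 hx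
      -- If the overgroup was joined by the corecurrence rule only, its variables enter the address
      -- through `joined`; otherwise the parent already had them.
      · rcases hc a ha hXa with ⟨rfl, rfl⟩ | hc
        · exact Or.inr ⟨rfl, Or.inr ⟨rfl, hx⟩⟩
        · exact Or.inl ⟨y, hy, hc, hw⟩
      · exact Or.inr ⟨hc a ha hXa, Or.inl ⟨rfl, rfl⟩⟩
  · intro x hx w hw
    change w < s.1 + 1
    simp only [nextAnnot, nextTerms, List.mem_map] at hx
    obtain ⟨X, -, rfl⟩ := hx
    rcases List.mem_append.1 hw with hw | hw
    · obtain ⟨y, hy, hw⟩ := List.mem_flatMap.1 hw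
      split_ifs at hw
      · exact Nat.lt_succ_of_lt (hs.lt y hy w hw)
      · simp at hw
    · split_ifs at hw
      · rw [List.mem_singleton.1 hw]
        exact Nat.lt_succ_self _
      · simp at hw
  · intro a ha b hb hab
    rw [getD_nextAnnot ha, getD_nextAnnot hb]
    by_cases hp : parent k i a = parent k i b
    · rw [hp]
      exact (extension_apart hab hp).append_left _
    · exact (hs.apart _ (h.parent_lt ha) _ (h.parent_lt hb) hp).append _ _

/-! ### Transfer of victory from premise to conclusion -/

theorem via_extension {k i : ℕ} {A : Cirquent} {s : Annot} {a : ℕ} (ha : a < A.forms.length)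
    (σ : ℕ → ℕ → Bool) (Γ : Run) :
    Γ.via (addrMove σ ((nextAnnot k i A s).2.1.getD a [])) =
      (Γ.via (addrMove σ (s.2.1.getD (parent k i a) []))).via (addrMove σ
        (extension k i s.1 (joined i (nextTerms k i s.1 A.forms.length s.2.2 A.ogroups)) a)) := by
  rw [getD_nextAnnot ha, via_addrMove_append]

/-- The oformulas of the premise that the rule does not introduce keep their addresses. -/
theorem RuleOk.wonAt_of_nil {k i : ℕ} {A C : Cirquent} (h : RuleOk k i A C) {I : Interpretation}
    {s : Annot} {Γ : Run} {σ : ℕ → ℕ → Bool} {a : ℕ} (ha : a < A.forms.length)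
    (he : ∀ v L, extension k i v L a = []) (hw : WonAt I A (nextAnnot k i A s) Γ σ a) :
    WonAt I C s Γ σ (parent k i a) := by
  obtain ⟨G, hG, hwin⟩ := hw
  obtain ⟨G', h1, h2⟩ := h.target_extension 0 [] hG
  rw [he] at h2
  cases h2
  refine ⟨G, h1, ?_⟩
  rwa [via_extension ha, he, show addrMove σ [] = some from rfl, Run.via_some] at hwin

/-- Except for the components of a conjunction and the body of a recurrence, a single won oformula
of the premise makes its parent won: one disjunct, one half or one essentially finite thread of a
corecurrence is enough. -/
theorem RuleOk.wonAt {k i : ℕ} {A C : Cirquent} (h : RuleOk k i A C) {F : Formula} {s : Annot}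
    (hs : Fits F C s) {I : Interpretation} {Γ : Run} (hΓ : Γ ∈ (F.interp I).Lr)
    {σ : ℕ → ℕ → Bool} (hσ : ∀ v, EssFinite (σ v)) {a : ℕ} (ha : a < A.forms.length)
    (hk5 : k ≠ 5 ∨ (a ≠ i ∧ a ≠ i + 1)) (hk6 : k ≠ 6 ∨ a ≠ i)
    (hw : WonAt I A (nextAnnot k i A s) Γ σ a) : WonAt I C s Γ σ (parent k i a) := by
  by_cases he : ∀ v L, extension k i v L a = []
  · exact h.wonAt_of_nil ha he hw
  obtain ⟨G, hG, hwin⟩ := hw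
  set L := joined i (nextTerms k i s.1 A.forms.length s.2.2 A.ogroups) with hL
  obtain ⟨G', h1, h2⟩ := h.target_extension s.1 L hG
  have hlegal := legal_addrMove hΓ (hs.target_eq _ _ h1) σ
  refine ⟨G', h1, ?_⟩
  rw [via_extension ha] at hwin
  have hk := h.2.1
  have hcase : (∃ b, extension k i s.1 L a = [.inl (decide (k = 3), b)] ∧ (k = 3 ∨ k = 4)) ∨
      (extension k i s.1 L a = [.inr L] ∧ k = 7) := by
    simp only [extension] at he ⊢
    split_ifs at he ⊢ with g1 g2 g3 g4 g5
    · simp at he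
    · exact Or.inl ⟨false, rfl, by omega⟩
    · omega
    · exact Or.inr ⟨rfl, by omega⟩
    · exact Or.inl ⟨true, rfl, by omega⟩
    · simp at he
  obtain ⟨hi, -, -, ⟨s3, s4, -, -, s7⟩, -⟩ := id h
  rcases hcase with ⟨b, hext, hk34⟩ | ⟨hext, rfl⟩
  · rw [← hL, hext, addrMove_singleton] at hwin
    rw [hext, target] at h2
    have hp : parent k i a = i := by
      have hai : a = i ∨ a = i + 1 := by
        by_contra hne
        rw [not_or] at hne
        simp only [extension, if_neg hne.1, hne.2, false_and, if_false, ite_self] at hext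
        exact absurd hext (by simp)
      simp only [parent]
      split_ifs <;> omega
    rw [hp] at h1 hwin hlegal ⊢
    rw [h1] at s3 s4
    rcases hk34 with rfl | rfl
    · obtain ⟨E, rfl⟩ := eq_corecur_of_toNat (s3 rfl).2.2
      cases h2
      have h3 : Run.via (stepMove σ (.inl (decide (3 = 3), b)))
          (Run.via (addrMove σ (s.2.1.getD i [])) Γ) ∈ ((Formula.corecur E).interp I).Lr :=
        legal_stepMove hlegal rfl σ
      obtain ⟨x, hx, hx'⟩ := (wn_corecur h3).1 hwin
      -- The winning thread of the half, with the bit of the half put in front, is a winning thread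
      -- of the whole.
      refine (wn_corecur hlegal).2 ⟨fun n => Nat.casesOn n b x, ?_, ?_⟩
      · refine ((Set.finite_singleton 0).union (hx.image Nat.succ)).subset fun n hn => ?_
        cases n with
        | zero => exact Or.inl rfl
        | succ n => exact Or.inr ⟨n, hn, rfl⟩
      · rw [Run.via_via] at hx'
        simp only [decide_true, stepMove, halfMove_threadMove] at hx'
        exact hx'
    · have h4 := s4 rfl
      rw [eq_comm, Option.bind_eq_some_iff] at h4
      obtain ⟨E, -, h4⟩ := h4
      rw [Option.map_eq_some_iff] at h4
      obtain ⟨H, -, rfl⟩ := h4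
      have h5 : (if b then H else E) = G := by simpa [stepForm, target] using h2
      subst h5
      refine (wn_disj hlegal).2 ⟨b, ?_⟩
      rw [interp_pick]
      exact hwin
  · rw [← hL, hext, addrMove_singleton] at hwin
    rw [hext, target] at h2
    have hai : a = i := by
      simp only [extension] at hext
      split_ifs at hext <;> simp_all
    subst hai
    have hp : parent 7 a a = a := by simp [parent]
    rw [hp] at h1 hwin hlegal ⊢
    rw [h1, hG] at s7
    cases s7 rfl
    exact (wn_corecur hlegal).2 ⟨_, essFinite_interleave hσ L, hwin⟩

/-- Only two rules need more than `RuleOk.wonAt`. A conjunction requires two undergroups of the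
premise; a recurrence requires the premise for many assignments, whence the quantification over
assignments in `Won`. -/
theorem RuleOk.won {k i : ℕ} {A C : Cirquent} (h : RuleOk k i A C) {F : Formula} {s : Annot}
    (hs : Fits F C s) {I : Interpretation} {Γ : Run} (hΓ : Γ ∈ (F.interp I).Lr)
    (hw : Won I A (nextAnnot k i A s) Γ) : Won I C s Γ := by
  obtain ⟨hi, -, -, ⟨-, -, s5, s6, -⟩, -, -, hunder⟩ := id h
  intro σ hσ U hU
  by_cases hk5 : k = 5
  · subst hk5
    -- The premise undergroup without one conjunct yields either a won oformula that survives in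
    -- `U`, or victory in the other conjunct.
    have key : ∀ b ∈ [i, i + 1], (∃ a < C.forms.length, InGroup U a ∧ WonAt I C s Γ σ a) ∨
        ∃ c, (c = i ∨ c = i + 1) ∧ c ≠ b ∧ c < A.forms.length ∧ InGroup U (parent 5 i c) ∧
          WonAt I A (nextAnnot 5 i A s) Γ σ c := by
      intro b hb
      obtain ⟨X, hX, hXb, hXU⟩ := hunder U hU b hb
      obtain ⟨a, ha, haX, hwa⟩ := hw σ hσ X hX
      by_cases hai : a = i ∨ a = i + 1
      · refine Or.inr ⟨a, hai, ?_, ha, hXU a ha haX, hwa⟩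
        rintro rfl
        exact hXb haX
      · rw [not_or] at hai
        exact Or.inl ⟨_, h.parent_lt ha, hXU a ha haX,
          h.wonAt hs hΓ hσ ha (Or.inr hai) (Or.inl (by decide)) hwa⟩
    rcases key i (by simp) with h1 | ⟨c, hc, hcb, hcA, hcU, hcw⟩
    · exact h1
    rcases key (i + 1) (by simp) with h1 | ⟨d, hd, hdb, hdA, hdU, hdw⟩
    · exact h1
    obtain rfl : c = i + 1 := hc.resolve_left hcb
    obtain rfl : d = i := hd.resolve_right hdb
    have hp : parent 5 d d = d := by simp [parent]
    have hp' : parent 5 d (d + 1) = d := by simp [parent]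
    have hd' := h.parent_lt hdA
    rw [hp] at hd' hdU
    refine ⟨d, hd', hdU, ?_⟩
    obtain ⟨E, hE, hEw⟩ := hdw
    obtain ⟨H, hH, hHw⟩ := hcw
    have h1 := s5 rfl
    rw [hE, hH] at h1
    have h1 : C.forms[d]? = some (.conj E H) := h1
    refine ⟨_, h1, (wn_conj (legal_addrMove hΓ (hs.target_eq _ _ h1) σ)).2 fun b => ?_⟩
    rw [interp_pick]
    cases b
    · rw [via_extension hdA, hp] at hEw
      simpa [extension, addrMove_singleton, stepMove] using hEw
    · rw [via_extension hcA, hp'] at hHw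
      simpa [extension, addrMove_singleton, stepMove] using hHw
  · obtain ⟨X, hX, -, hXU⟩ := hunder U hU A.forms.length (by simp [avoid, hk5])
    by_cases hk6 : k = 6
    · subst hk6
      have hp : ∀ a, parent 6 i a = a := fun a => by simp [parent]
      by_cases hex : ∃ a < C.forms.length, InGroup U a ∧ WonAt I C s Γ σ a
      · exact hex
      -- Let no oformula of `U` be won under `σ`. Addresses in the conclusion contain only variables
      -- below `s.1`, so changing the value of the fresh variable `s.1` makes none of them won. For
      -- every value, the victory in `X` must therefore come from the oformula number `i`.
      have key : ∀ x, EssFinite x → i < A.forms.length ∧ InGroup X i ∧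
          WonAt I A (nextAnnot 6 i A s) Γ (Function.update σ s.1 x) i := by
        intro x hx
        have hσ' : ∀ v, EssFinite (Function.update σ s.1 x v) := by
          intro v
          by_cases hv : v = s.1
          · subst hv; simpa using hx
          · simpa [hv] using hσ v
        obtain ⟨a, ha, haX, hwa⟩ := hw _ hσ' X hX
        by_cases hai : a = i
        · subst hai
          exact ⟨ha, haX, hwa⟩
        · exfalso
          have h1 := h.wonAt hs hΓ hσ' ha (Or.inl (by decide)) (Or.inr hai) hwa
          have h2 := h.parent_lt ha
          refine hex ⟨_, h2, hXU a ha haX, ?_⟩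
          obtain ⟨G, hG, hwG⟩ := h1
          refine ⟨G, hG, ?_⟩
          rw [addrMove_eq_of_vars (τ := σ)] at hwG
          · exact hwG
          · intro v hv
            obtain ⟨y, hy, -, hvy⟩ := (hs.vars _ h2 v).1 hv
            have := hs.lt y hy v hvy
            rw [Function.update_of_ne (by omega)]
      obtain ⟨hiA, hiX, -⟩ := key (fun _ => false) (by simp [EssFinite])
      have hiU := hXU i hiA hiX
      have hiC := h.parent_lt hiA
      rw [hp] at hiU hiC
      refine ⟨i, hiC, hiU, ?_⟩
      obtain ⟨E, hE⟩ : ∃ E, A.forms[i]? = some E := ⟨_, List.getElem?_eq_getElem hiA⟩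
      have h1 := s6 rfl
      rw [hE] at h1
      have h1 : C.forms[i]? = some (.recur E) := h1
      refine ⟨_, h1, (wn_recur (legal_addrMove hΓ (hs.target_eq _ _ h1) σ)).2 fun x hx => ?_⟩
      obtain ⟨-, -, E', hE', hwE⟩ := key x hx
      rw [hE] at hE'
      cases hE'
      rw [via_extension hiA, hp, addrMove_eq_of_vars (τ := σ) (A := s.2.1.getD i [])] at hwE
      · simpa [extension, addrMove_singleton, stepMove, interleave_singleton] using hwE
      · intro v hv
        obtain ⟨y, hy, -, hvy⟩ := (hs.vars _ hiC v).1 hv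
        have := hs.lt y hy v hvy
        rw [Function.update_of_ne (by omega)]
    · obtain ⟨a, ha, haX, hwa⟩ := hw σ hσ X hX
      exact ⟨_, h.parent_lt ha, hXU a ha haX,
        h.wonAt hs hΓ hσ ha (Or.inl hk5) (Or.inl hk6) hwa⟩

/-! ### Every inference is recognized -/

theorem getElem?_swapAt {α : Type} {i : ℕ} {l : List α} (h : i + 1 < l.length) (a : ℕ) :
    (swapAt i l)[a]? = l[parent 1 i a]? := by
  induction i generalizing l a with
  | zero =>
    match l, h with
    | x :: y :: l, _ => rcases a with _ | _ | a <;> simp [swapAt, parent]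
  | succ i ih =>
    match l, h with
    | x :: l, h =>
      cases a with
      | zero => simp [swapAt, parent]
      | succ a =>
        rw [swapAt, List.getElem?_cons_succ, ih (by simpa using h)]
        simp only [parent, if_true, Nat.add_right_cancel_iff]
        split_ifs <;> simp

theorem parent_eq_of_dup {k : ℕ} (hk : 3 ≤ k ∧ k ≤ 5) (i a : ℕ) :
    parent k i a = if a ≤ i then a else a - 1 := by
  simp only [parent]
  rw [if_neg (by omega), if_neg (by omega), if_pos hk]

theorem getElem?_dupAt {α : Type} {i : ℕ} {l : List α} (h : i < l.length) (a : ℕ) :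
    (dupAt i l)[a]? = l[if a ≤ i then a else a - 1]? := by
  induction i generalizing l a with
  | zero =>
    match l, h with
    | x :: l, _ => rcases a with _ | _ | a <;> simp [dupAt]
  | succ i ih =>
    match l, h with
    | x :: l, h =>
      cases a with
      | zero => simp [dupAt]
      | succ a =>
        rw [dupAt, List.getElem?_cons_succ, ih (by simpa using h)]
        rcases a with _ | a
        · simp
        · simp only [Nat.add_le_add_iff_right, Nat.add_sub_cancel]
          split_ifs <;> simp

theorem length_dupAt {α : Type} {i : ℕ} {l : List α} (h : i < l.length) :
    (dupAt i l).length = l.length + 1 := by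
  induction i generalizing l with
  | zero =>
    match l, h with
    | x :: l, _ => simp [dupAt]
  | succ i ih =>
    match l, h with
    | x :: l, h => simp [dupAt, ih (by simpa using h : i < l.length)]

theorem getElem?_split {α : Type} (l r : List α) (x y z : α) (a : ℕ) :
    a = l.length ∨ a = l.length + 1 ∨
      (l ++ x :: y :: r)[a]? = (l ++ z :: r)[if a ≤ l.length then a else a - 1]? := by
  rcases lt_trichotomy a l.length with h | h | h
  · refine Or.inr (Or.inr ?_)
    rw [if_pos h.le, List.getElem?_append_left h, List.getElem?_append_left h]
  · exact Or.inl h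
  · rcases Nat.lt_or_ge (l.length + 1) a with h' | h'
    · obtain ⟨b, rfl⟩ : ∃ b, a = l.length + (b + 2) := ⟨a - l.length - 2, by omega⟩
      refine Or.inr (Or.inr ?_)
      rw [if_neg (by omega), List.getElem?_append_right (by omega),
        List.getElem?_append_right (by omega)]
      simp
    · exact Or.inr (Or.inl (by omega))

theorem getElem?_middle {α : Type} (l r : List α) (x z : α) (a : ℕ) :
    a = l.length ∨ (l ++ x :: r)[a]? = (l ++ z :: r)[a]? := by
  rcases lt_trichotomy a l.length with h | h | h
  · exact Or.inr (by rw [List.getElem?_append_left h, List.getElem?_append_left h])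
  · exact Or.inl h
  · obtain ⟨b, rfl⟩ : ∃ b, a = l.length + (b + 1) := ⟨a - l.length - 1, by omega⟩
    refine Or.inr ?_
    rw [List.getElem?_append_right (by omega), List.getElem?_append_right (by omega)]
    simp

theorem swapAt_append {α : Type} (l r : List α) (x y : α) :
    swapAt l.length (l ++ x :: y :: r) = l ++ y :: x :: r := by
  induction l with
  | nil => rfl
  | cons z l ih => simp [swapAt, ih]

/-- The rules that leave the oformulas as they are. -/
theorem ruleOk_zero {Fs : List Formula} {U V O Q : List Group}
    (hover : ∀ Y ∈ Q, ∀ a, InGroup Y a →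
      ∃ X ∈ O, InGroup X a ∧ ∀ b, InGroup X b → InGroup Y b)
    (hunder : ∀ Y ∈ V, ∃ X ∈ U, X.length = Fs.length ∧ ∀ b, InGroup X b → InGroup Y b) :
    RuleOk 0 0 ⟨Fs, U, O⟩ ⟨Fs, V, Q⟩ := by
  have hp : ∀ a, parent 0 0 a = a := fun a => by simp [parent]
  refine ⟨by simp, by simp, fun a _ => Or.inr (Or.inr (by rw [hp])), by simp [SplitOk], ?_,
    by simp, ?_⟩
  · intro Y hY a _ ha
    obtain ⟨X, hX, h1, h2⟩ := hover Y hY a (by rwa [hp] at ha)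
    exact ⟨X, hX, h1, fun b _ hb => Or.inr (by rw [hp]; exact h2 b hb)⟩
  · intro Y hY b hb
    obtain ⟨X, hX, h1, h2⟩ := hunder Y hY
    refine ⟨X, hX, ?_, fun a _ ha => by rw [hp]; exact h2 a ha⟩
    obtain rfl : b = Fs.length := by simpa [avoid] using hb
    simp [InGroup, ← h1]

/-- The rules that split an oformula in two. -/
theorem ruleOk_dup {k : ℕ} (hk : 3 ≤ k ∧ k ≤ 5) {Fs Gs : List Formula} {D E H : Formula}
    {U V O : List Group} (hO : ∀ Y ∈ O, Y.length = (Fs ++ D :: Gs).length)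
    (hsplit : SplitOk k (some D) (some E) (some H))
    (hunder : ∀ Y ∈ V, ∀ b ∈ avoid k Fs.length (Fs ++ E :: H :: Gs).length,
      ∃ X ∈ U, ¬ InGroup X b ∧ ∀ a, InGroup X a → InGroup Y (parent k Fs.length a)) :
    RuleOk k Fs.length ⟨Fs ++ E :: H :: Gs, U, O.map (dupAt Fs.length)⟩
      ⟨Fs ++ D :: Gs, V, O⟩ := by
  have hdup : ∀ Y ∈ O, ∀ a, InGroup (dupAt Fs.length Y) a ↔ InGroup Y (parent k Fs.length a) := by
    intro Y hY a
    rw [InGroup, getElem?_dupAt (by rw [hO Y hY]; simp), parent_eq_of_dup hk]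
  refine ⟨by simp, by omega, fun a _ => ?_, by simpa using hsplit, ?_, by omega, ?_⟩
  · rcases getElem?_split Fs Gs E H D a with h | h | h
    · exact Or.inl ⟨h, hk.1⟩
    · exact Or.inr (Or.inl ⟨h, hk⟩)
    · exact Or.inr (Or.inr (by rw [parent_eq_of_dup hk]; exact h))
  · intro Y hY a _ ha
    exact ⟨_, List.mem_map_of_mem hY, (hdup Y hY a).2 ha, fun b _ hb => Or.inr ((hdup Y hY b).1 hb)⟩
  · intro Y hY b hb
    obtain ⟨X, hX, h1, h2⟩ := hunder Y hY b hb
    exact ⟨X, hX, h1, fun a _ ha => h2 a ha⟩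

theorem avoid_dup {k : ℕ} (hk : 3 ≤ k ∧ k ≤ 4) {Fs Gs : List Formula} {D E H : Formula}
    {U : List Group} (hU : ∀ Y ∈ U, Y.length = (Fs ++ D :: Gs).length) :
    ∀ Y ∈ U, ∀ b ∈ avoid k Fs.length (Fs ++ E :: H :: Gs).length,
      ∃ X ∈ U.map (dupAt Fs.length), ¬ InGroup X b ∧
        ∀ a, InGroup X a → InGroup Y (parent k Fs.length a) := by
  intro Y hY b hb
  have hlt : Fs.length < Y.length := by rw [hU Y hY]; simp
  refine ⟨_, List.mem_map_of_mem hY, ?_, fun a ha => ?_⟩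
  · rw [avoid, if_neg (by omega), List.mem_singleton] at hb
    rw [InGroup, List.getElem?_eq_none]
    · simp
    · rw [hb, length_dupAt hlt, hU Y hY]
      simp
  · rw [InGroup, getElem?_dupAt hlt] at ha
    rwa [parent_eq_of_dup (by omega)]

theorem exists_of_forall₂ {α β : Type} {R : α → β → Prop} {l : List α} {r : List β}
    (h : List.Forall₂ R l r) {y : β} (hy : y ∈ r) : ∃ x ∈ l, R x y := by
  induction h with
  | nil => simp at hy
  | cons h1 _ ih =>
    rcases List.mem_cons.1 hy with rfl | hy
    · exact ⟨_, List.mem_cons_self, h1⟩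
    · obtain ⟨x, hx, h2⟩ := ih hy
      exact ⟨x, List.mem_cons_of_mem _ hx, h2⟩

theorem inGroup_lt {X : Group} {a : ℕ} (h : InGroup X a) : a < X.length :=
  (List.getElem?_eq_some_iff.1 h).1

/-- `RuleOk` asks for less than the rules provide, so all rules that leave the oformulas alone fall
under one kind. Well-formedness enters through the lengths of the groups. -/
theorem exists_ruleOk {A C : Cirquent} (h : Infer A C) (hA : A.WellFormed) (hC : C.WellFormed) :
    ∃ k < 8, ∃ i ≤ C.forms.length, RuleOk k i A C := by
  have hrefl : ∀ (O : List Group), ∀ Y ∈ O, ∀ a, InGroup Y a →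
      ∃ X ∈ O, InGroup X a ∧ ∀ b, InGroup X b → InGroup Y b :=
    fun O Y hY a ha => ⟨Y, hY, ha, fun _ h => h⟩
  have hAu := hA.under_group
  have hAo := hA.over_group
  have hCu := hC.under_group
  have hCo := hC.over_group
  cases h with
  | oformulaExchange Fs Gs E F U O =>
    have hlen : ∀ (X : Group), X.length = (Fs ++ E :: F :: Gs).length →
        ∀ a, InGroup (swapAt Fs.length X) (parent 1 Fs.length a) ↔ InGroup X a := by
      intro X hX a
      rw [InGroup, getElem?_swapAt (by rw [hX]; simp)]
      have : parent 1 Fs.length (parent 1 Fs.length a) = a := by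
        simp only [parent, if_true]
        split_ifs <;> omega
      rw [this]
    refine ⟨1, by omega, Fs.length, by simp, by simp, by omega, fun a _ => ?_, by simp [SplitOk],
      ?_, by omega, ?_⟩
    · refine Or.inr (Or.inr ?_)
      change (Fs ++ E :: F :: Gs)[a]? = (Fs ++ F :: E :: Gs)[parent 1 Fs.length a]?
      rw [← getElem?_swapAt (by simp), swapAt_append]
    · intro Y hY a _ ha
      obtain ⟨X, hX, rfl⟩ := List.mem_map.1 hY
      have hX' := (hAo X hX).1
      exact ⟨X, hX, (hlen X hX' a).1 ha, fun b _ hb => Or.inr ((hlen X hX' b).2 hb)⟩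
    · intro Y hY b hb
      obtain ⟨X, hX, rfl⟩ := List.mem_map.1 hY
      have hX' := (hAu X hX).1
      refine ⟨X, hX, ?_, fun a _ ha => (hlen X hX' a).2 ha⟩
      simp only [avoid, if_neg (by omega : ¬ 1 = 5), List.mem_singleton] at hb
      intro h
      have := inGroup_lt h
      simp only at hX'
      omega
  | underExchange Fs U V X Y O =>
    refine ⟨0, by omega, 0, by simp, ruleOk_zero (hrefl O) fun Z hZ => ⟨Z, ?_, (hCu Z hZ).1, ?_⟩⟩
    · simp only [List.mem_append, List.mem_cons] at hZ ⊢
      tauto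
    · exact fun _ h => h
  | overExchange Fs U O Q X Y =>
    refine ⟨0, by omega, 0, by simp, ruleOk_zero (fun Z hZ a ha => ⟨Z, ?_, ha, fun _ h => h⟩)
      fun Z hZ => ⟨Z, hZ, (hCu Z hZ).1, fun _ h => h⟩⟩
    simp only [List.mem_append, List.mem_cons] at hZ ⊢
    tauto
  | underDuplication Fs U V X O =>
    refine ⟨0, by omega, 0, by simp, ruleOk_zero (hrefl O) fun Z hZ => ⟨Z, ?_, (hCu Z hZ).1, ?_⟩⟩
    · simp only [List.mem_append, List.mem_cons] at hZ ⊢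
      tauto
    · exact fun _ h => h
  | overDuplication Fs U O Q X =>
    refine ⟨0, by omega, 0, by simp, ruleOk_zero (fun Z hZ a ha => ⟨Z, ?_, ha, fun _ h => h⟩)
      fun Z hZ => ⟨Z, hZ, (hCu Z hZ).1, fun _ h => h⟩⟩
    simp only [List.mem_append, List.mem_cons] at hZ ⊢
    tauto
  | merging Fs U O Q X Y =>
    refine ⟨0, by omega, 0, by simp, ruleOk_zero (fun Z hZ a ha => ?_)
      fun Z hZ => ⟨Z, hZ, (hCu Z hZ).1, fun _ h => h⟩⟩
    have hX := (hAo X (by simp)).1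
    have hY := (hAo Y (by simp)).1
    have key : ∀ b, InGroup (List.zipWith or X Y) b ↔ InGroup X b ∨ InGroup Y b := by
      intro b
      simp only [InGroup, List.getElem?_zipWith]
      by_cases hb : b < X.length
      · have hb' : b < Y.length := by omega
        rw [List.getElem?_eq_getElem hb, List.getElem?_eq_getElem hb']
        simp
      · rw [List.getElem?_eq_none (by omega : X.length ≤ b),
          List.getElem?_eq_none (by omega : Y.length ≤ b)]
        simp
    simp only [List.mem_append, List.mem_cons] at hZ
    rcases hZ with hZ | rfl | hZ
    · exact ⟨Z, by simp [hZ], ha, fun _ h => h⟩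
    -- A member of the union lies in one of the merged overgroups, and both are mapped into the
    -- union.
    · rcases (key a).1 ha with h | h
      · exact ⟨X, by simp, h, fun b hb => (key b).2 (Or.inl hb)⟩
      · exact ⟨Y, by simp, h, fun b hb => (key b).2 (Or.inr hb)⟩
    · exact ⟨Z, by simp [hZ], ha, fun _ h => h⟩
  | weakeningArc Fs U V X O i hi hX h =>
    refine ⟨0, by omega, 0, by simp, ruleOk_zero (hrefl O) fun Z hZ => ?_⟩
    simp only [List.mem_append, List.mem_cons] at hZ
    rcases hZ with hZ | rfl | hZ
    · exact ⟨Z, by simp [hZ], (hCu Z (by simp [hZ])).1, fun _ h => h⟩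
    · refine ⟨Z.set i false, by simp, (hAu _ (by simp)).1, fun b hb => ?_⟩
      by_cases hib : i = b
      · subst hib
        exact hi
      · rwa [InGroup, List.getElem?_set_ne hib] at hb
    · exact ⟨Z, by simp [hZ], (hCu Z (by simp [hZ])).1, fun _ h => h⟩
  | weakeningDelete Fs U V X O i hi hX h =>
    have hlt : i < Fs.length := by
      have := (hCu X (by simp)).1
      have h2 := inGroup_lt hi
      simp only at this
      omega
    have herase : ∀ (Y : Group) a, InGroup (Y.eraseIdx i) a ↔ InGroup Y (parent 2 i a) := by
      intro Y a
      simp only [InGroup, List.getElem?_eraseIdx, parent]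
      split_ifs <;> first | rfl | omega
    refine ⟨2, by omega, i, hlt.le, by omega, by omega, fun a _ => ?_, by simp [SplitOk], ?_,
      by omega, ?_⟩
    · refine Or.inr (Or.inr ?_)
      change (Fs.eraseIdx i)[a]? = _
      simp only [List.getElem?_eraseIdx, parent]
      split_ifs <;> first | rfl | omega
    · intro Y hY a _ ha
      have ha' := (herase Y a).2 ha
      -- The filter removes only overgroups that have become empty, and this one still contains `a`.
      refine ⟨Y.eraseIdx i, List.mem_filter.2 ⟨List.mem_map_of_mem hY, ?_⟩, ha',
        fun b _ hb => Or.inr ((herase Y b).1 hb)⟩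
      simpa using List.mem_of_getElem? ha'
    · intro Y hY b hb
      refine ⟨Y.eraseIdx i, List.mem_map_of_mem (f := fun Y : Group => Y.eraseIdx i) hY, ?_,
        fun a _ ha => (herase Y a).1 ha⟩
      simp only [avoid, if_neg (by omega : ¬ 2 = 5), List.mem_singleton] at hb
      intro h
      have h1 := inGroup_lt h
      have h2 := (hAu _ (List.mem_map_of_mem (f := fun Y : Group => Y.eraseIdx i) hY)).1
      simp only at h2
      omega
  | contraction Fs Gs F U O =>
    refine ⟨3, by omega, Fs.length, by simp, ruleOk_dup (by omega) (fun Y hY => (hCo Y hY).1) ?_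
      (avoid_dup (by omega) fun Y hY => (hCu Y hY).1)⟩
    refine ⟨fun _ => ⟨rfl, rfl, ?_⟩, by simp, by simp, by simp, by simp⟩
    simp only [Option.elim, Formula.toNat]
    omega
  | disjIntro Fs Gs E F U O =>
    exact ⟨4, by omega, Fs.length, by simp, ruleOk_dup (by omega) (fun Y hY => (hCo Y hY).1)
      (by simp [SplitOk]) (avoid_dup (by omega) fun Y hY => (hCu Y hY).1)⟩
  | conjIntro Fs Gs E F U O =>
    refine ⟨5, by omega, Fs.length, by simp, ruleOk_dup (by omega) (fun Y hY => (hCo Y hY).1)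
      (by simp [SplitOk]) fun Y hY b hb => ?_⟩
    have hlt : Fs.length < Y.length := by rw [(hCu Y hY).1]; simp
    have hdup : ∀ a, InGroup (dupAt Fs.length Y) a ↔ InGroup Y (parent 5 Fs.length a) := by
      intro a
      rw [InGroup, getElem?_dupAt hlt, parent_eq_of_dup (by omega)]
    have hset : ∀ c a, InGroup ((dupAt Fs.length Y).set c false) a →
        a ≠ c ∧ InGroup Y (parent 5 Fs.length a) := by
      intro c a ha
      by_cases hca : c = a
      · subst hca
        rw [InGroup, List.getElem?_set_self'] at ha
        cases hd : (dupAt Fs.length Y)[c]? <;> simp [hd] at ha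
      · rw [InGroup, List.getElem?_set_ne hca] at ha
        exact ⟨fun h => hca h.symm, (hdup a).1 ha⟩
    have hb' : b = Fs.length ∨ b = Fs.length + 1 := by simpa [avoid] using hb
    have hpb : parent 5 Fs.length b = Fs.length := by
      rw [parent_eq_of_dup (by omega)]
      split_ifs <;> omega
    by_cases hY' : Y[Fs.length]? = some true
    -- Of the two undergroups into which `Y` splits, the one that leaves out the conjunct `b`.
    · refine ⟨(dupAt Fs.length Y).set b false, List.mem_flatMap.2 ⟨Y, hY, ?_⟩,
        fun h => (hset b b h).1 rfl, fun a ha => (hset b a ha).2⟩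
      rw [splitUnder, if_pos hY']
      rcases hb' with rfl | rfl <;> simp
    · refine ⟨dupAt Fs.length Y, List.mem_flatMap.2 ⟨Y, hY, ?_⟩, fun h => ?_,
        fun a ha => (hdup a).1 ha⟩
      · rw [splitUnder, if_neg hY']
        simp
      · rw [hdup, hpb] at h
        exact hY' h
  | recurIntro Fs Gs F U O Q =>
    have hp : ∀ a, parent 6 Fs.length a = a := fun a => by simp [parent]
    refine ⟨6, by omega, Fs.length, by simp, by simp, by omega, fun a _ => ?_, by simp [SplitOk],
      ?_, fun _ => ?_, ?_⟩
    · rw [hp]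
      rcases getElem?_middle Fs Gs F (.recur F) a with h | h
      · exact Or.inl ⟨h, by omega⟩
      · exact Or.inr (Or.inr h)
    · intro Y hY a _ ha
      rw [hp] at ha
      refine ⟨Y, ?_, ha, fun b _ hb => Or.inr (by rwa [hp])⟩
      simp only [List.mem_append, List.mem_cons] at hY ⊢
      tauto
    · refine ⟨soleGroup (Fs ++ F :: Gs).length Fs.length, by simp, ?_, fun a _ ha => ?_⟩
      · rw [InGroup, soleGroup, List.getElem?_set_self]
        simp
      · by_contra hne
        rw [InGroup, soleGroup, List.getElem?_set_ne (Ne.symm hne), List.getElem?_replicate] at ha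
        split_ifs at ha <;> simp at ha
    · intro Y hY b hb
      refine ⟨Y, hY, ?_, fun a _ ha => by rwa [hp]⟩
      simp only [avoid, if_neg (by omega : ¬ 6 = 5), List.mem_singleton] at hb
      intro h
      have h1 := inGroup_lt h
      have h2 := (hAu _ hY).1
      simp only at h2
      omega
  | corecurIntro Fs Gs F U O Q h =>
    have hp : ∀ a, parent 7 Fs.length a = a := fun a => by simp [parent]
    refine ⟨7, by omega, Fs.length, by simp, by simp, by omega, fun a _ => ?_, by simp [SplitOk],
      ?_, by omega, ?_⟩
    · rw [hp]
      rcases getElem?_middle Fs Gs F (.corecur F) a with h | h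
      · exact Or.inl ⟨h, by omega⟩
      · exact Or.inr (Or.inr h)
    · intro Y hY a _ ha
      rw [hp] at ha
      obtain ⟨X, hX, hXY⟩ := exists_of_forall₂ h hY
      refine ⟨X, hX, ?_, fun b _ hb => ?_⟩
      · rcases hXY with rfl | rfl
        · exact ha
        · by_cases hc : Fs.length = a
          · rw [InGroup, ← hc, List.getElem?_set_self]
            rw [hc]
            exact inGroup_lt ha
          · rwa [InGroup, List.getElem?_set_ne hc]
      · rw [hp]
        rcases hXY with rfl | rfl
        · exact Or.inr hb
        · by_cases hc : Fs.length = b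
          -- The membership that the rule may have added in the premise is the exception admitted by
          -- `Cover`.
          · exact Or.inl ⟨rfl, hc.symm⟩
          · rw [InGroup, List.getElem?_set_ne hc] at hb
            exact Or.inr hb
    · intro Y hY b hb
      refine ⟨Y, hY, ?_, fun a _ ha => by rwa [hp]⟩
      simp only [avoid, if_neg (by omega : ¬ 7 = 5), List.mem_singleton] at hb
      intro h
      have h1 := inGroup_lt h
      have h2 := (hAu _ hY).1
      simp only at h2
      omega

/-! ### The annotation of a proof -/

/-- The first rule that fits. -/
def findRule (A C : Cirquent) : ℕ × ℕ :=
  (((List.range 8).flatMap fun k => (List.range (C.forms.length + 1)).filterMap fun i =>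
    if RuleOk k i A C then some (k, i) else none).head?).getD (0, 0)

/-- A proof is a bare sequence of cirquents, so the rule must be found by search. Any hit serves,
even if it is not the rule that was meant; the default value is not used, as the search succeeds. -/
theorem findRule_spec {A C : Cirquent} (h : Infer A C) (hA : A.WellFormed) (hC : C.WellFormed) :
    RuleOk (findRule A C).1 (findRule A C).2 A C := by
  obtain ⟨k, hk, i, hi, hr⟩ := exists_ruleOk h hA hC
  set l := (List.range 8).flatMap fun k => (List.range (C.forms.length + 1)).filterMap fun i =>
    if RuleOk k i A C then some (k, i) else none with hl
  have hmem : ∀ x ∈ l, RuleOk x.1 x.2 A C := by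
    intro x hx
    simp only [hl, List.mem_flatMap, List.mem_filterMap] at hx
    obtain ⟨k, -, i, -, hx⟩ := hx
    split_ifs at hx with h1
    cases hx
    exact h1
  have hne : l ≠ [] := by
    refine List.ne_nil_of_mem (a := (k, i)) ?_
    simp only [hl, List.mem_flatMap, List.mem_filterMap, List.mem_range]
    exact ⟨k, hk, i, by omega, by rw [if_pos hr]⟩
  obtain ⟨x, l', hl'⟩ := List.exists_cons_of_ne_nil hne
  have hf : findRule A C = x := by
    rw [findRule, ← hl, hl']
    rfl
  rw [hf]
  exact hmem x (by rw [hl']; exact List.mem_cons_self)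

/-- The annotation of the end of a proof of a formula. -/
def rootAnnot : Annot := (0, [[]], [([true], [])])

/-- Passing from the annotated conclusion to the annotated premise `A`. -/
def annotStep (A : Cirquent) : Option (Annot × Cirquent) → Annot × Cirquent
  | none => (rootAnnot, A)
  | some (s, C) => (nextAnnot (findRule A C).1 (findRule A C).2 A s, A)

/-- The annotation of the first cirquent of a proof. -/
def annotate (P : List Cirquent) : Option (Annot × Cirquent) :=
  P.foldr (fun A o => some (annotStep A o)) none

theorem fits_root (F : Formula) : Fits F F.club rootAnnot := by
  refine ⟨rfl, rfl, ?_, ?_, ?_, ?_⟩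
  · intro a G hG
    cases a with
    | zero => exact hG
    | succ a => simp [Formula.club] at hG
  · intro a ha v
    obtain rfl : a = 0 := by simpa [Formula.club] using ha
    simp [rootAnnot, addrVars]
  · simp [rootAnnot]
  · intro a ha b hb hab
    simp only [Formula.club, List.length_singleton] at ha hb
    omega

/-- Annotations are carried from the end of the proof to its beginning, and victory is carried back
in the opposite direction, one rule at a time. -/
theorem annotate_spec {F : Formula} {P : List Cirquent} {A : Cirquent}
    (hwf : ∀ C ∈ P, C.WellFormed) (hhead : P.head? = some A) (hchain : P.IsChain Infer)
    (hlast : P.getLast? = some F.club) :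
    ∃ s, annotate P = some (s, A) ∧ Fits F A s ∧ ∀ (I : Interpretation) (Γ : Run),
      Γ ∈ (F.interp I).Lr → Won I A s Γ → Won I F.club rootAnnot Γ := by
  induction P generalizing A with
  | nil => simp at hhead
  | cons B P ih =>
    obtain rfl : B = A := by simpa using hhead
    cases P with
    | nil =>
      obtain rfl : B = F.club := by simpa using hlast
      exact ⟨rootAnnot, rfl, fits_root F, fun _ _ _ h => h⟩
    | cons C P =>
      rw [List.isChain_cons_cons] at hchain
      obtain ⟨s, h1, h2, h3⟩ := ih (fun D hD => hwf D (List.mem_cons_of_mem _ hD)) rfl hchain.2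
        (by simpa using hlast)
      have hr := findRule_spec hchain.1 (hwf B (by simp)) (hwf C (by simp))
      refine ⟨nextAnnot (findRule B C).1 (findRule B C).2 B s, ?_, hr.fits h2,
        fun I Γ hΓ hw => h3 I Γ hΓ (hr.won h2 hΓ hw)⟩
      rw [annotate, List.foldr_cons, ← annotate, h1]
      rfl

theorem Formula.neg_neg (F : Formula) : F.neg.neg = F := by
  induction F <;> simp_all [Formula.neg]

theorem getElem?_flatMap_pair (L : List Formula) (a : ℕ) :
    (L.flatMap fun F => [F.neg, F])[a]? =
      L[a / 2]?.map fun F => if a % 2 = 0 then F.neg else F := by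
  induction L generalizing a with
  | nil => simp
  | cons F L ih =>
    rcases a with _ | _ | a
    · simp
    · simp
    · simp only [List.flatMap_cons, List.cons_append, List.nil_append, List.getElem?_cons_succ, ih]
      rw [show (a + 1 + 1) / 2 = a / 2 + 1 by omega, show (a + 1 + 1) % 2 = a % 2 by omega]
      simp

theorem partner_div (a : ℕ) : partner a / 2 = a / 2 := by
  unfold partner
  split_ifs <;> omega

/-- Partners in an axiom belong to the same overgroups, and the variables of an address are those
attached to its overgroups; so partners have the same variables. -/
theorem IsAxiom.paired {F : Formula} {A : Cirquent} {s : Annot} (hA : IsAxiom A)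
    (hs : Fits F A s) : Paired F s.1 s.2.1 := by
  obtain ⟨L, -, hf, hu, ho⟩ := hA
  have hlen : A.forms.length = 2 * L.length := by
    rw [hf]
    simp [Nat.mul_comm]
  have hget : ∀ (a : ℕ) (B : Addr), s.2.1[a]? = some B → a < A.forms.length ∧
      s.2.1.getD a [] = B := by
    intro a B hB
    refine ⟨hs.length_eq ▸ (List.getElem?_eq_some_iff.1 hB).1, ?_⟩
    rw [List.getD_eq_getElem?_getD, hB]
    rfl
  refine ⟨?_, ?_, ?_, ?_⟩
  · intro a B B' hB hB' v hv
    obtain ⟨ha, rfl⟩ := hget a B hB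
    obtain ⟨hb, rfl⟩ := hget _ B' hB'
    rw [hs.vars _ hb] at hv
    rw [hs.vars _ ha]
    obtain ⟨x, hx, hxa, hv⟩ := hv
    refine ⟨x, hx, ?_, hv⟩
    have hxo : x.1 ∈ A.ogroups := hs.fst_eq ▸ List.mem_map_of_mem (f := Prod.fst) hx
    rw [ho, hu, List.mem_map] at hxo
    obtain ⟨j, -, hj⟩ := hxo
    rw [← hj] at hxa ⊢
    simp only [InGroup, List.getElem?_map] at hxa ⊢
    rw [List.getElem?_range (by omega)] at hxa ⊢
    simpa [partner_div] using hxa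
  · intro B hB v hv
    obtain ⟨a, ha⟩ := List.mem_iff_getElem?.1 hB
    obtain ⟨ha', rfl⟩ := hget a B ha
    obtain ⟨x, hx, -, hv⟩ := (hs.vars _ ha' v).1 hv
    exact hs.lt x hx v hv
  · intro a b B B' hB hB' hab
    obtain ⟨ha, rfl⟩ := hget a B hB
    obtain ⟨hb, rfl⟩ := hget b B' hB'
    exact hs.apart a ha b hb hab
  · intro a B B' hB hB'
    obtain ⟨ha, rfl⟩ := hget a B hB
    obtain ⟨hb, rfl⟩ := hget _ B' hB'
    obtain ⟨G, hG⟩ : ∃ G, L[a / 2]? = some G := ⟨_, List.getElem?_eq_getElem (by omega)⟩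
    have h1 := getElem?_flatMap_pair L a
    have h2 := getElem?_flatMap_pair L (partner a)
    rw [← hf, hG] at h1
    rw [← hf, partner_div, hG] at h2
    simp only [Option.map_some] at h1 h2
    by_cases ha2 : a % 2 = 0
    · rw [if_pos ha2] at h1
      rw [if_neg (by unfold partner; split_ifs; omega)] at h2
      refine ⟨_, hs.target_eq _ _ h1, ?_⟩
      rw [hs.target_eq _ _ h2, Formula.neg_neg]
    · rw [if_neg ha2] at h1
      rw [if_pos (by unfold partner; split_ifs; omega)] at h2
      exact ⟨_, hs.target_eq _ _ h1, hs.target_eq _ _ h2⟩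

/-- If `G`, at the odd place, is not won, then `¬G`, at the even place, is won, as its subrun is the
negation of that of `G`. -/
theorem IsAxiom.won {F : Formula} {A : Cirquent} {s : Annot} (hA : IsAxiom A) (hs : Fits F A s)
    {I : Interpretation} {Γ : Run} (hΓ : Γ ∈ (F.interp I).Lr)
    (h : ∀ (σ : ℕ → ℕ → Bool) (a : ℕ) (B B' : Addr), s.2.1[a]? = some B →
      s.2.1[partner a]? = some B' → Γ.via (addrMove σ B) = (Γ.via (addrMove σ B')).neg) :
    Won I A s Γ := by
  obtain ⟨L, -, hf, hu, -⟩ := hA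
  have hlen : A.forms.length = 2 * L.length := by
    rw [hf]
    simp [Nat.mul_comm]
  intro σ _ U hU
  rw [hu, List.mem_map] at hU
  obtain ⟨j, hj, rfl⟩ := hU
  rw [List.mem_range] at hj
  have hin : ∀ a < 2 * L.length, a / 2 = j →
      InGroup ((List.range (2 * L.length)).map fun a => decide (a / 2 = j)) a := by
    intro a ha haj
    simp [InGroup, ha, haj]
  obtain ⟨G, hG⟩ : ∃ G, L[j]? = some G := ⟨_, List.getElem?_eq_getElem hj⟩
  have h1 := getElem?_flatMap_pair L (2 * j)
  have h2 := getElem?_flatMap_pair L (2 * j + 1)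
  rw [← hf, show 2 * j / 2 = j by omega, hG] at h1
  rw [← hf, show (2 * j + 1) / 2 = j by omega, hG] at h2
  simp only [Option.map_some] at h1 h2
  rw [if_pos (by omega)] at h1
  rw [if_neg (by omega)] at h2
  have hg : ∀ a < 2 * L.length, s.2.1[a]? = some (s.2.1.getD a []) := by
    intro a ha
    have : a < s.2.1.length := by rw [hs.length_eq]; omega
    rw [List.getD_eq_getElem?_getD, List.getElem?_eq_getElem this]
    rfl
  have hp : partner (2 * j) = 2 * j + 1 := by simp [partner]
  have h3 := h σ (2 * j) _ _ (hg _ (by omega)) (by rw [hp]; exact hg _ (by omega))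
  by_cases hw : (G.interp I).Wn (Γ.via (addrMove σ (s.2.1.getD (2 * j + 1) []))) = .top
  · exact ⟨2 * j + 1, by omega, hin _ (by omega) (by omega), G, h2, hw⟩
  · refine ⟨2 * j, by omega, hin _ (by omega) (by omega), G.neg, h1, ?_⟩
    have h4 := legal_addrMove hΓ (hs.target_eq _ _ h1) σ
    rw [((dual_interp I G) _).2 h4, h3, Run.neg_neg]
    exact hw

/-- The data of the copycat strategy that is extracted from a proof. -/
def strategyOf (P : List Cirquent) : ℕ × List Addr :=
  (annotate P).elim (0, []) fun x => (x.1.1, x.1.2.1)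

theorem strategyOf_wins {F : Formula} {P : List Cirquent} (hP : IsProof P F)
    {p : ℕ → List LabMove} (h0 : p 0 = [])
    (hs : ∀ i, FollowsBy (respond (strategyOf P) (p i)) (p i) (p (i + 1))) :
    (∀ i, ∃ j ≥ i, respond (strategyOf P) (p j) = none) ∧
      ∀ I, (F.interp I).Wn (limitRun p) = .top := by
  obtain ⟨hwf, ⟨A, hhead, hA⟩, hchain, hlast⟩ := hP
  obtain ⟨s, h1, h2, h3⟩ := annotate_spec hwf hhead hchain hlast
  have hst : strategyOf P = (s.1, s.2.1) := by rw [strategyOf, h1]; rfl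
  rw [hst] at hs ⊢
  obtain ⟨h4, h5, h6⟩ := (hA.paired h2).copycat h0 hs
  refine ⟨h4, fun I => ?_⟩
  rcases h5 I with h7 | h7
  · exact (F.interp I).wn_illegal _ _ h7
  -- The address of `F` in its own cirquent is empty, so any essentially finite assignment will do.
  · obtain ⟨a, ha, -, G, hG, hw⟩ := h3 I _ h7 (hA.won h2 h7 h6) (fun _ _ => false)
      (fun _ => by simp [EssFinite]) [true] (by simp [Formula.club])
    obtain rfl : a = 0 := by simpa [Formula.club] using ha
    cases hG
    have : addrMove (fun _ _ => false) (rootAnnot.2.1.getD 0 []) = some := rfl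
    rwa [this, Run.via_some] at hw

/-! ### The copycat strategy is primitive recursive -/

section Logic

variable {α β : Type*} [Primcodable α] [Primcodable β]

theorem primrecPred_imp {p q : α → Prop} (hp : PrimrecPred p) (hq : PrimrecPred q) :
    PrimrecPred fun a => p a → q a :=
  (hp.not.or hq).of_eq fun _ => imp_iff_not_or.symm

theorem primrecPred_forall_mem {l : α → List β} {p : α → β → Prop} (hl : Primrec l)
    (hp : PrimrecPred fun x : α × β => p x.1 x.2) : PrimrecPred fun a => ∀ b ∈ l a, p a b :=
  (PrimrecRel.forall_mem_list (R := fun b a => p a b)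
    (hp.comp (Primrec.pair Primrec.snd Primrec.fst))).comp hl Primrec.id

theorem primrecPred_forall_lt {n : α → ℕ} {p : α → ℕ → Prop} (hn : Primrec n)
    (hp : PrimrecPred fun x : α × ℕ => p x.1 x.2) : PrimrecPred fun a => ∀ b < n a, p a b :=
  (primrecPred_forall_mem (Primrec.list_range.comp hn) hp).of_eq fun a => by simp

theorem primrecPred_exists_mem {l : α → List β} {p : α → β → Prop} (hl : Primrec l)
    (hp : PrimrecPred fun x : α × β => p x.1 x.2) : PrimrecPred fun a => ∃ b ∈ l a, p a b :=
  (PrimrecRel.exists_mem_list (R := fun b a => p a b)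
    (hp.comp (Primrec.pair Primrec.snd Primrec.fst))).comp hl Primrec.id

theorem primrecPred_mem [DecidableEq β] {l : α → List β} {f : α → β} (hl : Primrec l)
    (hf : Primrec f) : PrimrecPred fun a => f a ∈ l a :=
  (primrecPred_exists_mem (p := fun a b => b = f a) hl
    (Primrec.eq.comp Primrec.snd (hf.comp Primrec.fst))).of_eq fun a => by simp

end Logic

theorem primrec_pow : Primrec₂ ((· ^ ·) : ℕ → ℕ → ℕ) := Primrec₂.unpaired'.1 Nat.Primrec.pow

theorem primrec_oracle : Primrec fun x : ℕ × ℕ × ℕ => oracle x.1 x.2.1 x.2.2 := by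
  have h : Primrec fun x : ℕ × ℕ × ℕ =>
      decide (x.1 / 2 ^ Nat.pair x.2.1 x.2.2 % 2 = 1) :=
    (Primrec.eq.comp (Primrec.nat_mod.comp (Primrec.nat_div.comp Primrec.fst
      (primrec_pow.comp (Primrec.const 2) (Primrec₂.natPair.comp (Primrec.fst.comp Primrec.snd)
        (Primrec.snd.comp Primrec.snd)))) (Primrec.const 2)) (Primrec.const 1)).decide
  exact h.of_eq fun x => (Nat.testBit_eq_decide_div_mod_eq).symm

theorem primrec_interleave :
    Primrec fun x : ℕ × List ℕ × ℕ => interleave (oracle x.1) x.2.1 x.2.2 := by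
  have hL : Primrec fun x : ℕ × List ℕ × ℕ => x.2.1 := Primrec.fst.comp Primrec.snd
  have hn : Primrec fun x : ℕ × List ℕ × ℕ => x.2.2 := Primrec.snd.comp Primrec.snd
  have hlen := Primrec.list_length.comp hL
  have h : Primrec fun x : ℕ × List ℕ × ℕ =>
      ((x.2.1[x.2.2 % x.2.1.length]?).map fun v =>
        oracle x.1 v (x.2.2 / x.2.1.length)).getD false := by
    refine Primrec.option_getD.comp (Primrec.option_map
      (Primrec.list_getElem?.comp hL (Primrec.nat_mod.comp hn hlen)) ?_) (Primrec.const false)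
    exact (primrec_oracle.comp (Primrec.pair (Primrec.fst.comp Primrec.fst)
      (Primrec.pair Primrec.snd ((Primrec.nat_div.comp hn hlen).comp Primrec.fst)))).to₂
  refine h.of_eq fun x => ?_
  rw [interleave]
  cases x.2.1[x.2.2 % x.2.1.length]? <;> rfl

theorem primrec_word :
    Primrec fun x : (ℕ × List ℕ) × ℕ => word (interleave (oracle x.1.1) x.1.2) x.2 := by
  refine Primrec.list_map (Primrec.list_range.comp Primrec.snd) ?_
  refine ((Primrec.dom_bool Key.bit).comp (primrec_interleave.comp (Primrec.pair
    (Primrec.fst.comp (Primrec.fst.comp Primrec.fst)) (Primrec.pair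
      (Primrec.snd.comp (Primrec.fst.comp Primrec.fst)) Primrec.snd)))).to₂

/-- The recursion shifts the bitstring, which is no argument of a primitive recursive function.
Locating the first dot turns it into a comparison of finite words. -/
theorem threadMove_eq_ite (x : ℕ → Bool) (m : Move) : threadMove x m =
    if m.idxOf Key.dot < m.length ∧ m.take (m.idxOf Key.dot) = word x (m.idxOf Key.dot)
    then some (m.drop (m.idxOf Key.dot + 1)) else none := by
  induction m generalizing x with
  | nil => rfl
  | cons c m ih =>
    rw [threadMove]
    by_cases hc : c = Key.dot
    · subst hc
      simp [word]
    · rw [if_neg hc, ih, List.idxOf_cons_ne _ hc, word_succ]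
      by_cases hb : c = Key.bit (x 0)
      · simp [hb]
      · simp [hb]

theorem primrec_threadMove : Primrec fun x : (ℕ × List ℕ) × Move =>
    threadMove (interleave (oracle x.1.1) x.1.2) x.2 := by
  have hi : Primrec fun x : (ℕ × List ℕ) × Move => x.2.idxOf Key.dot :=
    Primrec.list_idxOf.comp (Primrec.const Key.dot) Primrec.snd
  refine (Primrec.ite (PrimrecPred.and (Primrec.nat_lt.comp hi
    (Primrec.list_length.comp Primrec.snd)) (Primrec.eq.comp
      (Primrec.list_take.comp hi Primrec.snd)
      (primrec_word.comp (Primrec.pair Primrec.fst hi))))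
    (Primrec.option_some.comp (Primrec.list_drop.comp (Primrec.succ.comp hi) Primrec.snd))
    (Primrec.const none)).of_eq fun x => (threadMove_eq_ite _ _).symm

theorem stripMove_eq_ite (c d : Key) (m : Move) :
    stripMove [c, d] m = if m.take 2 = [c, d] then some (m.drop 2) else none := by
  rw [stripMove]
  refine if_congr ?_ rfl rfl
  rw [List.prefix_iff_eq_take, eq_comm]
  rfl

theorem primrec_stripMove :
    Primrec fun x : Bool × Move => stripMove [Key.side x.1, Key.dot] x.2 := by
  refine (Primrec.ite (Primrec.eq.comp (Primrec.list_take.comp (Primrec.const 2) Primrec.snd)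
    (Primrec.list_cons.comp ((Primrec.dom_bool Key.side).comp Primrec.fst)
      (Primrec.const [Key.dot])))
    (Primrec.option_some.comp (Primrec.list_drop.comp (Primrec.const 2) Primrec.snd))
    (Primrec.const none)).of_eq fun x => (stripMove_eq_ite _ _ _).symm

theorem primrec_halfMove : Primrec fun x : Bool × Move => halfMove x.1 x.2 := by
  have hh : Primrec fun x : Bool × Move => x.2.head? := Primrec.list_head?.comp Primrec.snd
  refine (Primrec.ite (Primrec.eq.comp hh (Primrec.const (some Key.dot)))
    (Primrec.option_some.comp Primrec.snd)
    (Primrec.ite (Primrec.eq.comp hh (Primrec.option_some.comp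
      ((Primrec.dom_bool Key.bit).comp Primrec.fst)))
      (Primrec.option_some.comp (Primrec.list_tail.comp Primrec.snd))
      (Primrec.const none))).of_eq fun x => ?_
  obtain ⟨b, _ | ⟨c, m⟩⟩ := x <;> simp [halfMove]

theorem primrec_stepMove :
    Primrec fun x : (ℕ × Step) × Move => stepMove (oracle x.1.1) x.1.2 x.2 := by
  have h : Primrec fun x : (ℕ × Step) × Move => (Sum.casesOn x.1.2
      (fun y => bif y.1 then halfMove y.2 x.2 else stripMove [Key.side y.2, Key.dot] x.2)
      (fun L => threadMove (interleave (oracle x.1.1) L) x.2) : Option Move) := by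
    refine Primrec.sumCasesOn (Primrec.snd.comp Primrec.fst) ?_ ?_
    · have hp : Primrec fun x : ((ℕ × Step) × Move) × (Bool × Bool) => (x.2.2, x.1.2) :=
        Primrec.pair (Primrec.snd.comp Primrec.snd) (Primrec.snd.comp Primrec.fst)
      exact (Primrec.cond (Primrec.fst.comp Primrec.snd) (primrec_halfMove.comp hp)
        (primrec_stripMove.comp hp)).to₂
    · exact (primrec_threadMove.comp (Primrec.pair (Primrec.pair
        (Primrec.fst.comp (Primrec.fst.comp Primrec.fst)) Primrec.snd)
        (Primrec.snd.comp Primrec.fst))).to₂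
  refine h.of_eq fun x => ?_
  obtain ⟨⟨r, ⟨_ | _, b⟩ | L⟩, m⟩ := x <;> rfl

/-- The recursion changes the move on the way; as a left fold that carries an optional move it is
primitive recursive. -/
theorem addrMove_eq_foldl (σ : ℕ → ℕ → Bool) (A : Addr) (m : Move) :
    addrMove σ A m = A.foldl (fun o s => o.bind (stepMove σ s)) (some m) := by
  have hnone : ∀ A : Addr, A.foldl (fun o s => o.bind (stepMove σ s)) none = none := by
    intro A
    induction A with
    | nil => rfl
    | cons s A ih => exact ih
  induction A generalizing m with
  | nil => rfl
  | cons s A ih =>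
    rw [addrMove, List.foldl_cons, Option.bind_some]
    cases stepMove σ s m with
    | none => exact (hnone A).symm
    | some m' => exact ih m'

theorem primrec_addrMove :
    Primrec fun x : (ℕ × Addr) × Move => addrMove (oracle x.1.1) x.1.2 x.2 := by
  have h : Primrec fun x : (ℕ × Addr) × Move =>
      x.1.2.foldl (fun o s => o.bind (stepMove (oracle x.1.1) s)) (some x.2) := by
    refine Primrec.list_foldl (h := fun (x : (ℕ × Addr) × Move) (y : Option Move × Step) =>
        y.1.bind (stepMove (oracle x.1.1) y.2)) (Primrec.snd.comp Primrec.fst)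
      (Primrec.option_some.comp Primrec.snd) ?_
    refine Primrec₂.mk (Primrec.option_bind (Primrec.fst.comp Primrec.snd) (Primrec₂.mk ?_))
    exact primrec_stepMove.comp (Primrec.pair (Primrec.pair
      (Primrec.fst.comp (Primrec.fst.comp (Primrec.fst.comp Primrec.fst)))
      (Primrec.snd.comp (Primrec.snd.comp Primrec.fst))) Primrec.snd)
  exact h.of_eq fun x => (addrMove_eq_foldl _ _ _).symm

theorem primrec_stepBuild :
    Primrec fun x : (ℕ × ℕ) × Step × Move => stepBuild (oracle x.1.1) x.1.2 x.2.1 x.2.2 := by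
  have h : Primrec fun x : (ℕ × ℕ) × Step × Move => (Sum.casesOn x.2.1
      (fun y => bif y.1 then Key.bit y.2 :: x.2.2 else Key.side y.2 :: Key.dot :: x.2.2)
      (fun L => word (interleave (oracle x.1.1) L) (x.1.2 * (L.length + 1)) ++
        Key.dot :: x.2.2) : Move) := by
    refine Primrec.sumCasesOn (Primrec.fst.comp Primrec.snd) ?_ ?_
    · have hm : Primrec fun x : ((ℕ × ℕ) × Step × Move) × (Bool × Bool) => x.1.2.2 :=
        Primrec.snd.comp (Primrec.snd.comp Primrec.fst)
      have hb : Primrec fun x : ((ℕ × ℕ) × Step × Move) × (Bool × Bool) => x.2.2 :=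
        Primrec.snd.comp Primrec.snd
      exact (Primrec.cond (Primrec.fst.comp Primrec.snd)
        (Primrec.list_cons.comp ((Primrec.dom_bool Key.bit).comp hb) hm)
        (Primrec.list_cons.comp ((Primrec.dom_bool Key.side).comp hb)
          (Primrec.list_cons.comp (Primrec.const Key.dot) hm))).to₂
    · exact (Primrec.list_append.comp (primrec_word.comp (Primrec.pair (Primrec.pair
        (Primrec.fst.comp (Primrec.fst.comp Primrec.fst)) Primrec.snd)
        (Primrec.nat_mul.comp (Primrec.snd.comp (Primrec.fst.comp Primrec.fst))
          (Primrec.succ.comp (Primrec.list_length.comp Primrec.snd)))))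
        (Primrec.list_cons.comp (Primrec.const Key.dot)
          (Primrec.snd.comp (Primrec.snd.comp Primrec.fst)))).to₂
  refine h.of_eq fun x => ?_
  obtain ⟨⟨r, k⟩, ⟨_ | _, b⟩ | L, m⟩ := x <;> rfl

theorem primrec_build :
    Primrec fun x : (ℕ × ℕ) × Addr × Move => build (oracle x.1.1) x.1.2 x.2.1 x.2.2 :=
  Primrec.list_foldr (h := fun (x : (ℕ × ℕ) × Addr × Move) (y : Step × Move) =>
      stepBuild (oracle x.1.1) x.1.2 y.1 y.2) (Primrec.fst.comp Primrec.snd)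
    (Primrec.snd.comp Primrec.snd)
    (primrec_stepBuild.comp (Primrec.pair (Primrec.fst.comp Primrec.fst) Primrec.snd)).to₂

theorem primrec_partner : Primrec partner :=
  Primrec.ite (Primrec.eq.comp (Primrec.nat_mod.comp Primrec.id (Primrec.const 2))
    (Primrec.const 0)) Primrec.succ (Primrec.nat_sub.comp Primrec.id (Primrec.const 1))

theorem primrec_copyMove {α : Type*} [Primcodable α] {As : α → List Addr} {k a r : α → ℕ}
    {m : α → Move} (hAs : Primrec As) (hk : Primrec k) (hm : Primrec m) (ha : Primrec a)
    (hr : Primrec r) : Primrec fun x => copyMove (As x) (k x) (m x) (a x) (r x) := by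
  have h1 : Primrec fun x : (α × Addr) × Addr => addrMove (oracle (r x.1.1)) x.1.2 (m x.1.1) :=
    primrec_addrMove.comp (g := fun x : (α × Addr) × Addr => ((r x.1.1, x.1.2), m x.1.1))
      (Primrec.pair (Primrec.pair (hr.comp (Primrec.fst.comp Primrec.fst))
        (Primrec.snd.comp Primrec.fst)) (hm.comp (Primrec.fst.comp Primrec.fst)))
  have h2 : Primrec₂ fun (x : (α × Addr) × Addr) (β : Move) =>
      build (oracle (r x.1.1)) (k x.1.1) x.2 β :=
    Primrec₂.mk (primrec_build.comp
      (g := fun x : ((α × Addr) × Addr) × Move => ((r x.1.1.1, k x.1.1.1), x.1.2, x.2))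
      (Primrec.pair (Primrec.pair (hr.comp (Primrec.fst.comp (Primrec.fst.comp Primrec.fst)))
        (hk.comp (Primrec.fst.comp (Primrec.fst.comp Primrec.fst))))
        (Primrec.pair (Primrec.snd.comp Primrec.fst) Primrec.snd)))
  have h3 : Primrec₂ fun (x : α × Addr) (B : Addr) =>
      (addrMove (oracle (r x.1)) x.2 (m x.1)).map (build (oracle (r x.1)) (k x.1) B) :=
    Primrec.option_map h1 h2
  have h4 : Primrec fun x : α × Addr => (As x.1)[partner (a x.1)]? :=
    Primrec.list_getElem?.comp (hAs.comp Primrec.fst) (primrec_partner.comp (ha.comp Primrec.fst))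
  have h5 : Primrec₂ fun (x : α) (A : Addr) => (As x)[partner (a x)]?.bind fun B =>
      (addrMove (oracle (r x)) A (m x)).map (build (oracle (r x)) (k x) B) :=
    Primrec.option_bind h4 h3
  exact Primrec.option_bind (Primrec.list_getElem?.comp hAs ha) h5

theorem primrec_addrVars : Primrec addrVars := by
  refine Primrec.list_flatMap Primrec.id (Primrec₂.mk ?_)
  have h : Primrec fun s : Step => (Sum.casesOn s (fun _ => []) (fun L => L) : List ℕ) :=
    Primrec.sumCasesOn Primrec.id (Primrec₂.const []) Primrec₂.right
  refine (h.comp Primrec.snd).of_eq fun x => ?_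
  obtain ⟨_, _ | L⟩ := x <;> rfl

theorem primrec_depth : Primrec₂ depth :=
  Primrec₂.mk (Primrec.nat_mul.comp Primrec.snd (Primrec.succ.comp (Primrec.list_length.comp
    (primrec_addrVars.comp (Primrec.list_flatten.comp Primrec.fst)))))

theorem primrec_copies : Primrec fun x : (ℕ × List Addr) × ℕ × Move =>
    copies x.1.1 x.1.2 x.2.1 x.2.2 := by
  have hAs : Primrec fun x : (ℕ × List Addr) × ℕ × Move => x.1.2 := Primrec.snd.comp Primrec.fst
  have hk : Primrec fun x : (ℕ × List Addr) × ℕ × Move => x.2.1 := Primrec.fst.comp Primrec.snd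
  have hb : Primrec fun x : (ℕ × List Addr) × ℕ × Move =>
      2 ^ (x.1.1 + depth x.1.2 x.2.1 + 1) ^ 2 :=
    primrec_pow.comp (Primrec.const 2) (primrec_pow.comp (Primrec.succ.comp (Primrec.nat_add.comp
      (Primrec.fst.comp Primrec.fst) (primrec_depth.comp hAs hk))) (Primrec.const 2))
  refine Primrec.list_flatMap (Primrec.list_range.comp (Primrec.list_length.comp hAs))
    (Primrec₂.mk ?_)
  refine Primrec.listFilterMap (Primrec.list_range.comp (hb.comp Primrec.fst)) (Primrec₂.mk ?_)
  exact primrec_copyMove (hAs.comp (Primrec.fst.comp Primrec.fst))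
    (hk.comp (Primrec.fst.comp Primrec.fst))
    ((Primrec.snd.comp Primrec.snd).comp (Primrec.fst.comp Primrec.fst))
    (Primrec.snd.comp Primrec.fst) Primrec.snd

theorem primrec_isTop : Primrec fun m : LabMove => decide (m.1 = Player.top) :=
  (Primrec.eq.comp Primrec.fst (Primrec.const Player.top)).decide

theorem primrec_beforeTail : Primrec beforeTail :=
  (Primrec.list_dropWhile primrec_isTop).comp Primrec.list_reverse

theorem primrec_tailMoves : Primrec tailMoves :=
  Primrec.list_map ((Primrec.list_takeWhile primrec_isTop).comp Primrec.list_reverse)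
    (Primrec₂.mk (Primrec.snd.comp Primrec.snd))

theorem primrec_totalLength : Primrec totalLength := by
  have h : Primrec fun Φ : List LabMove => Φ.foldr (fun m n => m.2.length + n) 0 :=
    Primrec.list_foldr (h := fun _ (y : LabMove × ℕ) => y.1.2.length + y.2) Primrec.id
      (Primrec.const 0) (Primrec₂.mk (Primrec.nat_add.comp (Primrec.list_length.comp
        (Primrec.snd.comp (Primrec.fst.comp Primrec.snd))) (Primrec.snd.comp Primrec.snd)))
  refine h.of_eq fun Φ => ?_
  rw [totalLength, List.sum_eq_foldr, List.foldr_map]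

theorem primrec_respond : Primrec₂ respond := by
  refine Primrec₂.mk (Primrec.option_bind
    (Primrec.list_head?.comp (primrec_beforeTail.comp Primrec.snd)) (Primrec₂.mk ?_))
  have hc : Primrec fun x : ((ℕ × List Addr) × List LabMove) × LabMove =>
      copies x.1.1.1 x.1.1.2 (totalLength (beforeTail x.1.2)) x.2.2 :=
    primrec_copies.comp (Primrec.pair (Primrec.fst.comp Primrec.fst) (Primrec.pair
      (primrec_totalLength.comp (primrec_beforeTail.comp (Primrec.snd.comp Primrec.fst)))
      (Primrec.snd.comp Primrec.snd)))
  have ht : Primrec fun x : ((ℕ × List Addr) × List LabMove) × LabMove => tailMoves x.1.2 :=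
    primrec_tailMoves.comp (Primrec.snd.comp Primrec.fst)
  refine Primrec.list_head?.comp ?_
  have h : Primrec fun x : ((ℕ × List Addr) × List LabMove) × LabMove =>
      (copies x.1.1.1 x.1.1.2 (totalLength (beforeTail x.1.2)) x.2.2).filterMap
        fun c => if c ∈ tailMoves x.1.2 then none else some c := by
    refine Primrec.listFilterMap hc (Primrec₂.mk (Primrec.ite
      (primrecPred_mem (ht.comp Primrec.fst) Primrec.snd) (Primrec.const none)
      (Primrec.option_some.comp Primrec.snd)))
  refine h.of_eq fun x => ?_
  rw [← List.filterMap_eq_filter]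
  refine List.filterMap_congr fun c _ => ?_
  by_cases hcm : c ∈ tailMoves x.1.2 <;> simp [Option.guard, hcm]

/-! ### The annotation of proofs is primitive recursive -/

theorem primrec_toNat : Primrec Formula.toNat := Primrec.of_equiv (e := Formula.equivNat)

theorem primrec_forms : Primrec Cirquent.forms :=
  Primrec.fst.comp (Primrec.of_equiv (e := Cirquent.equivProd))

theorem primrec_ugroups : Primrec Cirquent.ugroups :=
  Primrec.fst.comp (Primrec.snd.comp (Primrec.of_equiv (e := Cirquent.equivProd)))

theorem primrec_ogroups : Primrec Cirquent.ogroups :=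
  Primrec.snd.comp (Primrec.snd.comp (Primrec.of_equiv (e := Cirquent.equivProd)))

theorem primrec_six_mul_add {α : Type*} [Primcodable α] {f : α → ℕ} (hf : Primrec f) (c : ℕ) :
    Primrec fun x => 6 * f x + c :=
  Primrec.nat_add.comp (Primrec.nat_mul.comp (Primrec.const 6) hf) (Primrec.const c)

theorem primrec_disj : Primrec₂ Formula.disj :=
  Primrec₂.mk ((Primrec.of_equiv_iff Formula.equivNat).1 (primrec_six_mul_add
    (Primrec₂.natPair.comp (primrec_toNat.comp Primrec.fst) (primrec_toNat.comp Primrec.snd)) 3))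

theorem primrec_conj : Primrec₂ Formula.conj :=
  Primrec₂.mk ((Primrec.of_equiv_iff Formula.equivNat).1 (primrec_six_mul_add
    (Primrec₂.natPair.comp (primrec_toNat.comp Primrec.fst) (primrec_toNat.comp Primrec.snd)) 2))

theorem primrec_recur : Primrec Formula.recur :=
  (Primrec.of_equiv_iff Formula.equivNat).1 (primrec_six_mul_add primrec_toNat 4)

theorem primrec_corecur : Primrec Formula.corecur :=
  (Primrec.of_equiv_iff Formula.equivNat).1 (primrec_six_mul_add primrec_toNat 5)

section Rules

variable {α : Type*} [Primcodable α] {k i a n v : α → ℕ}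

theorem primrecPred_inGroup {X : α → Group} (hX : Primrec X) (ha : Primrec a) :
    PrimrecPred fun x => InGroup (X x) (a x) :=
  Primrec.eq.comp (Primrec.list_getElem?.comp hX ha) (Primrec.const (some true))

theorem primrecPred_eq_const (hk : Primrec k) (c : ℕ) : PrimrecPred fun x => k x = c :=
  Primrec.eq.comp hk (Primrec.const c)

theorem primrec_parent (hk : Primrec k) (hi : Primrec i) (ha : Primrec a) :
    Primrec fun x => parent (k x) (i x) (a x) := by
  have hi1 := Primrec.succ.comp hi
  refine Primrec.ite (primrecPred_eq_const hk 1)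
    (Primrec.ite (Primrec.eq.comp ha hi) hi1 (Primrec.ite (Primrec.eq.comp ha hi1) hi ha))
    (Primrec.ite (primrecPred_eq_const hk 2)
      (Primrec.ite (Primrec.nat_lt.comp ha hi) ha (Primrec.succ.comp ha))
      (Primrec.ite ((Primrec.nat_le.comp (Primrec.const 3) hk).and
          (Primrec.nat_le.comp hk (Primrec.const 5)))
        (Primrec.ite (Primrec.nat_le.comp ha hi) ha
          (Primrec.nat_sub.comp ha (Primrec.const 1))) ha))

theorem primrec_extension (hk : Primrec k) (hi : Primrec i) (hv : Primrec v) {L : α → List ℕ}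
    (hL : Primrec L) (ha : Primrec a) :
    Primrec fun x => extension (k x) (i x) (v x) (L x) (a x) := by
  have hk3 : Primrec fun x => decide (k x = 3) := (primrecPred_eq_const hk 3).decide
  have hk5 : PrimrecPred fun x => k x ≤ 5 := Primrec.nat_le.comp hk (Primrec.const 5)
  have hone : ∀ {s : α → Step}, Primrec s → Primrec fun x => [s x] := fun hs =>
    Primrec.list_cons.comp hs (Primrec.const [])
  have hinl : ∀ b : Bool, Primrec fun x => ([.inl (decide (k x = 3), b)] : Addr) := fun b =>
    hone (Primrec.sumInl.comp (Primrec.pair hk3 (Primrec.const b)))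
  refine Primrec.ite (Primrec.nat_lt.comp hk (Primrec.const 3)) (Primrec.const [])
    (Primrec.ite (Primrec.eq.comp ha hi)
      (Primrec.ite hk5 (hinl false) (Primrec.ite (primrecPred_eq_const hk 6)
        (hone (Primrec.sumInr.comp (Primrec.list_cons.comp hv (Primrec.const []))))
        (hone (Primrec.sumInr.comp hL))))
      (Primrec.ite ((Primrec.eq.comp ha (Primrec.succ.comp hi)).and hk5) (hinl true)
        (Primrec.const [])))

theorem primrecPred_cover (hk : Primrec k) (hi : Primrec i) (hn : Primrec n) {X Y : α → Group}
    (hX : Primrec X) (hY : Primrec Y) :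
    PrimrecPred fun x => Cover (k x) (i x) (n x) (X x) (Y x) :=
  primrecPred_forall_lt hn (primrecPred_imp
    (primrecPred_inGroup (hX.comp Primrec.fst) Primrec.snd)
    (((primrecPred_eq_const (hk.comp Primrec.fst) 7).and
      (Primrec.eq.comp Primrec.snd (hi.comp Primrec.fst))).or
      (primrecPred_inGroup (hY.comp Primrec.fst)
        (primrec_parent (hk.comp Primrec.fst) (hi.comp Primrec.fst) Primrec.snd))))

theorem primrecPred_sole (hi : Primrec i) (hn : Primrec n) {X : α → Group} (hX : Primrec X) :
    PrimrecPred fun x => Sole (i x) (n x) (X x) :=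
  primrecPred_forall_lt hn (primrecPred_imp
    (primrecPred_inGroup (hX.comp Primrec.fst) Primrec.snd)
    (Primrec.eq.comp Primrec.snd (hi.comp Primrec.fst)))

theorem primrecPred_splitOk (hk : Primrec k) {G E H : α → Option Formula} (hG : Primrec G)
    (hE : Primrec E) (hH : Primrec H) : PrimrecPred fun x => SplitOk (k x) (G x) (E x) (H x) := by
  have hto : Primrec fun x => (G x).elim 0 Formula.toNat := by
    refine (Primrec.option_getD.comp ((Primrec.option_map₁ primrec_toNat).comp hG)
      (Primrec.const 0)).of_eq fun x => ?_
    cases G x <;> rfl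
  have hbind : ∀ {f : Formula → Formula → Formula}, Primrec₂ f →
      Primrec fun x => (E x).bind fun e => (H x).map (f e) := fun {f} hf => by
    have h2 : Primrec₂ fun (x : α × Formula) (h : Formula) => f x.2 h :=
      hf.comp (Primrec.snd.comp Primrec.fst) Primrec.snd
    have h1 : Primrec₂ fun (x : α) (e : Formula) => (H x).map (f e) :=
      Primrec.option_map (hH.comp Primrec.fst) h2
    exact Primrec.option_bind hE h1
  have hmap : ∀ {f : Formula → Formula}, Primrec f → Primrec fun x => (E x).map f := fun hf =>
    (Primrec.option_map₁ hf).comp hE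
  exact (primrecPred_imp (primrecPred_eq_const hk 3) ((Primrec.eq.comp hG hE).and
      ((Primrec.eq.comp hG hH).and (primrecPred_eq_const
        (Primrec.nat_mod.comp hto (Primrec.const 6)) 5)))).and
    ((primrecPred_imp (primrecPred_eq_const hk 4) (Primrec.eq.comp hG (hbind primrec_disj))).and
    ((primrecPred_imp (primrecPred_eq_const hk 5) (Primrec.eq.comp hG (hbind primrec_conj))).and
    ((primrecPred_imp (primrecPred_eq_const hk 6) (Primrec.eq.comp hG (hmap primrec_recur))).and
    (primrecPred_imp (primrecPred_eq_const hk 7) (Primrec.eq.comp hG (hmap primrec_corecur))))))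

theorem primrec_avoid (hk : Primrec k) (hi : Primrec i) (hn : Primrec n) :
    Primrec fun x => avoid (k x) (i x) (n x) :=
  Primrec.ite (primrecPred_eq_const hk 5)
    (Primrec.list_cons.comp hi (Primrec.list_cons.comp (Primrec.succ.comp hi) (Primrec.const [])))
    (Primrec.list_cons.comp hn (Primrec.const []))

theorem primrecPred_ruleOk (hk : Primrec k) (hi : Primrec i) {A C : α → Cirquent} (hA : Primrec A)
    (hC : Primrec C) : PrimrecPred fun x => RuleOk (k x) (i x) (A x) (C x) := by
  have hAf := primrec_forms.comp hA
  have hCf := primrec_forms.comp hC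
  have hn := Primrec.list_length.comp hAf
  have hk3 : PrimrecPred fun x => 3 ≤ k x := Primrec.nat_le.comp (Primrec.const 3) hk
  have hk5 : PrimrecPred fun x => k x ≤ 5 := Primrec.nat_le.comp hk (Primrec.const 5)
  have hi1 := Primrec.succ.comp hi
  have h1 : PrimrecPred fun x => 3 ≤ k x → i x < (C x).forms.length :=
    primrecPred_imp hk3 (Primrec.nat_lt.comp hi (Primrec.list_length.comp hCf))
  have h2 : PrimrecPred fun x => k x < 8 := Primrec.nat_lt.comp hk (Primrec.const 8)
  have h3 : PrimrecPred fun x => ∀ a < (A x).forms.length, (a = i x ∧ 3 ≤ k x) ∨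
      (a = i x + 1 ∧ 3 ≤ k x ∧ k x ≤ 5) ∨
        (A x).forms[a]? = (C x).forms[parent (k x) (i x) a]? :=
    primrecPred_forall_lt hn (((Primrec.eq.comp Primrec.snd (hi.comp Primrec.fst)).and
      (hk3.comp Primrec.fst)).or (((Primrec.eq.comp Primrec.snd (hi1.comp Primrec.fst)).and
        ((hk3.comp Primrec.fst).and (hk5.comp Primrec.fst))).or
      (Primrec.eq.comp (Primrec.list_getElem?.comp (hAf.comp Primrec.fst) Primrec.snd)
        (Primrec.list_getElem?.comp (hCf.comp Primrec.fst)
          (primrec_parent (hk.comp Primrec.fst) (hi.comp Primrec.fst) Primrec.snd)))))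
  have h4 : PrimrecPred fun x =>
      SplitOk (k x) (C x).forms[i x]? (A x).forms[i x]? (A x).forms[i x + 1]? :=
    primrecPred_splitOk hk (Primrec.list_getElem?.comp hCf hi)
      (Primrec.list_getElem?.comp hAf hi) (Primrec.list_getElem?.comp hAf hi1)
  have h5 : PrimrecPred fun x => ∀ Y ∈ (C x).ogroups, ∀ a < (A x).forms.length,
      InGroup Y (parent (k x) (i x) a) → ∃ X ∈ (A x).ogroups, InGroup X a ∧
        Cover (k x) (i x) (A x).forms.length X Y := by
    refine primrecPred_forall_mem (primrec_ogroups.comp hC)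
      (primrecPred_forall_lt (hn.comp Primrec.fst) ?_)
    have f1 : Primrec fun x : (α × Group) × ℕ => x.1.1 := Primrec.fst.comp Primrec.fst
    have f2 : Primrec fun x : (α × Group) × ℕ => x.1.2 := Primrec.snd.comp Primrec.fst
    refine primrecPred_imp (primrecPred_inGroup f2
      (primrec_parent (hk.comp f1) (hi.comp f1) Primrec.snd)) (primrecPred_exists_mem
      ((primrec_ogroups.comp hA).comp f1) ((primrecPred_inGroup Primrec.snd
        (Primrec.snd.comp Primrec.fst)).and (primrecPred_cover ((hk.comp f1).comp Primrec.fst)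
          ((hi.comp f1).comp Primrec.fst) ((hn.comp f1).comp Primrec.fst) Primrec.snd
          (f2.comp Primrec.fst))))
  have h6 : PrimrecPred fun x => k x = 6 → ∃ X ∈ (A x).ogroups, InGroup X (i x) ∧
      Sole (i x) (A x).forms.length X :=
    primrecPred_imp (primrecPred_eq_const hk 6) (primrecPred_exists_mem (primrec_ogroups.comp hA)
      ((primrecPred_inGroup Primrec.snd (hi.comp Primrec.fst)).and
        (primrecPred_sole (hi.comp Primrec.fst) (hn.comp Primrec.fst) Primrec.snd)))
  have h7 : PrimrecPred fun x => ∀ Y ∈ (C x).ugroups, ∀ b ∈ avoid (k x) (i x) (A x).forms.length,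
      ∃ X ∈ (A x).ugroups, ¬ InGroup X b ∧ ∀ a < (A x).forms.length, InGroup X a →
        InGroup Y (parent (k x) (i x) a) := by
    refine primrecPred_forall_mem (primrec_ugroups.comp hC)
      (primrecPred_forall_mem ((primrec_avoid hk hi hn).comp Primrec.fst) ?_)
    have f1 : Primrec fun x : (α × Group) × ℕ => x.1.1 := Primrec.fst.comp Primrec.fst
    have f2 : Primrec fun x : (α × Group) × ℕ => x.1.2 := Primrec.snd.comp Primrec.fst
    refine primrecPred_exists_mem ((primrec_ugroups.comp hA).comp f1)
      ((primrecPred_inGroup Primrec.snd (Primrec.snd.comp Primrec.fst)).not.and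
        (primrecPred_forall_lt ((hn.comp f1).comp Primrec.fst) ?_))
    have f3 : Primrec fun x : (((α × Group) × ℕ) × Group) × ℕ => x.1.1 :=
      Primrec.fst.comp Primrec.fst
    exact primrecPred_imp (primrecPred_inGroup (Primrec.snd.comp Primrec.fst) Primrec.snd)
      (primrecPred_inGroup (f2.comp f3) (primrec_parent ((hk.comp f1).comp f3)
        ((hi.comp f1).comp f3) Primrec.snd))
  exact h1.and (h2.and (h3.and (h4.and (h5.and (h6.and h7)))))

theorem primrec_findRule {A C : α → Cirquent} (hA : Primrec A) (hC : Primrec C) :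
    Primrec fun x => findRule (A x) (C x) := by
  have hlen := Primrec.list_length.comp (primrec_forms.comp hC)
  have h1 : Primrec₂ fun (x : α × ℕ) (i : ℕ) =>
      if RuleOk x.2 i (A x.1) (C x.1) then some (x.2, i) else none := by
    have f1 : Primrec fun x : (α × ℕ) × ℕ => x.1.1 := Primrec.fst.comp Primrec.fst
    have f2 : Primrec fun x : (α × ℕ) × ℕ => x.1.2 := Primrec.snd.comp Primrec.fst
    exact Primrec.ite (primrecPred_ruleOk f2 Primrec.snd (hA.comp f1) (hC.comp f1))
      (Primrec.option_some.comp (Primrec.pair f2 Primrec.snd)) (Primrec.const none)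
  have h2 : Primrec₂ fun (x : α) (k : ℕ) => (List.range ((C x).forms.length + 1)).filterMap fun i =>
      if RuleOk k i (A x) (C x) then some (k, i) else none :=
    Primrec.listFilterMap (Primrec.list_range.comp ((Primrec.succ.comp hlen).comp Primrec.fst)) h1
  exact Primrec.option_getD.comp (Primrec.list_head?.comp
    (Primrec.list_flatMap (Primrec.const (List.range 8)) h2)) (Primrec.const (0, 0))

theorem primrec_nextTerms (hk : Primrec k) (hi : Primrec i) (hv : Primrec v) (hn : Primrec n)
    {T : α → List (Group × List ℕ)} (hT : Primrec T) {O : α → List Group} (hO : Primrec O) :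
    Primrec fun x => nextTerms (k x) (i x) (v x) (n x) (T x) (O x) := by
  have h1 : Primrec₂ fun (x : α × Group) (y : Group × List ℕ) =>
      if Cover (k x.1) (i x.1) (n x.1) x.2 y.1 then y.2 else [] := by
    have f1 : Primrec fun x : (α × Group) × Group × List ℕ => x.1.1 := Primrec.fst.comp Primrec.fst
    exact Primrec.ite (primrecPred_cover (hk.comp f1) (hi.comp f1) (hn.comp f1)
      (Primrec.snd.comp Primrec.fst) (Primrec.fst.comp Primrec.snd))
      (Primrec.snd.comp Primrec.snd) (Primrec.const [])
  have h2 : Primrec fun x : α × Group => (T x.1).flatMap fun y =>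
      if Cover (k x.1) (i x.1) (n x.1) x.2 y.1 then y.2 else [] :=
    Primrec.list_flatMap (hT.comp Primrec.fst) h1
  have h3 : Primrec fun x : α × Group =>
      if k x.1 = 6 ∧ Sole (i x.1) (n x.1) x.2 then [v x.1] else [] :=
    Primrec.ite ((primrecPred_eq_const (hk.comp Primrec.fst) 6).and
      (primrecPred_sole (hi.comp Primrec.fst) (hn.comp Primrec.fst) Primrec.snd))
      (Primrec.list_cons.comp (hv.comp Primrec.fst) (Primrec.const [])) (Primrec.const [])
  exact Primrec.list_map hO (Primrec₂.mk (Primrec.pair Primrec.snd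
    (Primrec.list_append.comp h2 h3)))

theorem primrec_joined (hi : Primrec i) {T : α → List (Group × List ℕ)} (hT : Primrec T) :
    Primrec fun x => joined (i x) (T x) :=
  Primrec.list_flatMap hT (Primrec₂.mk (Primrec.ite (primrecPred_inGroup
    (Primrec.fst.comp Primrec.snd) (hi.comp Primrec.fst)) (Primrec.snd.comp Primrec.snd)
    (Primrec.const [])))

theorem primrec_nextAnnot (hk : Primrec k) (hi : Primrec i) {A : α → Cirquent} (hA : Primrec A)
    {s : α → Annot} (hs : Primrec s) : Primrec fun x => nextAnnot (k x) (i x) (A x) (s x) := by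
  have hn := Primrec.list_length.comp (primrec_forms.comp hA)
  have hv : Primrec fun x => (s x).1 := Primrec.fst.comp hs
  have hAs : Primrec fun x => (s x).2.1 := Primrec.fst.comp (Primrec.snd.comp hs)
  have hT := primrec_nextTerms hk hi hv hn (Primrec.snd.comp (Primrec.snd.comp hs))
    (primrec_ogroups.comp hA)
  have hL := primrec_joined hi hT
  have h1 : Primrec₂ fun (x : α) (a : ℕ) => (s x).2.1.getD (parent (k x) (i x) a) [] ++
      extension (k x) (i x) (s x).1 (joined (i x) (nextTerms (k x) (i x) (s x).1
        (A x).forms.length (s x).2.2 (A x).ogroups)) a :=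
    Primrec.list_append.comp ((Primrec.list_getD []).comp (hAs.comp Primrec.fst)
      (primrec_parent (hk.comp Primrec.fst) (hi.comp Primrec.fst) Primrec.snd))
      (primrec_extension (hk.comp Primrec.fst) (hi.comp Primrec.fst) (hv.comp Primrec.fst)
        (hL.comp Primrec.fst) Primrec.snd)
  exact Primrec.pair (Primrec.succ.comp hv) (Primrec.pair
    (Primrec.list_map (Primrec.list_range.comp hn) h1) hT)

end Rules

theorem primrec_annotStep : Primrec₂ annotStep := by
  have hf : Primrec fun x : (Cirquent × Option (Annot × Cirquent)) × Annot × Cirquent =>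
      findRule x.1.1 x.2.2 :=
    primrec_findRule (Primrec.fst.comp Primrec.fst) (Primrec.snd.comp Primrec.snd)
  have h1 : Primrec₂ fun (x : Cirquent × Option (Annot × Cirquent)) (y : Annot × Cirquent) =>
      (nextAnnot (findRule x.1 y.2).1 (findRule x.1 y.2).2 x.1 y.1, x.1) :=
    Primrec.pair (primrec_nextAnnot (Primrec.fst.comp hf) (Primrec.snd.comp hf)
      (Primrec.fst.comp Primrec.fst) (Primrec.fst.comp Primrec.snd))
      (Primrec.fst.comp Primrec.fst)
  refine Primrec₂.mk ((Primrec.option_casesOn (Primrec.snd : Primrec fun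
    x : Cirquent × Option (Annot × Cirquent) => x.2) (Primrec.pair (Primrec.const rootAnnot)
      Primrec.fst) h1).of_eq fun x => ?_)
  obtain ⟨A, _ | ⟨s, C⟩⟩ := x <;> rfl

theorem primrec_annotate : Primrec annotate :=
  Primrec.list_foldr (h := fun _ (y : Cirquent × Option (Annot × Cirquent)) =>
    some (annotStep y.1 y.2)) Primrec.id (Primrec.const none)
    (Primrec₂.mk (Primrec.option_some.comp (primrec_annotStep.comp
      (Primrec.fst.comp Primrec.snd) (Primrec.snd.comp Primrec.snd))))

theorem primrec_strategyOf : Primrec strategyOf := by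
  have h1 : Primrec₂ fun (_ : List Cirquent) (x : Annot × Cirquent) => (x.1.1, x.1.2.1) :=
    Primrec.pair (Primrec.fst.comp (Primrec.fst.comp Primrec.snd))
      (Primrec.fst.comp (Primrec.snd.comp (Primrec.fst.comp Primrec.snd)))
  refine (Primrec.option_casesOn primrec_annotate (Primrec.const (0, [])) h1).of_eq fun P => ?_
  rw [strategyOf]
  cases annotate P <;> rfl

/-! ### Extraction of uniform solutions -/

/-- The code of the data extracted from the proof is the parameter of the one machine scheme for
copycat play. -/
theorem exists_extraction : ∃ f : List Cirquent → EPM, Computable f ∧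
    ∀ (F : Formula) (P : List Cirquent), IsProof P F → (f P).IsUniformSolution F := by
  have hS : Primrec₂ fun (n : ℕ) (Φ : List LabMove) =>
      -- The default concerns only numbers that code nothing; the parameters in use are codes.
      respond ((Encodable.decode (α := ℕ × List Addr) n).getD (0, [])) Φ :=
    primrec_respond.comp (Primrec.option_getD.comp (Primrec.decode.comp Primrec.fst)
      (Primrec.const (0, []))) Primrec.snd
  obtain ⟨M, hM, hspec⟩ := exists_machine hS
  refine ⟨fun P => M (Encodable.encode (strategyOf P)),
    (hM.comp (Primrec.encode.comp primrec_strategyOf)).to_comp, fun F P hP I B hB => ?_⟩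
  obtain ⟨p, h0, hstep, hrun, hfair⟩ := hspec _ B hB
  simp only [Encodable.encodek, Option.getD_some] at hstep hfair
  obtain ⟨h1, h2⟩ := strategyOf_wins hP h0 hstep
  rw [hrun]
  exact ⟨h2 I, Or.inl (hfair h1)⟩

end CoL

theorem theorem4p8 :
    (∀ F : CoL.Formula, CoL.Provable F → CoL.UniformlyValid F) ∧
    ∃ f : List CoL.Cirquent → CoL.EPM, Computable f ∧
      ∀ (F : CoL.Formula) (P : List CoL.Cirquent), CoL.IsProof P F →
        CoL.EPM.IsUniformSolution (f P) F := by
  obtain ⟨f, hf, h⟩ := CoL.exists_extraction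
  exact ⟨fun F ⟨P, hP⟩ => ⟨f P, h F P hP⟩, f, hf, h⟩
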